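/- **Setting.** Let $E$ be a commutative unital C*-algebra, $T$ a group, $(T_n)_{n\ge 0}$ an increasing sequence of finite subgroups of $T$ with $T_0=\{1\}$ and $\bigcup_n T_n=T$, and $f:T\times T\to \mathrm{Un}\,E$ a Schur $E$-function for $T$, i.e. $f(1,1)=1$ and $f(r,s)f(rs,t)=f(r,st)f(s,t)$ for all $r,s,t\in T$ ($\mathrm{Un}$ and $\mathrm{Pr}$ denote the set of unitaries and the set of orthogonal projections). An *$E$-C*-algebra* is a C*-algebra $F$ which is a unital $E$-module with $\|\alpha x\|\le\|\alpha\|\|x\|$, $(\alpha x)^*=\alpha^*x^*$, $\alpha(xy)=(\alpha x)y=x(\alpha y)$, the actions of $\mathbb C$ and $E$ being compatible; the morphisms of $E$-C*-algebras are the $E$-linear C*-homomorphisms. $\check F$ denotes the unital C*-algebra $E\times F$ with $(\alpha,x)(\beta,y)=(\alpha\beta,\alpha y+\beta x+xy)$ and $(\alpha,x)^*=(\alpha^*,x^*)$; $\pi^F:\check F\to E$, $(\alpha,x)\mapsto\alpha$; $\sigma^F:\check F\to\check F$, $(\alpha,x)\mapsto(\alpha,0)$; and $\check\varphi:\check F\to\check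 G$, $(\alpha,x)\mapsto(\alpha,\varphi x)$ for every morphism $\varphi:F\to G$. For a unital $E$-C*-algebra $R$ and $n\ge 0$, $R_n$ is the C*-algebra of all operators $\sum_{t\in T_n}(X_t\otimes \mathrm{id})V_t$ $(X_t\in R)$ on the Hilbert right $R$-module $R^{T_n}$, where $(V_t\xi)(s)=f(t,t^{-1}s)\,\xi(t^{-1}s)$ and $X_t\otimes\mathrm{id}$ is left multiplication by $X_t$ in every coordinate. $R_{n-1}$ is identified with a subalgebra of $R_n$ by extending the family of coefficients $(X_t)$ by $0$; $E_n$ is mapped into $R_n$ through $\alpha\mapsto\alpha 1_R$; a unital morphism $\varphi:R\to R'$ induces $\varphi_n:R_n\to R'_n$ by application to the coefficients. Let elements $C_n\in E_n$ $(n\ge1)$ be given such that $A_n:=C_n^*C_n$ and $B_n:=C_nC_n^*$ are orthogonal projections, $A_n+B_n=1$, and $C_n$ commutes with every element of $E_{n-1}$. **$K_0$.** Let $R_\to$ be the algebraic inductive limit of the sequence $R_{n-1}\to R_n$, $X\mapsto A_nX$. The Murray–von Neumann classes of $\mathrm{Pr}\,R_\to$ form a commutative monoid, the sum of two classes being the class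 of the sum of orthogonal representatives; $K_0^{\mathrm{full}}(R)$ denotes its Grothendieck group and $[P]_0$ the class of $P\in\mathrm{Pr}\,R_n$. For an $E$-C*-algebra $F$, $K_0(F):=\ker\big(K_0^{\mathrm{full}}(\check F)\to K_0^{\mathrm{full}}(E),\ [P]_0\mapsto[\pi^F_nP]_0\big)$, and $K_0(\varphi)$ is the restriction of $[P]_0\mapsto[\check\varphi_nP]_0$. **$K_1$.** Let $\mathrm{un}\,R$ be the inductive limit of the sequence of groups $\mathrm{Un}\,R_{n-1}\to\mathrm{Un}\,R_n$, $U\mapsto A_nU+B_n$, and $\mathrm{un}_ER$ the subgroup of all classes of those $U\in\mathrm{Un}\,R_n$, $n\ge0$, which are homotopic in $\mathrm{Un}\,R_n$ to (the image of) an element of $\mathrm{Un}\,E_n$. For an $E$-C*-algebra $F$, $K_1(F):=\mathrm{un}\,\check F/\mathrm{un}_E\check F$, which is commutative and written additively; $[U]_1$ is the class of $U\in \mathrm{Un}\,\check F_n$, and $K_1(\varphi)[U]_1=[\check\varphi_nU]_1$. **Theorem.** Let $0\to F\xrightarrow{\varphi}G\xrightarrow{\psi}H\to0$ be an exact sequence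 of $E$-C*-algebras and morphisms of $E$-C*-algebras. For every $n\ge1$ and every $U\in\mathrm{Un}\,\check H_{n-1}$ there are $V\in\mathrm{Un}\,\check G_n$ and $P\in\mathrm{Pr}\,\check F_n$ with $$\check\psi_nV=A_nU+B_nU^*,\qquad \check\varphi_nP=VA_nV^*,$$ and there is a unique group homomorphism $\delta_1:K_1(H)\to K_0(F)$ (the index map) such that $\delta_1[U]_1=[P]_0-[\sigma^F_nP]_0$ for all such $n,U,V,P$. The sequence $$K_1(F)\xrightarrow{K_1(\varphi)}K_1(G)\xrightarrow{K_1(\psi)}K_1(H)\xrightarrow{\ \delta_1\ }K_0(F)\xrightarrow{K_0(\varphi)}K_0(G)\xrightarrow{K_0(\psi)}K_0(H)$$ is exact (at $K_1(G)$, $K_1(H)$, $K_0(F)$ and $K_0(G)$). -/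

import Mathlib

set_option linter.unusedSectionVars false
set_option linter.unusedSimpArgs false

noncomputable section

namespace ProjK

universe u v w

open scoped Topology

/-! ### The unital algebra `F̌ = E × F` of an `E`-C*-algebra `F` -/

/-- For an `E`-C*-algebra `F`, the algebra `F̌`: the vector space `E × F` with multiplication
`(α, x)(β, y) = (αβ, αy + βx + xy)` and involution `(α, x)* = (α*, x*)`. -/
def Check (E : Type u) (F : Type w) : Type (max u w) := Unitization E F

namespace Check

section Algebra

variable (E : Type u) (F : Type w) [CommCStarAlgebra E] [NonUnitalCStarAlgebra F] [Module E F]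
  [IsScalarTower ℂ E F] [IsScalarTower E F F] [SMulCommClass E F F] [StarModule E F]

instance instRing : Ring (Check E F) := inferInstanceAs (Ring (Unitization E F))
instance instStarRing : StarRing (Check E F) := inferInstanceAs (StarRing (Unitization E F))
instance instAlgebraComplex : Algebra ℂ (Check E F) :=
  inferInstanceAs (Algebra ℂ (Unitization E F))
instance instAlgebra : Algebra E (Check E F) := inferInstanceAs (Algebra E (Unitization E F))
instance instStarModule : StarModule E (Check E F) :=
  inferInstanceAs (StarModule E (Unitization E F))
instance instIsScalarTower : IsScalarTower ℂ E (Check E F) :=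
  inferInstanceAs (IsScalarTower ℂ E (Unitization E F))

end Algebra

section Norm

variable {E : Type u} {F : Type w} [CommCStarAlgebra E] [NonUnitalCStarAlgebra F] [Module E F]
  [IsScalarTower ℂ E F] [IsScalarTower E F F] [SMulCommClass E F F] [StarModule E F]
  [IsBoundedSMul E F]

/-- `Check E F` is the vector space `E × F`. -/
def toProd : Check E F ≃+ E × F := Unitization.addEquiv E F

/-- Left multiplication of `F̌` on its ideal `F`: `(α, x) y = α y + x y`. -/
def lrepAux (x : Check E F) : F →L[ℂ] F :=
  LinearMap.mkContinuous
    { toFun := fun y => (toProd x).1 • y + (toProd x).2 * y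
      map_add' := fun y z => by rw [smul_add, mul_add]; abel
      map_smul' := fun c y => by
        rw [RingHom.id_apply, smul_add, mul_smul_comm, ← smul_one_smul E c y,
          ← smul_one_smul E c ((toProd x).1 • y), smul_smul, smul_smul, mul_comm] }
    (‖(toProd x).1‖ + ‖(toProd x).2‖) (fun y => by
      rw [add_mul]
      exact (norm_add_le _ _).trans (add_le_add (norm_smul_le _ _) (norm_mul_le _ _)))

theorem lrepAux_apply (x : Check E F) (y : F) :
    lrepAux x y = (toProd x).1 • y + (toProd x).2 * y := rfl

theorem toProd_mul (x y : Check E F) : toProd (x * y) =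
    ((toProd x).1 * (toProd y).1, (toProd x).1 • (toProd y).2 + (toProd y).1 • (toProd x).2
      + (toProd x).2 * (toProd y).2) := rfl

theorem toProd_star (x : Check E F) :
    toProd (star x) = (star (toProd x).1, star (toProd x).2) := rfl

theorem toProd_one : toProd (1 : Check E F) = (1, 0) := rfl

theorem toProd_smul (c : ℂ) (x : Check E F) : toProd (c • x) = c • toProd x := rfl

theorem toProd_algebraMap (α : E) : toProd (algebraMap E (Check E F) α) = (α, 0) := rfl

/-- The injective homomorphism `F̌ → E × B(F)`, `(α, x) ↦ (α, y ↦ α y + x y)`. -/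
def lrep : Check E F →ₐ[ℂ] E × (F →L[ℂ] F) where
  toFun x := ((toProd x).1, lrepAux x)
  map_one' := Prod.ext (by simp [toProd_one]) (by
    ext y; simp [lrepAux_apply, toProd_one])
  map_mul' x y := Prod.ext (by simp [toProd_mul]) (by
    ext z
    simp only [Prod.snd_mul, ContinuousLinearMap.mul_apply', lrepAux_apply, toProd_mul,
      ContinuousLinearMap.mul_def, ContinuousLinearMap.comp_apply,
      smul_add, mul_add, add_mul, smul_smul, mul_smul_comm, smul_mul_assoc, mul_assoc]
    abel)
  map_zero' := Prod.ext (by simp) (by ext z; simp [lrepAux_apply])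
  map_add' x y := Prod.ext (by simp) (by
    ext z; simp only [lrepAux_apply, map_add, Prod.fst_add, Prod.snd_add, add_smul, add_mul,
      add_apply]; abel)
  commutes' c := by
    rw [Algebra.algebraMap_eq_smul_one, Algebra.algebraMap_eq_smul_one]
    refine Prod.ext (by simp [toProd_smul, toProd_one]) ?_
    ext z
    simp [lrepAux_apply, toProd_smul, toProd_one]

theorem lrep_apply (x : Check E F) : lrep x = ((toProd x).1, lrepAux x) := rfl

theorem norm_snd_le (x : Check E F) : ‖(toProd x).2‖ ≤ 2 * ‖lrep x‖ := by
  have h1 : ‖(toProd x).1‖ ≤ ‖lrep x‖ := norm_fst_le (lrep x)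
  have h2 : ‖lrepAux x‖ ≤ ‖lrep x‖ := _root_.norm_snd_le (lrep x)
  have key : ∀ b : F, ‖(toProd x).2 * b‖ ≤ (2 * ‖lrep x‖) * ‖b‖ := fun b => by
    have : (toProd x).2 * b = lrepAux x b - (toProd x).1 • b := by
      rw [lrepAux_apply]; abel
    rw [this, two_mul, add_mul]
    refine (norm_sub_le _ _).trans (add_le_add ?_ ?_)
    · exact (ContinuousLinearMap.le_opNorm _ _).trans (by gcongr)
    · exact (norm_smul_le _ _).trans (by gcongr)
  have h := key (star (toProd x).2)
  rw [CStarRing.norm_self_mul_star, norm_star] at h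
  rcases (norm_nonneg (toProd x).2).eq_or_lt with h0 | h0
  · rw [← h0]; positivity
  · exact le_of_mul_le_mul_right h h0

theorem lrep_injective : Function.Injective (lrep : Check E F → E × (F →L[ℂ] F)) := by
  rw [injective_iff_map_eq_zero]
  intro x hx
  have h1 : (toProd x).1 = 0 := congrArg Prod.fst hx
  have h2 : (toProd x).2 = 0 := by
    have := norm_snd_le x
    rw [hx, norm_zero, mul_zero] at this
    exact norm_le_zero_iff.mp this
  exact toProd.injective ((Prod.ext h1 h2).trans (map_zero toProd).symm)

/-- The norm of `F̌`: `‖(α, x)‖` is the maximum of `‖α‖` and the operator norm of left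
multiplication by `(α, x)` on `F`. -/
instance instNormedRing : NormedRing (Check E F) :=
  NormedRing.induced (Check E F) (E × (F →L[ℂ] F)) lrep lrep_injective

theorem norm_def (x : Check E F) : ‖x‖ = ‖lrep x‖ := rfl

theorem norm_eq (x : Check E F) : ‖x‖ = max ‖(toProd x).1‖ ‖lrepAux x‖ := rfl

instance instNormedAlgebra : NormedAlgebra ℂ (Check E F) where
  norm_smul_le c x := by
    rw [norm_def, norm_def, map_smul]
    exact norm_smul_le c (lrep x)

theorem norm_lrepAux_sq_le (x : Check E F) : ‖lrepAux x‖ ^ 2 ≤ ‖lrepAux (star x * x)‖ := by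
  have key : ∀ b : F, ‖lrepAux x b‖ ≤ Real.sqrt ‖lrepAux (star x * x)‖ * ‖b‖ := fun b => by
    have e : star (lrepAux x b) * lrepAux x b = star b * lrepAux (star x * x) b := by
      simp only [lrepAux_apply, toProd_mul, toProd_star, star_add, star_mul, star_smul, smul_add,
        mul_add, add_mul, smul_smul, mul_smul_comm, smul_mul_assoc, mul_assoc]
      rw [mul_comm (star (toProd x).1)]
      abel
    have h : ‖lrepAux x b‖ ^ 2 ≤ ‖lrepAux (star x * x)‖ * ‖b‖ ^ 2 := by
      rw [sq, ← CStarRing.norm_star_mul_self, e]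
      refine (norm_mul_le _ _).trans ?_
      rw [norm_star]
      calc ‖b‖ * ‖lrepAux (star x * x) b‖ ≤ ‖b‖ * (‖lrepAux (star x * x)‖ * ‖b‖) := by
            gcongr; exact ContinuousLinearMap.le_opNorm _ _
        _ = _ := by ring
    refine le_of_sq_le_sq ?_ (by positivity)
    rwa [mul_pow, Real.sq_sqrt (norm_nonneg _)]
  have := ContinuousLinearMap.opNorm_le_bound (lrepAux x) (Real.sqrt_nonneg _) key
  calc ‖lrepAux x‖ ^ 2 ≤ Real.sqrt ‖lrepAux (star x * x)‖ ^ 2 := by gcongr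
    _ = _ := Real.sq_sqrt (norm_nonneg _)

instance instCStarRing : CStarRing (Check E F) where
  norm_mul_self_le x := by
    have h1 : ‖(toProd x).1‖ * ‖(toProd x).1‖ ≤ ‖star x * x‖ := by
      rw [← CStarRing.norm_star_mul_self]
      exact norm_fst_le (lrep (star x * x))
    have h2 : ‖lrepAux x‖ * ‖lrepAux x‖ ≤ ‖star x * x‖ := by
      rw [← sq]
      exact (norm_lrepAux_sq_le x).trans (_root_.norm_snd_le (lrep (star x * x)))
    rw [norm_eq x]
    rcases max_cases ‖(toProd x).1‖ ‖lrepAux x‖ with h | h <;> rw [h.1]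
    · exact h1
    · exact h2

theorem lipschitz_toProd : LipschitzWith 2 (toProd : Check E F ≃+ E × F) := by
  rw [← Real.toNNReal_ofNat]
  refine AddMonoidHomClass.lipschitz_of_bound (toProd : Check E F ≃+ E × F) 2 fun x => ?_
  rw [Prod.norm_def]
  refine max_le ?_ (norm_snd_le x)
  have h1 : ‖(toProd x).1‖ ≤ ‖x‖ := norm_fst_le (lrep x)
  linarith [norm_nonneg x]

theorem antilipschitz_toProd : AntilipschitzWith 2 (toProd : Check E F ≃+ E × F) := by
  refine AddMonoidHomClass.antilipschitz_of_bound (toProd : Check E F ≃+ E × F) fun x => ?_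
  have h1 : ‖(toProd x).1‖ ≤ ‖toProd x‖ := norm_fst_le _
  have h2 : ‖(toProd x).2‖ ≤ ‖toProd x‖ := _root_.norm_snd_le _
  have h3 : ‖lrepAux x‖ ≤ ‖(toProd x).1‖ + ‖(toProd x).2‖ :=
    LinearMap.mkContinuous_norm_le _ (by positivity) _
  rw [norm_eq, NNReal.coe_two]
  exact max_le (by linarith [norm_nonneg (toProd x)]) (by linarith)

instance instCompleteSpace : CompleteSpace (Check E F) := by
  have h : IsUniformInducing (toProd : Check E F ≃+ E × F) :=
    antilipschitz_toProd.isUniformInducing lipschitz_toProd.uniformContinuous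
  exact (Equiv.toUniformEquivOfIsUniformInducing
    (toProd : Check E F ≃+ E × F).toEquiv h).completeSpace_iff.2 inferInstance

/-- `F̌` with its C*-norm. -/
instance instCStarAlgebra : CStarAlgebra (Check E F) where
  star_smul c x := toProd.injective (by
    rw [toProd_star, toProd_smul, toProd_smul, toProd_star]
    simp [star_smul])

end Norm

section Maps

variable (E : Type u) {F : Type w} {G : Type*} [CommCStarAlgebra E]
  [NonUnitalCStarAlgebra F] [Module E F]
  [IsScalarTower ℂ E F] [IsScalarTower E F F] [SMulCommClass E F F] [StarModule E F]
  [IsBoundedSMul E F]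
  [NonUnitalCStarAlgebra G] [Module E G]
  [IsScalarTower ℂ E G] [IsScalarTower E G G] [SMulCommClass E G G] [StarModule E G]
  [IsBoundedSMul E G]

variable (F) in
/-- `π : F̌ → E`, `(α, x) ↦ α`. -/
def piHom : Check E F →⋆ₐ[E] E :=
  { Unitization.fstHom E F with map_star' := fun _ => rfl }

variable (F) in
/-- `λ : E → F̌`, `α ↦ (α, 0)`. -/
def lamHom : E →⋆ₐ[E] Check E F :=
  { Algebra.ofId E (Check E F) with map_star' := fun α => algebraMap_star_comm α }

variable (F) in
/-- `σ = λ ∘ π : F̌ → F̌`, `(α, x) ↦ (α, 0)`. -/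
def sigmaHom : Check E F →⋆ₐ[E] Check E F := (lamHom E F).comp (piHom E F)

variable {E} in
/-- `φ̌ : F̌ → Ǧ`, `(α, x) ↦ (α, φ x)`. -/
def mapHom (φ : F →⋆ₙₐ[E] G) : Check E F →⋆ₐ[E] Check E G where
  toFun x := toProd.symm ((toProd x).1, φ (toProd x).2)
  map_one' := toProd.injective (Prod.ext rfl (map_zero φ))
  map_mul' x y := toProd.injective (Prod.ext rfl (by
    simp only [AddEquiv.apply_symm_apply, toProd_mul, map_add, map_smul, map_mul]))
  map_zero' := toProd.injective (Prod.ext rfl (map_zero φ))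
  map_add' x y := toProd.injective (Prod.ext rfl (map_add φ _ _))
  commutes' α := toProd.injective (Prod.ext rfl (map_zero φ))
  map_star' x := toProd.injective (Prod.ext rfl (map_star φ _))

theorem toProd_mapHom (φ : F →⋆ₙₐ[E] G) (x : Check E F) :
    toProd (mapHom φ x) = ((toProd x).1, φ (toProd x).2) := rfl

theorem piHom_apply (x : Check E F) : piHom E F x = (toProd x).1 := rfl

theorem toProd_sigmaHom (x : Check E F) : toProd (sigmaHom E F x) = ((toProd x).1, 0) := rfl

theorem piHom_comp_mapHom (φ : F →⋆ₙₐ[E] G) : (piHom E G).comp (mapHom φ) = piHom E F := by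
  refine StarAlgHom.ext fun x => ?_
  rw [StarAlgHom.comp_apply, piHom_apply, piHom_apply, toProd_mapHom]

end Maps

end Check

/-! ### Schur functions and the algebras `F_n` -/

/-- A group `T` which is the union of an increasing sequence of finite subgroups `T_n`, starting
with the trivial one, together with a Schur `E`-function `f : T × T → Un E`. -/
structure SchurTower (E : Type u) (T : Type v) [CommCStarAlgebra E] [Group T] where
  /-- the finite subgroups `T_n` -/
  sub : ℕ → Subgroup T
  sub_mono : Monotone sub
  sub_zero : sub 0 = ⊥
  sub_finite : ∀ n, Finite (sub n)
  exhaust : ∀ t, ∃ n, t ∈ sub n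
  /-- the Schur function -/
  f : T → T → unitary E
  f_one : f 1 1 = 1
  cocycle : ∀ r s t, f r s * f (r * s) t = f r (s * t) * f s t

namespace SchurTower

variable {E : Type u} {T : Type v} [CommCStarAlgebra E] [Group T] (S : SchurTower E T)

instance instFintypeSub (n : ℕ) : Fintype (S.sub n) :=
  haveI := S.sub_finite n
  Fintype.ofFinite _

instance instDecidableEqSub (n : ℕ) : DecidableEq (S.sub n) := Classical.decEq _

theorem f_one_left (r : T) : S.f 1 r = 1 := by
  have h := S.cocycle 1 1 r
  simpa [S.f_one] using h

theorem f_one_right (r : T) : S.f r 1 = 1 := by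
  have h := S.cocycle r 1 1
  simpa [S.f_one] using h

section Level

variable (R : Type w) [CStarAlgebra R] [Algebra E R] [StarModule E R]

/-- The matrices over `R` indexed by `T_n`, i.e. the adjointable operators of the Hilbert
`R`-module `R^{T_n}`. -/
abbrev Mat (n : ℕ) : Type (max v w) := CStarMatrix (S.sub n) (S.sub n) R

variable {R} in
/-- Left multiplication by `x : R` in every coordinate, `x ⊗ id`. -/
def diag {n : ℕ} (x : R) : S.Mat R n :=
  CStarMatrix.ofMatrix (Matrix.diagonal fun _ => x)

/-- The operator `V_t` on `R^{T_n}`, `(V_t ξ)(s) = f(t, t⁻¹ s) ξ(t⁻¹ s)`. -/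
def V {n : ℕ} (t : S.sub n) : S.Mat R n :=
  CStarMatrix.ofMatrix fun s r => if r = t⁻¹ * s then algebraMap E R (S.f t r) else 0

variable {R}

/-- The operator `∑ (X_t ⊗ id) V_t`, the sum being taken over `t ∈ T_n`. -/
def oper {n : ℕ} (X : S.sub n → R) : S.Mat R n := ∑ t, S.diag (X t) * S.V R t

theorem oper_apply {n : ℕ} (X : S.sub n → R) (s r : S.sub n) :
    S.oper X s r = X (s * r⁻¹) * algebraMap E R (S.f (s * (r : T)⁻¹) r) := by
  have h1 : ∀ t, (S.diag (X t) * S.V R t : S.Mat R n) s r =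
      if t = s * r⁻¹ then X t * algebraMap E R (S.f t r) else 0 := fun t => by
    rw [CStarMatrix.mul_apply, Finset.sum_eq_single s]
    · have e : (r = t⁻¹ * s) ↔ t = s * r⁻¹ :=
        ⟨fun h => by rw [h]; group, fun h => by rw [h]; group⟩
      simp only [diag, CStarMatrix.ofMatrix_apply, Matrix.diagonal_apply_eq]
      change X t * (if r = t⁻¹ * s then algebraMap E R (S.f t r) else 0) = _
      simp only [e, mul_ite, mul_zero]
    · intro b _ hb
      simp only [diag, CStarMatrix.ofMatrix_apply]
      rw [Matrix.diagonal_apply_ne _ hb.symm, zero_mul]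
    · simp
  have h2 : S.oper X s r = ∑ t, (S.diag (X t) * S.V R t : S.Mat R n) s r := by
    rw [oper]
    exact map_sum (AddMonoidHom.mk' (fun M : S.Mat R n => M s r) fun _ _ => rfl) _ _
  rw [h2, Finset.sum_congr rfl fun t _ => h1 t, Finset.sum_ite_eq' _ _ _]
  simp

/-- The coefficients of an operator. -/
def coef {n : ℕ} (M : S.Mat R n) (t : S.sub n) : R := M t 1

theorem coef_oper {n : ℕ} (X : S.sub n → R) : S.coef (S.oper X) = X := by
  ext t
  rw [coef, oper_apply]
  simp [f_one_right]

theorem oper_injective {n : ℕ} : Function.Injective (S.oper : (S.sub n → R) → S.Mat R n) :=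
  Function.LeftInverse.injective S.coef_oper

/-- Coefficients of a product. -/
def cmul {n : ℕ} (X Y : S.sub n → R) (t : S.sub n) : R :=
  ∑ v, X (t * v⁻¹) * algebraMap E R (S.f (t * (v : T)⁻¹) v) * Y v

/-- Coefficients of an adjoint. -/
def cstar {n : ℕ} (X : S.sub n → R) (t : S.sub n) : R :=
  algebraMap E R (star (S.f (t : T)⁻¹ t : E)) * star (X t⁻¹)

theorem oper_mul {n : ℕ} (X Y : S.sub n → R) : S.oper X * S.oper Y = S.oper (S.cmul X Y) := by
  ext s r
  rw [CStarMatrix.mul_apply, oper_apply, cmul, Finset.sum_mul]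
  refine Fintype.sum_equiv (Equiv.mulRight r⁻¹) _ _ fun q => ?_
  have h := congrArg (fun x : unitary E => algebraMap E R (x : E))
    (S.cocycle (s * (q : T)⁻¹) (q * (r : T)⁻¹) r)
  simp only [Submonoid.coe_mul, map_mul, mul_assoc, inv_mul_cancel_left, inv_mul_cancel,
    mul_one] at h
  rw [oper_apply, oper_apply]
  simp only [Equiv.coe_mulRight, Subgroup.coe_mul, Subgroup.coe_inv, mul_inv_rev, inv_inv,
    mul_assoc, inv_mul_cancel_left]
  congr 1
  rw [← Algebra.commutes (S.f (q * (r : T)⁻¹) r : E) (Y _), ← mul_assoc, ← h,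
    ← Algebra.commutes (S.f (s * (r : T)⁻¹) r : E) (Y _), mul_assoc]

theorem oper_star {n : ℕ} (X : S.sub n → R) : star (S.oper X) = S.oper (S.cstar X) := by
  ext s r
  rw [CStarMatrix.star_apply, oper_apply, oper_apply, cstar, star_mul, ← algebraMap_star_comm]
  have h := S.cocycle ((s * (r : T)⁻¹)⁻¹) (s * (r : T)⁻¹) r
  rw [inv_mul_cancel, f_one_left, mul_one] at h
  have h' : star (S.f (r * (s : T)⁻¹) s) =
      star (S.f ((s * (r : T)⁻¹)⁻¹) (s * (r : T)⁻¹)) * S.f (s * (r : T)⁻¹) r := by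
    rw [h]
    simp [mul_assoc]
  have h2 := congrArg (fun x : unitary E => algebraMap E R (x : E)) h'
  simp only [Submonoid.coe_mul, map_mul, Unitary.coe_star] at h2
  rw [h2]
  simp only [Subgroup.coe_mul, Subgroup.coe_inv, mul_inv_rev, inv_inv, mul_assoc]
  rw [Algebra.commutes (S.f (s * (r : T)⁻¹) r : E)]

theorem oper_add {n : ℕ} (X Y : S.sub n → R) : S.oper X + S.oper Y = S.oper (X + Y) := by
  ext s r
  simp [oper_apply, add_mul]

theorem oper_algebraMap {n : ℕ} (c : E) :
    S.oper (Pi.single 1 (algebraMap E R c)) = algebraMap E (S.Mat R n) c := by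
  ext s r
  rw [Algebra.algebraMap_eq_smul_one (A := S.Mat R n), CStarMatrix.smul_apply,
    CStarMatrix.one_apply, oper_apply]
  by_cases h : s = r
  · subst h
    simp [f_one_left, Algebra.algebraMap_eq_smul_one]
  · have : s * r⁻¹ ≠ 1 := fun h' => h (mul_inv_eq_one.mp h')
    simp [this, h]

variable (R)

/-- The algebra `R_n` of all operators `∑ (X_t ⊗ id) V_t` with coefficients in `R`, the sum being
taken over `t ∈ T_n`. -/
def Lvl (n : ℕ) : StarSubalgebra E (S.Mat R n) where
  carrier := Set.range S.oper
  mul_mem' := by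
    rintro _ _ ⟨X, rfl⟩ ⟨Y, rfl⟩
    exact ⟨_, (S.oper_mul X Y).symm⟩
  add_mem' := by
    rintro _ _ ⟨X, rfl⟩ ⟨Y, rfl⟩
    exact ⟨_, (S.oper_add X Y).symm⟩
  algebraMap_mem' c := ⟨_, S.oper_algebraMap c⟩
  star_mem' := by
    rintro _ ⟨X, rfl⟩
    exact ⟨_, (S.oper_star X).symm⟩

/-- The algebra `R_n`, as a type. -/
def Alg (n : ℕ) : Type (max v w) := S.Lvl R n

section Instances

variable (n : ℕ)

instance instRingAlg : Ring (S.Alg R n) := SubringClass.toRing (S.Lvl R n)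
instance instStarRingAlg : StarRing (S.Alg R n) := inferInstanceAs (StarRing (S.Lvl R n))
instance instAlgebraAlg : Algebra E (S.Alg R n) := inferInstanceAs (Algebra E (S.Lvl R n))
instance instStarModuleAlg : StarModule E (S.Alg R n) :=
  inferInstanceAs (StarModule E (S.Lvl R n))
instance instTopologicalSpaceAlg : TopologicalSpace (S.Alg R n) :=
  inferInstanceAs (TopologicalSpace (S.Lvl R n))

end Instances

variable {R}

/-- Elements of `R_n` are determined by, and can have arbitrary, coefficients. -/
def coefEquiv (n : ℕ) : S.Alg R n ≃ (S.sub n → R) where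
  toFun M := S.coef M.1
  invFun X := ⟨S.oper X, X, rfl⟩
  left_inv := by
    rintro ⟨_, X, rfl⟩
    exact Subtype.ext (congrArg S.oper (S.coef_oper X))
  right_inv X := S.coef_oper X

/-- The inclusion of `R_n` into the matrices over `R`. -/
def toMat (n : ℕ) : S.Alg R n →⋆ₐ[E] S.Mat R n := (S.Lvl R n).subtype

theorem toMat_injective (n : ℕ) : Function.Injective (S.toMat (R := R) n) :=
  Subtype.val_injective

theorem toMat_coefEquiv_symm {n : ℕ} (X : S.sub n → R) :
    S.toMat n ((S.coefEquiv n).symm X) = S.oper X := rfl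

theorem coefEquiv_mul {n : ℕ} (M N : S.Alg R n) :
    S.coefEquiv n (M * N) = S.cmul (S.coefEquiv n M) (S.coefEquiv n N) := by
  obtain ⟨X, rfl⟩ := (S.coefEquiv n).symm.surjective M
  obtain ⟨Y, rfl⟩ := (S.coefEquiv n).symm.surjective N
  simp only [Equiv.apply_symm_apply]
  rw [← Equiv.eq_symm_apply]
  exact Subtype.ext (S.oper_mul X Y)

theorem coefEquiv_star {n : ℕ} (M : S.Alg R n) :
    S.coefEquiv n (star M) = S.cstar (S.coefEquiv n M) := by
  obtain ⟨X, rfl⟩ := (S.coefEquiv n).symm.surjective M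
  simp only [Equiv.apply_symm_apply]
  rw [← Equiv.eq_symm_apply]
  exact Subtype.ext (S.oper_star X)

theorem coefEquiv_add {n : ℕ} (M N : S.Alg R n) :
    S.coefEquiv n (M + N) = S.coefEquiv n M + S.coefEquiv n N := rfl

theorem coefEquiv_algebraMap {n : ℕ} (c : E) :
    S.coefEquiv n (algebraMap E (S.Alg R n) c) = Pi.single 1 (algebraMap E R c) := by
  rw [← Equiv.eq_symm_apply]
  exact Subtype.ext (S.oper_algebraMap c).symm

/-- A map of `E`-C*-algebras `R_n → R'_m` constructed from a map of coefficients. -/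
def homOfCoef {R' : Type*} [CStarAlgebra R'] [Algebra E R'] [StarModule E R'] {n m : ℕ}
    (h : (S.sub n → R) → (S.sub m → R')) (hadd : ∀ X Y, h (X + Y) = h X + h Y)
    (hmul : ∀ X Y, h (S.cmul X Y) = S.cmul (h X) (h Y))
    (hstar : ∀ X, h (S.cstar X) = S.cstar (h X))
    (halg : ∀ c, h (Pi.single 1 (algebraMap E R c)) = Pi.single 1 (algebraMap E R' c)) :
    S.Alg R n →⋆ₐ[E] S.Alg R' m where
  toFun M := (S.coefEquiv m).symm (h (S.coefEquiv n M))
  map_one' := by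
    rw [Equiv.symm_apply_eq, ← map_one (algebraMap E (S.Alg R n)),
      ← map_one (algebraMap E (S.Alg R' m)), coefEquiv_algebraMap, coefEquiv_algebraMap, halg]
  map_mul' M N := by
    rw [Equiv.symm_apply_eq, coefEquiv_mul, coefEquiv_mul, hmul, Equiv.apply_symm_apply,
      Equiv.apply_symm_apply]
  map_zero' := by
    have h0 : h 0 = 0 := by simpa using hadd 0 0
    exact (Equiv.symm_apply_eq _).mpr h0
  map_add' M N := by
    rw [Equiv.symm_apply_eq, coefEquiv_add, coefEquiv_add, hadd, Equiv.apply_symm_apply,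
      Equiv.apply_symm_apply]
  commutes' c := by
    rw [Equiv.symm_apply_eq, coefEquiv_algebraMap, coefEquiv_algebraMap, halg]
  map_star' M := by
    rw [Equiv.symm_apply_eq, coefEquiv_star, coefEquiv_star, hstar, Equiv.apply_symm_apply]

theorem coefEquiv_homOfCoef {R' : Type*} [CStarAlgebra R'] [Algebra E R'] [StarModule E R']
    {n m : ℕ} {h : (S.sub n → R) → (S.sub m → R')} (hadd) (hmul) (hstar) (halg)
    (M : S.Alg R n) : S.coefEquiv m (S.homOfCoef h hadd hmul hstar halg M) =
      h (S.coefEquiv n M) := Equiv.apply_symm_apply _ _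

/-- Extension of a family of coefficients from `T_n` to `T_{n+1}` by zero. -/
def extend {n : ℕ} (X : S.sub n → R) (t : S.sub (n + 1)) : R :=
  haveI := Classical.propDecidable ((t : T) ∈ S.sub n)
  if h : (t : T) ∈ S.sub n then X ⟨t, h⟩ else 0

theorem extend_of_mem {n : ℕ} (X : S.sub n → R) {t : S.sub (n + 1)} (h : (t : T) ∈ S.sub n) :
    S.extend X t = X ⟨t, h⟩ := dif_pos h

theorem extend_of_notMem {n : ℕ} (X : S.sub n → R) {t : S.sub (n + 1)}
    (h : (t : T) ∉ S.sub n) : S.extend X t = 0 := dif_neg h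

theorem extend_cmul {n : ℕ} (X Y : S.sub n → R) :
    S.extend (S.cmul X Y) = S.cmul (S.extend X) (S.extend Y) := by
  ext t
  by_cases ht : (t : T) ∈ S.sub n
  · rw [extend_of_mem _ _ ht, cmul, cmul]
    refine Fintype.sum_of_injective (Subgroup.inclusion (S.sub_mono n.le_succ))
      (Subgroup.inclusion_injective _) _ _ (fun v hv => ?_) (fun v => ?_)
    · have : (v : T) ∉ S.sub n := fun h => hv ⟨⟨v, h⟩, rfl⟩
      rw [extend_of_notMem _ Y this, mul_zero]
    · have h1 : ((Subgroup.inclusion (S.sub_mono n.le_succ) v : S.sub (n + 1)) : T) ∈ S.sub n :=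
        v.2
      have h2 : ((t * (Subgroup.inclusion (S.sub_mono n.le_succ) v)⁻¹ : S.sub (n + 1)) : T) ∈
          S.sub n := (S.sub n).mul_mem ht ((S.sub n).inv_mem h1)
      rw [extend_of_mem _ Y h1, extend_of_mem _ X h2]
      rfl
  · rw [extend_of_notMem _ _ ht, cmul, Finset.sum_eq_zero]
    intro v _
    by_cases hv : (v : T) ∈ S.sub n
    · have : ((t * v⁻¹ : S.sub (n + 1)) : T) ∉ S.sub n := fun h => ht (by
        simpa using (S.sub n).mul_mem h hv)
      rw [extend_of_notMem _ X this, zero_mul, zero_mul]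
    · rw [extend_of_notMem _ Y hv, mul_zero]

theorem extend_cstar {n : ℕ} (X : S.sub n → R) :
    S.extend (S.cstar X) = S.cstar (S.extend X) := by
  ext t
  by_cases ht : (t : T) ∈ S.sub n
  · have h1 : ((t⁻¹ : S.sub (n + 1)) : T) ∈ S.sub n := (S.sub n).inv_mem ht
    rw [extend_of_mem _ _ ht, cstar, cstar, extend_of_mem _ _ h1]
    rfl
  · have h1 : ((t⁻¹ : S.sub (n + 1)) : T) ∉ S.sub n := fun h => ht (by
      simpa using (S.sub n).inv_mem h)
    rw [extend_of_notMem _ _ ht, cstar, extend_of_notMem _ _ h1, star_zero, mul_zero]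

theorem extend_single {n : ℕ} (x : R) :
    S.extend (Pi.single (1 : S.sub n) x) = Pi.single 1 x := by
  ext t
  by_cases ht : t = 1
  · subst ht
    rw [extend_of_mem _ _ (S.sub n).one_mem, Pi.single_eq_same]
    exact Pi.single_eq_same (M := fun _ => R) (1 : S.sub n) x
  · rw [Pi.single_eq_of_ne ht]
    by_cases h : (t : T) ∈ S.sub n
    · rw [extend_of_mem _ _ h, Pi.single_eq_of_ne]
      intro h'
      exact ht (Subtype.ext (congrArg (fun x : S.sub n => (x : T)) h'))
    · exact extend_of_notMem _ _ h

/-- The canonical inclusion `R_n ⊂ R_{n+1}`: same coefficients, extended by zero. -/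
def incl (n : ℕ) : S.Alg R n →⋆ₐ[E] S.Alg R (n + 1) :=
  S.homOfCoef S.extend
    (fun X Y => by
      ext t
      by_cases ht : (t : T) ∈ S.sub n
      · simp [extend_of_mem _ _ ht]
      · simp [extend_of_notMem _ _ ht])
    S.extend_cmul S.extend_cstar (fun _ => S.extend_single _)

variable {R' : Type*} [CStarAlgebra R'] [Algebra E R'] [StarModule E R']

/-- The map `φ_n : R_n → R'_n`, which applies `φ` to the coefficients. -/
def lmap (φ : R →⋆ₐ[E] R') (n : ℕ) : S.Alg R n →⋆ₐ[E] S.Alg R' n :=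
  S.homOfCoef (fun X t => φ (X t)) (fun X Y => by ext t; simp)
    (fun X Y => by ext t; simp [cmul, AlgHomClass.commutes])
    (fun X => by ext t; simp [cstar, AlgHomClass.commutes, map_star])
    (fun c => by
      ext t
      by_cases ht : t = 1
      · subst ht; simp [AlgHomClass.commutes]
      · simp [Pi.single_eq_of_ne ht])

theorem lmap_incl (φ : R →⋆ₐ[E] R') (n : ℕ) (M : S.Alg R n) :
    S.lmap φ (n + 1) (S.incl n M) = S.incl n (S.lmap φ n M) := by
  apply (S.coefEquiv (n + 1)).injective
  rw [lmap, incl, incl, lmap, coefEquiv_homOfCoef, coefEquiv_homOfCoef, coefEquiv_homOfCoef,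
    coefEquiv_homOfCoef]
  ext t
  by_cases ht : (t : T) ∈ S.sub n
  · rw [extend_of_mem _ _ ht, extend_of_mem _ _ ht]
  · rw [extend_of_notMem _ _ ht, extend_of_notMem _ _ ht, map_zero]

theorem lmap_comp {R'' : Type*} [CStarAlgebra R''] [Algebra E R''] [StarModule E R'']
    (χ : R' →⋆ₐ[E] R'') (φ : R →⋆ₐ[E] R') (n : ℕ) (M : S.Alg R n) :
    S.lmap χ n (S.lmap φ n M) = S.lmap (χ.comp φ) n M := by
  apply (S.coefEquiv n).injective
  rw [lmap, lmap, lmap, coefEquiv_homOfCoef, coefEquiv_homOfCoef, coefEquiv_homOfCoef]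
  rfl

/-- The map `E_n → R_n` induced by the unit of `R`. -/
def unitMap (R : Type*) [CStarAlgebra R] [Algebra E R] [StarModule E R] (n : ℕ) :
    S.Alg E n →⋆ₐ[E] S.Alg R n :=
  S.lmap { Algebra.ofId E R with map_star' := fun α => algebraMap_star_comm α } n

theorem lmap_unitMap (φ : R →⋆ₐ[E] R') (n : ℕ) (M : S.Alg E n) :
    S.lmap φ n (S.unitMap R n M) = S.unitMap R' n M := by
  rw [unitMap, unitMap, lmap_comp]
  congr 2
  ext x
  exact AlgHomClass.commutes φ x

theorem incl_unitMap (n : ℕ) (M : S.Alg E n) :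
    S.incl n (S.unitMap R n M) = S.unitMap R (n + 1) (S.incl n M) := (S.lmap_incl _ n M).symm

/-- An element of `E_n` which commutes with `E_{n-1}`, commutes with `R_{n-1}`. -/
theorem unitMap_commute {n : ℕ} (c : S.Alg E (n + 1)) (hc : ∀ M : S.Alg E n, Commute c (S.incl n M))
    (M : S.Alg R n) : Commute (S.unitMap R (n + 1) c) (S.incl n M) := by
  have key : ∀ (v : S.sub n) (t : S.sub (n + 1)),
      S.coefEquiv _ c (t * (Subgroup.inclusion (S.sub_mono n.le_succ) v)⁻¹) *
        S.f ((t * (Subgroup.inclusion (S.sub_mono n.le_succ) v)⁻¹ : S.sub (n + 1)) : T) v =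
      S.f v (((Subgroup.inclusion (S.sub_mono n.le_succ) v)⁻¹ * t : S.sub (n + 1)) : T) *
        S.coefEquiv _ c ((Subgroup.inclusion (S.sub_mono n.le_succ) v)⁻¹ * t) := by
    intro v t
    set w := Subgroup.inclusion (S.sub_mono n.le_succ) v with hw
    have hwv : (w : T) = v := rfl
    have e : S.extend (Pi.single v (1 : E)) = Pi.single w 1 := by
      ext u
      by_cases hu : u = w
      · subst hu
        rw [extend_of_mem _ _ v.2, Pi.single_eq_same]
        exact Pi.single_eq_same (M := fun _ => E) v 1
      · rw [Pi.single_eq_of_ne hu]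
        by_cases h : (u : T) ∈ S.sub n
        · rw [extend_of_mem _ _ h, Pi.single_eq_of_ne]
          intro h'
          exact hu (Subtype.ext (congrArg (fun x : S.sub n => (x : T)) h'))
        · exact extend_of_notMem _ _ h
    have h := congrFun (congrArg (S.coefEquiv _) (hc ((S.coefEquiv n).symm (Pi.single v 1))).eq) t
    rw [coefEquiv_mul, coefEquiv_mul, incl, coefEquiv_homOfCoef, Equiv.apply_symm_apply, e, cmul,
      cmul, Finset.sum_eq_single w, Finset.sum_eq_single (w⁻¹ * t)] at h
    · simpa [hwv] using h
    · intro b _ hb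
      rw [Pi.single_eq_of_ne, zero_mul, zero_mul]
      intro h'
      apply hb
      rw [← h']
      group
    · simp
    · intro b _ hb
      rw [Pi.single_eq_of_ne hb, mul_zero]
    · simp
  apply (S.coefEquiv _).injective
  rw [coefEquiv_mul, coefEquiv_mul, unitMap, lmap, incl, coefEquiv_homOfCoef, coefEquiv_homOfCoef]
  ext t
  rw [cmul, cmul]
  refine Fintype.sum_equiv ((Equiv.inv _).trans (Equiv.mulRight t)) _ _ fun w => ?_
  simp only [Equiv.trans_apply, Equiv.inv_apply, Equiv.coe_mulRight, mul_inv_rev, inv_inv,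
    mul_inv_cancel_left]
  by_cases hw : (w : T) ∈ S.sub n
  · have h := congrArg (algebraMap E R) (key ⟨w, hw⟩ t)
    rw [map_mul, map_mul] at h
    have hw' : Subgroup.inclusion (S.sub_mono n.le_succ) ⟨(w : T), hw⟩ = w := rfl
    rw [hw'] at h
    have hc' : ∀ x : E, ({ Algebra.ofId E R with map_star' := fun α => algebraMap_star_comm α } :
      E →⋆ₐ[E] R) x = algebraMap E R x := fun _ => rfl
    have e1 : (t : T) * ((w⁻¹ * t : S.sub (n + 1)) : T)⁻¹ = w := by
      rw [Subgroup.coe_mul, Subgroup.coe_inv]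
      group
    rw [hc', hc', e1, mul_assoc (S.extend _ _)]
    refine Eq.trans ?_ ((congrArg (fun x => S.extend (S.coefEquiv n M) w * x) h))
    have h3 := Algebra.commutes (S.coefEquiv _ c (t * w⁻¹) * S.f (t * (w : T)⁻¹) w : E)
      (S.extend (S.coefEquiv n M) w)
    rw [map_mul] at h3
    exact h3
  · rw [extend_of_notMem _ _ hw]
    simp

end Level

end SchurTower

/-! ### Sequential direct systems -/

section Seq

variable {G : ℕ → Type*}

/-- Iteration of the steps of a sequence of maps. -/
def seqMap (g : ∀ n, G n → G (n + 1)) {i j : ℕ} (h : i ≤ j) : G i → G j :=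
  Nat.leRecOn (C := G) h (fun {k} => g k)

theorem seqMap_self (g : ∀ n, G n → G (n + 1)) {i : ℕ} (x : G i) : seqMap g le_rfl x = x :=
  Nat.leRecOn_self x

theorem seqMap_succ (g : ∀ n, G n → G (n + 1)) {i j : ℕ} (h : i ≤ j) (x : G i) :
    seqMap g (h.trans j.le_succ) x = g j (seqMap g h x) :=
  Nat.leRecOn_succ h x

theorem seqMap_trans (g : ∀ n, G n → G (n + 1)) {i j k : ℕ} (h : i ≤ j) (h' : j ≤ k) (x : G i) :
    seqMap g h' (seqMap g h x) = seqMap g (h.trans h') x :=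
  (Nat.leRecOn_trans h h' x).symm

theorem seqMap_map {G' : ℕ → Type*} (g : ∀ n, G n → G (n + 1)) (g' : ∀ n, G' n → G' (n + 1))
    (φ : ∀ n, G n → G' n) (hφ : ∀ n x, φ (n + 1) (g n x) = g' n (φ n x)) {i j : ℕ} (h : i ≤ j)
    (x : G i) : φ j (seqMap g h x) = seqMap g' h (φ i x) := by
  induction j, h using Nat.le_induction with
  | base => rw [seqMap_self, seqMap_self]
  | succ k hk ih => rw [seqMap_succ g hk, hφ, ih, seqMap_succ g' hk]

theorem seqMap_const (g : ∀ n, G n → G (n + 1)) (c : ∀ n, G n) (hc : ∀ n, g n (c n) = c (n + 1))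
    {i j : ℕ} (h : i ≤ j) : seqMap g h (c i) = c j := by
  induction j, h using Nat.le_induction with
  | base => rw [seqMap_self]
  | succ k hk ih => rw [seqMap_succ g hk, ih, hc]

theorem seqMap_op (g : ∀ n, G n → G (n + 1)) (op : ∀ n, G n → G n → G n)
    (hop : ∀ n x y, g n (op n x y) = op (n + 1) (g n x) (g n y)) {i j : ℕ} (h : i ≤ j)
    (x y : G i) : seqMap g h (op i x y) = op j (seqMap g h x) (seqMap g h y) := by
  induction j, h using Nat.le_induction with
  | base => simp only [seqMap_self]
  | succ k hk ih => rw [seqMap_succ g hk, seqMap_succ g hk, seqMap_succ g hk, ih, hop]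

section Ring

variable [∀ n, NonUnitalRing (G n)] [∀ n, StarRing (G n)] (g : ∀ n, G n →⋆ₙ+* G (n + 1))

/-- Iteration of the steps of a sequence of *-homomorphisms. -/
def seqHom (i j : ℕ) (h : i ≤ j) : G i →⋆ₙ+* G j where
  toFun := seqMap (fun n => g n) h
  map_mul' := seqMap_op (fun n => g n) (fun _ x y => x * y) (fun n => map_mul (g n)) h
  map_add' := seqMap_op (fun n => g n) (fun _ x y => x + y) (fun n => map_add (g n)) h
  map_zero' := seqMap_const (fun n => g n) (fun _ => 0) (fun n => map_zero (g n)) h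
  map_star' x := (seqMap_map (fun n => g n) (fun n => g n) (fun _ x => star x)
    (fun n x => (map_star (g n) x).symm) h x).symm

theorem seqHom_apply {i j : ℕ} (h : i ≤ j) (x : G i) :
    seqHom g i j h x = seqMap (fun n => g n) h x := rfl

instance instDirectedSeqHom : DirectedSystem G (fun _ _ h => seqHom g _ _ h) where
  map_self _ x := seqMap_self (fun n => g n) x
  map_map _ _ _ h h' x := seqMap_trans (fun n => g n) h h' x

/-- The algebraic inductive limit of a sequence of *-homomorphisms of *-rings. -/
def SeqLim : Type _ := DirectLimit G (seqHom g)

instance SeqLim.instNonUnitalRing : NonUnitalRing (SeqLim g) :=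
  inferInstanceAs (NonUnitalRing (DirectLimit G (seqHom g)))

instance SeqLim.instStarRing : StarRing (SeqLim g) :=
  inferInstanceAs (StarRing (DirectLimit G (seqHom g)))

/-- The canonical map to the inductive limit. -/
def SeqLim.of (n : ℕ) : G n →⋆ₙ+* SeqLim g where
  toFun x := (⟦⟨n, x⟩⟧ : DirectLimit G (seqHom g))
  map_mul' x y := (DirectLimit.mul_def (f := seqHom g) n x y).symm
  map_add' x y := (DirectLimit.add_def (f := seqHom g) n x y).symm
  map_zero' := (DirectLimit.zero_def (f := seqHom g) n).symm
  map_star' x := (DirectLimit.star_def (f := seqHom g) n x).symm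

theorem SeqLim.of_succ (n : ℕ) (x : G n) : SeqLim.of g (n + 1) (g n x) = SeqLim.of g n x := by
  have h : g n x = seqHom g n (n + 1) n.le_succ x := by
    rw [seqHom_apply, seqMap_succ _ le_rfl, seqMap_self]
  rw [h]
  exact DirectLimit.mk_apply (f := seqHom g) n (n + 1) x n.le_succ

theorem SeqLim.of_seqHom {i j : ℕ} (h : i ≤ j) (x : G i) :
    SeqLim.of g j (seqHom g i j h x) = SeqLim.of g i x :=
  DirectLimit.mk_apply (f := seqHom g) i j x h

theorem SeqLim.exists_of (z : SeqLim g) : ∃ n x, SeqLim.of g n x = z := by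
  obtain ⟨n, x, h⟩ := DirectLimit.exists_eq_mk (seqHom g) z
  exact ⟨n, x, h.symm⟩

theorem SeqLim.exists_of₂ (z w : SeqLim g) :
    ∃ n x y, SeqLim.of g n x = z ∧ SeqLim.of g n y = w := by
  obtain ⟨n, x, y, h, h'⟩ := DirectLimit.exists_eq_mk₂ (seqHom g) z w
  exact ⟨n, x, y, h.symm, h'.symm⟩

theorem SeqLim.exists_of_eq {n : ℕ} {x y : G n} (h : SeqLim.of g n x = SeqLim.of g n y) :
    ∃ (m : ℕ) (hm : n ≤ m), seqHom g n m hm x = seqHom g n m hm y := by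
  obtain ⟨m, h1, _, h3⟩ := Quotient.eq.mp h
  exact ⟨m, h1, h3⟩

variable {G' : ℕ → Type*} [∀ n, NonUnitalRing (G' n)] [∀ n, StarRing (G' n)]
  (g' : ∀ n, G' n →⋆ₙ+* G' (n + 1))

variable {g g'} in
/-- The map of inductive limits induced by a map of sequences. -/
def SeqLim.map (φ : ∀ n, G n →⋆ₙ+* G' n) (hφ : ∀ n x, φ (n + 1) (g n x) = g' n (φ n x)) :
    SeqLim g →⋆ₙ+* SeqLim g' where
  toFun := DirectLimit.map (seqHom g) (seqHom g') (fun n x => φ n x) fun _ _ h x =>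
    (seqMap_map (fun n => g n) (fun n => g' n) (fun n x => φ n x) hφ h x).symm
  map_mul' z w := by
    obtain ⟨n, x, y, rfl, rfl⟩ := SeqLim.exists_of₂ g z w
    rw [← map_mul (SeqLim.of g n)]
    change SeqLim.of g' n (φ n (x * y)) = SeqLim.of g' n (φ n x) * SeqLim.of g' n (φ n y)
    rw [map_mul, map_mul]
  map_add' z w := by
    obtain ⟨n, x, y, rfl, rfl⟩ := SeqLim.exists_of₂ g z w
    rw [← map_add (SeqLim.of g n)]
    change SeqLim.of g' n (φ n (x + y)) = SeqLim.of g' n (φ n x) + SeqLim.of g' n (φ n y)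
    rw [map_add, map_add]
  map_zero' := by
    rw [← map_zero (SeqLim.of g 0)]
    change SeqLim.of g' 0 (φ 0 0) = 0
    rw [map_zero, map_zero]
  map_star' z := by
    obtain ⟨n, x, rfl⟩ := SeqLim.exists_of g z
    rw [← map_star (SeqLim.of g n)]
    change SeqLim.of g' n (φ n (star x)) = star (SeqLim.of g' n (φ n x))
    rw [map_star, map_star]

theorem SeqLim.map_of (φ : ∀ n, G n →⋆ₙ+* G' n) (hφ : ∀ n x, φ (n + 1) (g n x) = g' n (φ n x))
    (n : ℕ) (x : G n) : SeqLim.map φ hφ (SeqLim.of g n x) = SeqLim.of g' n (φ n x) := rfl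

end Ring

section Group

variable [∀ n, Group (G n)] (g : ∀ n, G n →* G (n + 1))

/-- Iteration of the steps of a sequence of group homomorphisms. -/
def seqMonoidHom (i j : ℕ) (h : i ≤ j) : G i →* G j where
  toFun := seqMap (fun n => g n) h
  map_mul' := seqMap_op (fun n => g n) (fun _ x y => x * y) (fun n => map_mul (g n)) h
  map_one' := seqMap_const (fun n => g n) (fun _ => 1) (fun n => map_one (g n)) h

theorem seqMonoidHom_apply {i j : ℕ} (h : i ≤ j) (x : G i) :
    seqMonoidHom g i j h x = seqMap (fun n => g n) h x := rfl

instance instDirectedSeqMonoidHom : DirectedSystem G (fun _ _ h => seqMonoidHom g _ _ h) where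
  map_self _ x := seqMap_self (fun n => g n) x
  map_map _ _ _ h h' x := seqMap_trans (fun n => g n) h h' x

/-- The inductive limit of a sequence of group homomorphisms. -/
def SeqGrp : Type _ := DirectLimit G (seqMonoidHom g)

instance SeqGrp.instGroup : Group (SeqGrp g) :=
  inferInstanceAs (Group (DirectLimit G (seqMonoidHom g)))

/-- The canonical map to the inductive limit. -/
def SeqGrp.of (n : ℕ) : G n →* SeqGrp g where
  toFun x := (⟦⟨n, x⟩⟧ : DirectLimit G (seqMonoidHom g))
  map_mul' x y := (DirectLimit.mul_def (f := seqMonoidHom g) n x y).symm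
  map_one' := (DirectLimit.one_def (f := seqMonoidHom g) n).symm

theorem SeqGrp.of_succ (n : ℕ) (x : G n) : SeqGrp.of g (n + 1) (g n x) = SeqGrp.of g n x := by
  have h : g n x = seqMonoidHom g n (n + 1) n.le_succ x := by
    rw [seqMonoidHom_apply, seqMap_succ _ le_rfl, seqMap_self]
  rw [h]
  exact DirectLimit.mk_apply (f := seqMonoidHom g) n (n + 1) x n.le_succ

theorem SeqGrp.of_seqMonoidHom {i j : ℕ} (h : i ≤ j) (x : G i) :
    SeqGrp.of g j (seqMonoidHom g i j h x) = SeqGrp.of g i x :=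
  DirectLimit.mk_apply (f := seqMonoidHom g) i j x h

theorem SeqGrp.exists_of (z : SeqGrp g) : ∃ n x, SeqGrp.of g n x = z := by
  obtain ⟨n, x, h⟩ := DirectLimit.exists_eq_mk (seqMonoidHom g) z
  exact ⟨n, x, h.symm⟩

theorem SeqGrp.exists_of₂ (z w : SeqGrp g) :
    ∃ n x y, SeqGrp.of g n x = z ∧ SeqGrp.of g n y = w := by
  obtain ⟨n, x, y, h, h'⟩ := DirectLimit.exists_eq_mk₂ (seqMonoidHom g) z w
  exact ⟨n, x, y, h.symm, h'.symm⟩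

variable {G' : ℕ → Type*} [∀ n, Group (G' n)] (g' : ∀ n, G' n →* G' (n + 1))

variable {g g'} in
/-- The map of inductive limits induced by a map of sequences. -/
def SeqGrp.map (φ : ∀ n, G n →* G' n) (hφ : ∀ n x, φ (n + 1) (g n x) = g' n (φ n x)) :
    SeqGrp g →* SeqGrp g' where
  toFun := DirectLimit.map (seqMonoidHom g) (seqMonoidHom g') (fun n x => φ n x) fun _ _ h x =>
    (seqMap_map (fun n => g n) (fun n => g' n) (fun n x => φ n x) hφ h x).symm
  map_mul' z w := by
    obtain ⟨n, x, y, rfl, rfl⟩ := SeqGrp.exists_of₂ g z w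
    rw [← map_mul (SeqGrp.of g n)]
    change SeqGrp.of g' n (φ n (x * y)) = SeqGrp.of g' n (φ n x) * SeqGrp.of g' n (φ n y)
    rw [map_mul, map_mul]
  map_one' := by
    rw [← map_one (SeqGrp.of g 0)]
    change SeqGrp.of g' 0 (φ 0 1) = 1
    rw [map_one, map_one]

theorem SeqGrp.map_of (φ : ∀ n, G n →* G' n) (hφ : ∀ n x, φ (n + 1) (g n x) = g' n (φ n x))
    (n : ℕ) (x : G n) : SeqGrp.map φ hφ (SeqGrp.of g n x) = SeqGrp.of g' n (φ n x) := rfl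

end Group

end Seq

/-- For a *-homomorphism `ρ` and a projection `b` with `ρ 1 + b = 1`, the homomorphism
`U ↦ ρ U + b` of unitary groups. -/
def unitaryStep {A A' : Type*} [Ring A] [StarRing A] [Ring A'] [StarRing A'] (ρ : A →⋆ₙ+* A')
    (b : A') (hb : star b = b) (hbb : b * b = b) (h1 : ρ 1 + b = 1) (h2 : ∀ x, ρ x * b = 0)
    (h3 : ∀ x, b * ρ x = 0) : unitary A →* unitary A' :=
  have hm : ∀ x y, (ρ x + b) * (ρ y + b) = ρ (x * y) + b := fun x y => by
    rw [add_mul, mul_add, mul_add, h2, h3, hbb, map_mul, add_zero, zero_add]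
  { toFun U := ⟨ρ U + b, by
      rw [Unitary.mem_iff, star_add, hb, ← map_star, hm, hm, Unitary.star_mul_self_of_mem U.2,
        Unitary.mul_star_self_of_mem U.2, h1]
      exact ⟨rfl, rfl⟩⟩
    map_one' := Subtype.ext h1
    map_mul' U V := Subtype.ext (hm U V).symm }

/-! ### The data of the theory -/

/-- The data on which the K-theory depends: a sequence of finite subgroups with a Schur function,
and a sequence `C_n` of elements of `E_n` (here `C n` belongs to `E_{n+1}`) such that
`A_n = C_n* C_n` and `B_n = C_n C_n*` are projections with sum `1` and such that `C_n` commutes with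
`E_{n-1}`. -/
structure ProjKData (E : Type u) (T : Type v) [CommCStarAlgebra E] [Group T] where
  /-- the subgroups `T_n` and the Schur function `f` -/
  toSchurTower : SchurTower E T
  /-- the elements `C_n` -/
  C : ∀ n, toSchurTower.Alg E (n + 1)
  isStarProjection_A : ∀ n, IsStarProjection (star (C n) * C n)
  isStarProjection_B : ∀ n, IsStarProjection (C n * star (C n))
  A_add_B : ∀ n, star (C n) * C n + C n * star (C n) = 1
  C_commute : ∀ n (M : toSchurTower.Alg E n), Commute (C n) (toSchurTower.incl n M)

namespace ProjKData

variable {E : Type u} {T : Type v} [CommCStarAlgebra E] [Group T] (K : ProjKData E T)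

section Limits

/-- The algebra `R_n`. -/
abbrev Lv (R : Type w) [CStarAlgebra R] [Algebra E R] [StarModule E R] (n : ℕ) : Type (max v w) :=
  K.toSchurTower.Alg R n

variable (R : Type w) [CStarAlgebra R] [Algebra E R] [StarModule E R]

/-- `C_{n+1}`, as an element of `R_{n+1}`. -/
def cc (n : ℕ) : K.Lv R (n + 1) := K.toSchurTower.unitMap R (n + 1) (K.C n)

/-- `A_{n+1} = C_{n+1}* C_{n+1}`. -/
def aa (n : ℕ) : K.Lv R (n + 1) := star (K.cc R n) * K.cc R n

/-- `B_{n+1} = C_{n+1} C_{n+1}*`. -/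
def bb (n : ℕ) : K.Lv R (n + 1) := K.cc R n * star (K.cc R n)

theorem aa_eq (n : ℕ) : K.aa R n = K.toSchurTower.unitMap R (n + 1) (star (K.C n) * K.C n) := by
  rw [aa, cc, map_mul, map_star]

theorem bb_eq (n : ℕ) : K.bb R n = K.toSchurTower.unitMap R (n + 1) (K.C n * star (K.C n)) := by
  rw [bb, cc, map_mul, map_star]

theorem star_aa (n : ℕ) : star (K.aa R n) = K.aa R n := by simp [aa]

theorem star_bb (n : ℕ) : star (K.bb R n) = K.bb R n := by simp [bb]

theorem aa_mul_aa (n : ℕ) : K.aa R n * K.aa R n = K.aa R n := by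
  rw [aa_eq, ← map_mul, (K.isStarProjection_A n).isIdempotentElem.eq]

theorem bb_mul_bb (n : ℕ) : K.bb R n * K.bb R n = K.bb R n := by
  rw [bb_eq, ← map_mul, (K.isStarProjection_B n).isIdempotentElem.eq]

theorem aa_add_bb (n : ℕ) : K.aa R n + K.bb R n = 1 := by
  rw [aa_eq, bb_eq, ← map_add, K.A_add_B, map_one]

theorem aa_mul_bb (n : ℕ) : K.aa R n * K.bb R n = 0 := by
  rw [eq_sub_of_add_eq' (K.aa_add_bb R n), mul_sub, mul_one, aa_mul_aa, sub_self]

theorem bb_mul_aa (n : ℕ) : K.bb R n * K.aa R n = 0 := by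
  rw [eq_sub_of_add_eq' (K.aa_add_bb R n), sub_mul, one_mul, aa_mul_aa, sub_self]

variable {R}

theorem cc_commute (n : ℕ) (M : K.Lv R n) : Commute (K.cc R n) (K.toSchurTower.incl n M) :=
  K.toSchurTower.unitMap_commute _ (K.C_commute n) M

theorem star_cc_commute (n : ℕ) (M : K.Lv R n) : Commute (star (K.cc R n)) (K.toSchurTower.incl n M) := by
  have h := (K.cc_commute n (star M)).star_star
  rwa [map_star, star_star] at h

theorem aa_commute (n : ℕ) (M : K.Lv R n) : Commute (K.aa R n) (K.toSchurTower.incl n M) :=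
  (K.star_cc_commute n M).mul_left (K.cc_commute n M)

theorem bb_commute (n : ℕ) (M : K.Lv R n) : Commute (K.bb R n) (K.toSchurTower.incl n M) :=
  (K.cc_commute n M).mul_left (K.star_cc_commute n M)

/-- The map `R_n → R_{n+1}`, `X ↦ A_{n+1} X`. -/
def rho (n : ℕ) : K.Lv R n →⋆ₙ+* K.Lv R (n + 1) where
  toFun X := K.aa R n * K.toSchurTower.incl n X
  map_mul' X Y := by
    rw [map_mul, mul_assoc, ← mul_assoc (K.toSchurTower.incl n X), ← (K.aa_commute n X).eq,
      ← mul_assoc, ← mul_assoc, ← mul_assoc, aa_mul_aa]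
  map_add' X Y := by rw [map_add, mul_add]
  map_zero' := by rw [map_zero, mul_zero]
  map_star' X := by
    rw [star_mul, star_aa, map_star, ← map_star (K.toSchurTower.incl n),
      (K.aa_commute n (star X)).eq]

theorem rho_apply (n : ℕ) (X : K.Lv R n) : K.rho n X = K.aa R n * K.toSchurTower.incl n X := rfl

/-- The map `Un R_n → Un R_{n+1}`, `U ↦ A_{n+1} U + B_{n+1}`. -/
def tau (n : ℕ) : unitary (K.Lv R n) →* unitary (K.Lv R (n + 1)) :=
  unitaryStep (K.rho n) (K.bb R n) (K.star_bb R n) (K.bb_mul_bb R n)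
    (by rw [rho_apply, map_one, mul_one, aa_add_bb])
    (fun X => by rw [rho_apply, mul_assoc, ← (K.bb_commute n X).eq, ← mul_assoc, aa_mul_bb,
      zero_mul])
    (fun X => by rw [rho_apply, ← mul_assoc, bb_mul_aa, zero_mul])

theorem coe_tau (n : ℕ) (U : unitary (K.Lv R n)) :
    (K.tau n U : K.Lv R (n + 1)) = K.aa R n * K.toSchurTower.incl n U + K.bb R n := rfl

variable (R)

/-- The algebraic inductive limit `R_→` of the sequence `R_n → R_{n+1}`, `X ↦ A_{n+1} X`. -/
def Lim : Type (max v w) := SeqLim (fun n => K.rho (R := R) n)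

instance instNonUnitalRingLim : NonUnitalRing (K.Lim R) :=
  SeqLim.instNonUnitalRing (fun n => K.rho (R := R) n)

instance instStarRingLim : StarRing (K.Lim R) := SeqLim.instStarRing (fun n => K.rho (R := R) n)

/-- The inductive limit `un R` of the groups `Un R_n`, with respect to `U ↦ A_{n+1} U + B_{n+1}`. -/
def LimUn : Type (max v w) := SeqGrp (fun n => K.tau (R := R) n)

instance instGroupLimUn : Group (K.LimUn R) := SeqGrp.instGroup (fun n => K.tau (R := R) n)

variable {R}

/-- The canonical map `R_n → R_→`. -/
def toLim (n : ℕ) : K.Lv R n →⋆ₙ+* K.Lim R :=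
  SeqLim.of (fun n => K.rho (R := R) n) n

/-- The canonical map `Un R_n → un R`. -/
def toLimUn (n : ℕ) : unitary (K.Lv R n) →* K.LimUn R :=
  SeqGrp.of (fun n => K.tau (R := R) n) n

theorem toLim_rho (n : ℕ) (X : K.Lv R n) : K.toLim (n + 1) (K.rho n X) = K.toLim n X :=
  SeqLim.of_succ (fun n => K.rho (R := R) n) n X

theorem toLimUn_tau (n : ℕ) (U : unitary (K.Lv R n)) :
    K.toLimUn (n + 1) (K.tau n U) = K.toLimUn n U :=
  SeqGrp.of_succ (fun n => K.tau (R := R) n) n U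

variable {R' : Type*} [CStarAlgebra R'] [Algebra E R'] [StarModule E R'] (φ : R →⋆ₐ[E] R')

theorem lmap_cc (n : ℕ) : K.toSchurTower.lmap φ (n + 1) (K.cc R n) = K.cc R' n := K.toSchurTower.lmap_unitMap φ _ _

theorem lmap_aa (n : ℕ) : K.toSchurTower.lmap φ (n + 1) (K.aa R n) = K.aa R' n := by
  rw [aa, aa, map_mul, map_star, lmap_cc]

theorem lmap_bb (n : ℕ) : K.toSchurTower.lmap φ (n + 1) (K.bb R n) = K.bb R' n := by
  rw [bb, bb, map_mul, map_star, lmap_cc]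

theorem lmap_rho (n : ℕ) (X : K.Lv R n) :
    K.toSchurTower.lmap φ (n + 1) (K.rho n X) = K.rho n (K.toSchurTower.lmap φ n X) := by
  rw [rho_apply, rho_apply, map_mul, lmap_aa, K.toSchurTower.lmap_incl]

/-- The map `φ_n`, as a homomorphism of *-rings. -/
def lmapHom (n : ℕ) : K.Lv R n →⋆ₙ+* K.Lv R' n where
  toFun := K.toSchurTower.lmap φ n
  map_mul' := map_mul _
  map_add' := map_add _
  map_zero' := map_zero _
  map_star' := map_star _

/-- The map `φ_→ : R_→ → R'_→` induced by the maps `φ_n`. -/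
def limMap : K.Lim R →⋆ₙ+* K.Lim R' :=
  SeqLim.map (g := fun n => K.rho (R := R) n) (g' := fun n => K.rho (R := R') n)
    (K.lmapHom φ) (K.lmap_rho φ)

theorem limMap_toLim (n : ℕ) (X : K.Lv R n) :
    K.limMap φ (K.toLim n X) = K.toLim n (K.toSchurTower.lmap φ n X) := rfl

/-- The map `Un R_n → Un R'_n` induced by `φ_n`. -/
def unMap (φ : R →⋆ₐ[E] R') (n : ℕ) : unitary (K.Lv R n) →* unitary (K.Lv R' n) :=
  Unitary.map
    { toFun := K.toSchurTower.lmap φ n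
      map_one' := map_one _
      map_mul' := map_mul _
      map_star' := map_star _ }

theorem coe_unMap (n : ℕ) (U : unitary (K.Lv R n)) :
    (K.unMap φ n U : K.Lv R' n) = K.toSchurTower.lmap φ n U := rfl

theorem unMap_tau (n : ℕ) (U : unitary (K.Lv R n)) :
    K.unMap φ (n + 1) (K.tau n U) = K.tau n (K.unMap φ n U) := by
  apply Subtype.ext
  rw [coe_unMap, coe_tau, coe_tau, coe_unMap, map_add, map_mul, lmap_aa, lmap_bb, K.toSchurTower.lmap_incl]

/-- The map `φ_← : un R → un R'` induced by the maps `φ_n`. -/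
def limUnMap : K.LimUn R →* K.LimUn R' :=
  SeqGrp.map (g := fun n => K.tau (R := R) n) (g' := fun n => K.tau (R := R') n)
    (K.unMap φ) (K.unMap_tau φ)

theorem limUnMap_toLimUn (n : ℕ) (U : unitary (K.Lv R n)) :
    K.limUnMap φ (K.toLimUn n U) = K.toLimUn n (K.unMap φ n U) := rfl

end Limits

end ProjKData

/-! ### Murray–von Neumann classes of projections and `K_0` -/

section MvN

variable (A : Type u) [NonUnitalRing A] [StarRing A]

/-- The projections of a *-ring. -/
def Proj : Type u := {p : A // IsStarProjection p}

variable {A}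

/-- Murray–von Neumann equivalence of projections. -/
def MvN (p q : Proj A) : Prop := ∃ x : A, star x * x = p.1 ∧ x * star x = q.1

theorem Proj.star_eq (p : Proj A) : star p.1 = p.1 := p.2.isSelfAdjoint.star_eq

theorem Proj.mul_self (p : Proj A) : p.1 * p.1 = p.1 := p.2.isIdempotentElem.eq

theorem MvN.refl (p : Proj A) : MvN p p :=
  ⟨p.1, by rw [p.star_eq, p.mul_self], by rw [p.star_eq, p.mul_self]⟩

theorem MvN.symm {p q : Proj A} (h : MvN p q) : MvN q p := by
  obtain ⟨x, h1, h2⟩ := h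
  exact ⟨star x, by rwa [star_star], by rwa [star_star]⟩

theorem MvN.trans {p q r : Proj A} (h : MvN p q) (h' : MvN q r) : MvN p r := by
  obtain ⟨x, h1, h2⟩ := h
  obtain ⟨y, h3, h4⟩ := h'
  refine ⟨y * x, ?_, ?_⟩
  · calc star (y * x) * (y * x) = star x * (star y * y) * x := by
          simp only [star_mul, mul_assoc]
      _ = (star x * x) * (star x * x) := by rw [h3, ← h2]; simp only [mul_assoc]
      _ = p.1 := by rw [h1, p.mul_self]
  · calc y * x * star (y * x) = y * (x * star x) * star y := by
          simp only [star_mul, mul_assoc]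
      _ = (y * star y) * (y * star y) := by rw [h2, ← h3]; simp only [mul_assoc]
      _ = r.1 := by rw [h4, r.mul_self]

variable (A) in
instance instSetoidProj : Setoid (Proj A) :=
  ⟨MvN, MvN.refl, MvN.symm, MvN.trans⟩

variable (A) in
/-- The set of Murray–von Neumann classes of projections. -/
def VSet : Type u := Quotient (instSetoidProj A)

/-- The class of a projection. -/
def VSet.mk (p : Proj A) : VSet A := Quotient.mk _ p

theorem VSet.mk_eq_mk {p q : Proj A} : VSet.mk p = VSet.mk q ↔ MvN p q := Quotient.eq

/-- The sum of two orthogonal projections. -/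
def Proj.add (p q : Proj A) (h : p.1 * q.1 = 0) : Proj A :=
  ⟨p.1 + q.1, by
    have h' : q.1 * p.1 = 0 := by
      rw [← p.star_eq, ← q.star_eq, ← star_mul, h, star_zero]
    refine ⟨?_, ?_⟩
    · rw [IsIdempotentElem, mul_add, add_mul, add_mul, h, h', p.mul_self, q.mul_self, add_zero,
        zero_add]
    · rw [IsSelfAdjoint, star_add, p.star_eq, q.star_eq]⟩

theorem Proj.orth_symm {p q : Proj A} (h : p.1 * q.1 = 0) : q.1 * p.1 = 0 := by
  rw [← p.star_eq, ← q.star_eq, ← star_mul, h, star_zero]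

theorem MvN.add {p q p' q' : Proj A} (h : p.1 * q.1 = 0) (h' : p'.1 * q'.1 = 0) (hp : MvN p p')
    (hq : MvN q q') : MvN (p.add q h) (p'.add q' h') := by
  obtain ⟨x, h1, h2⟩ := hp
  obtain ⟨y, h3, h4⟩ := hq
  have aux : ∀ {r r' : Proj A} {z : A}, star z * z = r.1 → z * star z = r'.1 →
      star (r'.1 * z * r.1) * (r'.1 * z * r.1) = r.1 ∧
      (r'.1 * z * r.1) * star (r'.1 * z * r.1) = r'.1 := by
    intro r r' z e1 e2
    constructor
    · calc star (r'.1 * z * r.1) * (r'.1 * z * r.1)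
          = r.1 * star z * (r'.1 * r'.1) * z * r.1 := by
            simp only [star_mul, r.star_eq, r'.star_eq, mul_assoc]
        _ = r.1 * (star z * z) * (star z * z) * r.1 := by
            rw [r'.mul_self, ← e2]; simp only [mul_assoc]
        _ = r.1 := by rw [e1, r.mul_self, r.mul_self, r.mul_self]
    · calc (r'.1 * z * r.1) * star (r'.1 * z * r.1)
          = r'.1 * z * (r.1 * r.1) * star z * r'.1 := by
            simp only [star_mul, r.star_eq, r'.star_eq, mul_assoc]
        _ = r'.1 * (z * star z) * (z * star z) * r'.1 := by
            rw [r.mul_self, ← e1]; simp only [mul_assoc]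
        _ = r'.1 := by rw [e2, r'.mul_self, r'.mul_self, r'.mul_self]
  obtain ⟨a1, a2⟩ := aux h1 h2
  obtain ⟨b1, b2⟩ := aux h3 h4
  refine ⟨p'.1 * x * p.1 + q'.1 * y * q.1, ?_, ?_⟩
  · have c1 : star (p'.1 * x * p.1) * (q'.1 * y * q.1) = 0 := by
      simp only [star_mul, p'.star_eq, mul_assoc]
      rw [← mul_assoc p'.1 q'.1, h', zero_mul, mul_zero, mul_zero]
    have c2 : star (q'.1 * y * q.1) * (p'.1 * x * p.1) = 0 := by
      simp only [star_mul, q'.star_eq, mul_assoc]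
      rw [← mul_assoc q'.1 p'.1, Proj.orth_symm h', zero_mul, mul_zero, mul_zero]
    rw [star_add, add_mul, mul_add, mul_add, a1, b1, c1, c2, add_zero, zero_add]
    rfl
  · have c1 : (p'.1 * x * p.1) * star (q'.1 * y * q.1) = 0 := by
      simp only [star_mul, q.star_eq, mul_assoc]
      rw [← mul_assoc p.1 q.1, h, zero_mul, mul_zero, mul_zero]
    have c2 : (q'.1 * y * q.1) * star (p'.1 * x * p.1) = 0 := by
      simp only [star_mul, p.star_eq, mul_assoc]
      rw [← mul_assoc q.1 p.1, Proj.orth_symm h, zero_mul, mul_zero, mul_zero]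
    rw [star_add, add_mul, mul_add, mul_add, a2, b2, c1, c2, add_zero, zero_add]
    rfl

variable (A) in
/-- Any two classes of projections have orthogonal representatives. -/
class HasOrthReps : Prop where
  exists_orth : ∀ p q : Proj A, ∃ p' q' : Proj A, MvN p p' ∧ MvN q q' ∧ p'.1 * q'.1 = 0

section Add

variable [HasOrthReps A]

theorem VSet.exists_orth (P Q : VSet A) : ∃ (p q : Proj A) (_ : p.1 * q.1 = 0),
    VSet.mk p = P ∧ VSet.mk q = Q := by
  obtain ⟨p, rfl⟩ := Quotient.exists_rep P
  obtain ⟨q, rfl⟩ := Quotient.exists_rep Q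
  obtain ⟨p', q', h1, h2, h3⟩ := HasOrthReps.exists_orth p q
  exact ⟨p', q', h3, (VSet.mk_eq_mk.mpr h1).symm, (VSet.mk_eq_mk.mpr h2).symm⟩

/-- The sum of two classes is the class of the sum of orthogonal representatives. -/
instance VSet.instAdd : Add (VSet A) where
  add P Q := VSet.mk ((VSet.exists_orth P Q).choose.add (VSet.exists_orth P Q).choose_spec.choose
    (VSet.exists_orth P Q).choose_spec.choose_spec.choose)

theorem VSet.mk_add_mk (p q : Proj A) (h : p.1 * q.1 = 0) :
    VSet.mk p + VSet.mk q = VSet.mk (p.add q h) := by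
  have hs := (VSet.exists_orth (VSet.mk p) (VSet.mk q)).choose_spec.choose_spec.choose_spec
  exact VSet.mk_eq_mk.mpr (MvN.add _ _ (VSet.mk_eq_mk.mp hs.1) (VSet.mk_eq_mk.mp hs.2))

theorem VSet.exists_orth₃ (P Q R : VSet A) : ∃ p q r : Proj A, p.1 * q.1 = 0 ∧ p.1 * r.1 = 0 ∧
    q.1 * r.1 = 0 ∧ VSet.mk p = P ∧ VSet.mk q = Q ∧ VSet.mk r = R := by
  obtain ⟨p, q, hpq, rfl, rfl⟩ := VSet.exists_orth P Q
  obtain ⟨s, r, hsr, hs, rfl⟩ := VSet.exists_orth (VSet.mk (p.add q hpq)) R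
  obtain ⟨x, h1, h2⟩ := VSet.mk_eq_mk.mp hs.symm
  have hqp := Proj.orth_symm hpq
  have h1' : star x * x = p.1 + q.1 := h1
  have mulx : ∀ a b : A, (x * a * star x) * (x * b * star x) = x * (a * (p.1 + q.1) * b) * star x :=
    fun a b => by rw [← h1']; simp only [mul_assoc]
  have hpp : p.1 * (p.1 + q.1) = p.1 := by rw [mul_add, p.mul_self, hpq, add_zero]
  have hqq : q.1 * (p.1 + q.1) = q.1 := by rw [mul_add, q.mul_self, hqp, zero_add]
  have prj : ∀ a : Proj A, a.1 * (p.1 + q.1) = a.1 → IsStarProjection (x * a.1 * star x) := by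
    intro a ha
    refine ⟨?_, ?_⟩
    · rw [IsIdempotentElem, mulx, ha, a.mul_self]
    · rw [IsSelfAdjoint, star_mul, star_mul, star_star, a.star_eq, mul_assoc]
  have eqv : ∀ (a : Proj A) (ha : a.1 * (p.1 + q.1) = a.1), MvN a ⟨x * a.1 * star x, prj a ha⟩ := by
    intro a ha
    refine ⟨x * a.1, ?_, ?_⟩
    · rw [star_mul, mul_assoc, ← mul_assoc (star x), h1', a.star_eq, ← mul_assoc, ha, a.mul_self]
    · rw [star_mul, a.star_eq, mul_assoc, ← mul_assoc a.1, a.mul_self, ← mul_assoc]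
  have hS : x * (p.1 + q.1) * star x = s.1 := by
    rw [← h1']
    calc x * (star x * x) * star x = (x * star x) * (x * star x) := by simp only [mul_assoc]
      _ = s.1 := by rw [h2, s.mul_self]
  have orth : ∀ a : A, a * (p.1 + q.1) = a → (x * a * star x) * r.1 = 0 := by
    intro a ha
    have : (x * a * star x) * s.1 = x * a * star x := by
      rw [← hS, mulx, ha]
      rw [ha]
    rw [← this, mul_assoc, hsr, mul_zero]
  refine ⟨⟨x * p.1 * star x, prj p hpp⟩, ⟨x * q.1 * star x, prj q hqq⟩, r, ?_, orth _ hpp,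
    orth _ hqq, (VSet.mk_eq_mk.mpr (eqv p hpp)).symm, (VSet.mk_eq_mk.mpr (eqv q hqq)).symm, rfl⟩
  change (x * p.1 * star x) * (x * q.1 * star x) = 0
  rw [mulx, hpp, hpq, mul_zero, zero_mul]

instance VSet.instZero : Zero (VSet A) where
  zero := VSet.mk ⟨0, IsStarProjection.zero A⟩

theorem VSet.zero_def : (0 : VSet A) = VSet.mk ⟨0, IsStarProjection.zero A⟩ := rfl

theorem VSet.add_comm' (P Q : VSet A) : P + Q = Q + P := by
  obtain ⟨p, q, h, rfl, rfl⟩ := VSet.exists_orth P Q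
  rw [VSet.mk_add_mk p q h, VSet.mk_add_mk q p (Proj.orth_symm h)]
  congr 1
  exact Subtype.ext (add_comm _ _)

theorem VSet.zero_add' (P : VSet A) : 0 + P = P := by
  obtain ⟨p, rfl⟩ := Quotient.exists_rep P
  refine (VSet.mk_add_mk ⟨0, IsStarProjection.zero A⟩ p (zero_mul _)).trans ?_
  exact congrArg VSet.mk (Subtype.ext (zero_add _))

instance VSet.instAddCommMonoid : AddCommMonoid (VSet A) where
  add_assoc P Q R := by
    obtain ⟨p, q, r, h1, h2, h3, rfl, rfl, rfl⟩ := VSet.exists_orth₃ P Q R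
    rw [VSet.mk_add_mk p q h1, VSet.mk_add_mk q r h3,
      VSet.mk_add_mk (p.add q h1) r (by
        change (p.1 + q.1) * r.1 = 0
        rw [add_mul, h2, h3, add_zero]),
      VSet.mk_add_mk p (q.add r h3) (by
        change p.1 * (q.1 + r.1) = 0
        rw [mul_add, h1, h2, add_zero])]
    congr 1
    exact Subtype.ext (add_assoc _ _ _)
  zero_add := VSet.zero_add'
  add_zero P := by rw [VSet.add_comm', VSet.zero_add']
  add_comm := VSet.add_comm'
  nsmul := nsmulRec

end Add

variable {A' : Type*} [NonUnitalRing A'] [StarRing A'] (φ : A →⋆ₙ+* A')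

/-- The image of a projection. -/
def Proj.map (p : Proj A) : Proj A' :=
  ⟨φ p.1, by
    refine ⟨?_, ?_⟩
    · rw [IsIdempotentElem, ← map_mul, p.mul_self]
    · rw [IsSelfAdjoint, ← map_star, p.star_eq]⟩

theorem MvN.map {p q : Proj A} (h : MvN p q) : MvN (p.map φ) (q.map φ) := by
  obtain ⟨x, h1, h2⟩ := h
  exact ⟨φ x, by rw [← map_star, ← map_mul, h1]; rfl, by rw [← map_star, ← map_mul, h2]; rfl⟩

/-- The homomorphism `[p] ↦ [φ p]`. -/
def VSet.map [HasOrthReps A] [HasOrthReps A'] : VSet A →+ VSet A' where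
  toFun := Quotient.map (Proj.map φ) fun _ _ h => MvN.map φ h
  map_zero' := congrArg VSet.mk (Subtype.ext (map_zero φ))
  map_add' P Q := by
    obtain ⟨p, q, h, rfl, rfl⟩ := VSet.exists_orth P Q
    rw [VSet.mk_add_mk p q h]
    refine Eq.trans ?_ (VSet.mk_add_mk (p.map φ) (q.map φ) ?_).symm
    · exact congrArg VSet.mk (Subtype.ext (map_add φ _ _))
    · change φ p.1 * φ q.1 = 0
      rw [← map_mul, h, map_zero]

theorem VSet.map_mk [HasOrthReps A] [HasOrthReps A'] (p : Proj A) :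
    VSet.map φ (VSet.mk p) = VSet.mk (p.map φ) := rfl

section SeqProj

variable {G : ℕ → Type*} [∀ n, NonUnitalRing (G n)] [∀ n, StarRing (G n)]
  (g : ∀ n, G n →⋆ₙ+* G (n + 1))

/-- Every projection of the inductive limit comes from a projection of some term of the
sequence. -/
theorem SeqLim.exists_proj (p : Proj (SeqLim g)) :
    ∃ (n : ℕ) (X : G n), SeqLim.of g n X = p.1 ∧ IsStarProjection X := by
  obtain ⟨n, X, hX⟩ := SeqLim.exists_of g p.1
  have h1 : SeqLim.of g n (X * X) = SeqLim.of g n X := by rw [map_mul, hX, p.mul_self]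
  have h2 : SeqLim.of g n (star X) = SeqLim.of g n X := by rw [map_star, hX, p.star_eq]
  obtain ⟨m, hm, e⟩ := SeqLim.exists_of_eq _ h1
  obtain ⟨m', hm', e'⟩ := SeqLim.exists_of_eq _ h2
  have f1 := congrArg (seqHom g m (max m m') (le_max_left _ _)) e
  have f2 := congrArg (seqHom g m' (max m m') (le_max_right _ _)) e'
  rw [seqHom_apply, seqHom_apply, seqHom_apply, seqHom_apply, seqMap_trans, seqMap_trans,
    ← seqHom_apply, ← seqHom_apply] at f1 f2
  refine ⟨max m m', seqHom g n _ (hm.trans (le_max_left _ _)) X, ?_, ?_, ?_⟩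
  · rw [SeqLim.of_seqHom, hX]
  · rw [IsIdempotentElem, ← map_mul, f1]
  · rw [IsSelfAdjoint, ← map_star, f2]

theorem SeqLim.exists_proj₂ (p q : Proj (SeqLim g)) :
    ∃ (n : ℕ) (X Y : G n), IsStarProjection X ∧ SeqLim.of g n X = p.1 ∧ SeqLim.of g n Y = q.1 ∧
      IsStarProjection Y := by
  obtain ⟨n, X, hX, hXp⟩ := SeqLim.exists_proj g p
  obtain ⟨m, Y, hY, hYp⟩ := SeqLim.exists_proj g q
  refine ⟨max n m, seqHom g n _ (le_max_left _ _) X, seqHom g m _ (le_max_right _ _) Y,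
    (Proj.map (seqHom g n _ (le_max_left _ _)) ⟨X, hXp⟩).2, ?_, ?_,
    (Proj.map (seqHom g m _ (le_max_right _ _)) ⟨Y, hYp⟩).2⟩
  · rw [SeqLim.of_seqHom, hX]
  · rw [SeqLim.of_seqHom, hY]

end SeqProj

end MvN

namespace ProjKData

variable {E : Type u} {T : Type v} [CommCStarAlgebra E] [Group T] (K : ProjKData E T)

section KZero

variable {R : Type w} [CStarAlgebra R] [Algebra E R] [StarModule E R]

instance instHasOrthReps : HasOrthReps (K.Lim R) where
  exists_orth p q := by
    obtain ⟨n, X, Y, -, hX, hY, hYp⟩ := SeqLim.exists_proj₂ (fun n => K.rho (R := R) n) p q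
    have hB : K.bb R n * K.toSchurTower.incl n Y = K.toSchurTower.incl n Y * K.bb R n :=
      (K.bb_commute n Y).eq
    have hYs : star (K.toSchurTower.incl n Y) = K.toSchurTower.incl n Y := by
      rw [← map_star, hYp.isSelfAdjoint.star_eq]
    have hYY : K.toSchurTower.incl n Y * K.toSchurTower.incl n Y = K.toSchurTower.incl n Y := by
      rw [← map_mul, hYp.isIdempotentElem.eq]
    have hP : IsStarProjection (K.bb R n * K.toSchurTower.incl n Y) := by
      refine ⟨?_, ?_⟩
      · rw [IsIdempotentElem, mul_assoc, ← mul_assoc (K.toSchurTower.incl n Y), ← hB, mul_assoc,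
          hYY, ← mul_assoc, bb_mul_bb]
      · rw [IsSelfAdjoint, star_mul, star_bb, hYs, hB]
    refine ⟨p, Proj.map (K.toLim (n + 1)) ⟨_, hP⟩, MvN.refl p,
      ⟨K.toLim (n + 1) (K.cc R n * K.toSchurTower.incl n Y), ?_, ?_⟩, ?_⟩
    · rw [← hY, ← map_star, ← map_mul]
      refine Eq.trans ?_ (K.toLim_rho n Y)
      rw [rho_apply]
      congr 1
      rw [star_mul, hYs, mul_assoc, ← mul_assoc (star (K.cc R n))]
      change _ * (K.aa R n * _) = _
      rw [(K.aa_commute n Y).eq, ← mul_assoc, hYY]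
    · change _ = K.toLim (n + 1) (K.bb R n * K.toSchurTower.incl n Y)
      rw [← map_star, ← map_mul]
      congr 1
      rw [star_mul, hYs, mul_assoc, ← mul_assoc (K.toSchurTower.incl n Y), hYY,
        ← (K.star_cc_commute n Y).eq, ← mul_assoc]
      rfl
    · rw [← hX]
      refine Eq.trans (congrArg (fun z => z * K.toLim (n + 1)
        (K.bb R n * K.toSchurTower.incl n Y)) (K.toLim_rho n X).symm) ?_
      rw [← map_mul, rho_apply, (K.aa_commute n X).eq, mul_assoc, ← mul_assoc (K.aa R n),
        aa_mul_bb, zero_mul, mul_zero, map_zero]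

/-- The class in `R_→` of a projection of `R_n`. -/
def limProj (n : ℕ) (P : K.Lv R n) (hP : IsStarProjection P) : Proj (K.Lim R) :=
  Proj.map (K.toLim n) ⟨P, hP⟩

variable (R) in
/-- The Grothendieck group of the semigroup of Murray–von Neumann classes of projections
of `R_→`. -/
def K0Full : Type (max v w) := Algebra.GrothendieckAddGroup (VSet (K.Lim R))

variable (R) in
instance instAddCommGroupK0Full : AddCommGroup (K.K0Full R) :=
  inferInstanceAs (AddCommGroup (Algebra.GrothendieckAddGroup (VSet (K.Lim R))))

/-- The canonical map to the Grothendieck group. -/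
def toK0Full : VSet (K.Lim R) →+ K.K0Full R :=
  Algebra.GrothendieckAddGroup.of

theorem k0Full_hom_ext {A : Type*} [AddCommGroup A] {f g : K.K0Full R →+ A}
    (h : ∀ v, f (K.toK0Full v) = g (K.toK0Full v)) : f = g :=
  Algebra.GrothendieckAddGroup.lift.symm.injective (AddMonoidHom.ext h)

/-- The class `[P]_0` of a projection `P` of `R_n`. -/
def class0 (n : ℕ) (P : K.Lv R n) (hP : IsStarProjection P) : K.K0Full R :=
  K.toK0Full (VSet.mk (K.limProj n P hP))

variable {R' : Type*} [CStarAlgebra R'] [Algebra E R'] [StarModule E R'] (φ : R →⋆ₐ[E] R')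

/-- The homomorphism `[P]_0 ↦ [φ_n P]_0`. -/
def k0FullMap : K.K0Full R →+ K.K0Full R' :=
  Algebra.GrothendieckAddGroup.lift (K.toK0Full.comp (VSet.map (K.limMap φ)))

theorem k0FullMap_of (v : VSet (K.Lim R)) :
    K.k0FullMap φ (K.toK0Full v) = K.toK0Full (VSet.map (K.limMap φ) v) :=
  DFunLike.congr_fun (Algebra.GrothendieckAddGroup.lift.symm_apply_apply
    (K.toK0Full.comp (VSet.map (K.limMap φ)))) v

end KZero

end ProjKData

/-! ### The topology of the algebras `F_n` -/

/-- Morphisms of `E`-C*-algebras are continuous. -/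
theorem continuous_starAlgHom {E R R' : Type*} [CommCStarAlgebra E] [CStarAlgebra R] [Algebra E R]
    [IsScalarTower ℂ E R] [CStarAlgebra R'] [Algebra E R'] [IsScalarTower ℂ E R']
    (φ : R →⋆ₐ[E] R') : Continuous φ := by
  let ψ : R →⋆ₙₐ[ℂ] R' :=
    { toFun := φ
      map_smul' := fun c x => by
        rw [MonoidHom.id_apply, ← smul_one_smul E c x, map_smul, smul_one_smul]
      map_zero' := map_zero φ
      map_add' := map_add φ
      map_mul' := map_mul φ
      map_star' := map_star φ }
  refine AddMonoidHomClass.continuous_of_bound φ 1 fun x => ?_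
  rw [one_mul]
  exact NonUnitalStarAlgHom.norm_apply_le ψ x

namespace SchurTower

variable {E : Type u} {T : Type v} [CommCStarAlgebra E] [Group T] (S : SchurTower E T)

variable {R : Type w} [CStarAlgebra R] [Algebra E R] [StarModule E R]

instance instContinuousMulAlg (n : ℕ) : ContinuousMul (S.Alg R n) := by
  have : ContinuousMul (S.Mat R n) :=
    inferInstanceAs (ContinuousMul (Matrix (S.sub n) (S.sub n) R))
  exact ⟨((continuous_subtype_val.comp continuous_fst).mul
    (continuous_subtype_val.comp continuous_snd)).subtype_mk _⟩

instance instContinuousAddAlg (n : ℕ) : ContinuousAdd (S.Alg R n) :=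
  ⟨((continuous_subtype_val.comp continuous_fst).add
    (continuous_subtype_val.comp continuous_snd)).subtype_mk _⟩

instance instContinuousStarAlg (n : ℕ) : ContinuousStar (S.Alg R n) := by
  have : ContinuousStar (S.Mat R n) :=
    inferInstanceAs (ContinuousStar (Matrix (S.sub n) (S.sub n) R))
  exact ⟨(continuous_star.comp continuous_subtype_val).subtype_mk _⟩

theorem continuous_coefEquiv (n : ℕ) (t : S.sub n) :
    Continuous fun M : S.Alg R n => S.coefEquiv n M t :=
  (continuous_apply_apply (ρ := fun _ _ => R) t (1 : S.sub n)).comp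
    (continuous_subtype_val : Continuous fun M : S.Alg R n => M.1)

theorem continuous_coefEquiv_symm (n : ℕ) : Continuous (S.coefEquiv (R := R) n).symm := by
  refine Continuous.subtype_mk ?_ _
  refine continuous_pi fun s => continuous_pi fun r => ?_
  simp only [oper_apply]
  exact (continuous_apply _).mul continuous_const

variable {R' : Type*} [CStarAlgebra R'] [Algebra E R'] [StarModule E R']

theorem continuous_incl (n : ℕ) : Continuous (S.incl (R := R) n) := by
  refine (S.continuous_coefEquiv_symm (n + 1)).comp (continuous_pi fun t => ?_)
  by_cases ht : (t : T) ∈ S.sub n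
  · simp only [extend_of_mem _ _ ht]
    exact S.continuous_coefEquiv n _
  · simp only [extend_of_notMem _ _ ht]
    exact continuous_const

theorem continuous_lmap [IsScalarTower ℂ E R] [IsScalarTower ℂ E R'] (φ : R →⋆ₐ[E] R') (n : ℕ) :
    Continuous (S.lmap φ n) :=
  (S.continuous_coefEquiv_symm n).comp
    (continuous_pi fun t => (continuous_starAlgHom φ).comp (S.continuous_coefEquiv n t))

theorem eq_zero_of_star_mul_self {n : ℕ} (c : S.Alg R n) (h : star c * c = 0) : c = 0 := by
  let := CStarAlgebra.spectralOrder R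
  have := CStarAlgebra.spectralOrderedRing R
  apply S.toMat_injective n
  rw [map_zero]
  have h' : star (S.toMat n c) * S.toMat n c = 0 := by
    rw [← map_star, ← map_mul, h, map_zero]
  exact (CStarRing.star_mul_self_eq_zero_iff _).mp h'

end SchurTower

/-- Conjugation with a self-adjoint unitary `s` is conjugation with the unitary `i s`, which is
homotopic to `1`, along `cos θ + i sin θ s`. -/
theorem exists_joined_conj {E A : Type*} [CommCStarAlgebra E] [Ring A] [StarRing A]
    [Algebra E A] [StarModule E A] [TopologicalSpace A] [ContinuousAdd A] [ContinuousMul A]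
    (hE : Continuous (algebraMap E A)) (s : A) (hs : star s = s) (hss : s * s = 1) :
    ∃ u : unitary A, Joined 1 u ∧ ∀ x : A, u * x * star (u : A) = s * x * s := by
  let z : ℝ → A := fun θ => algebraMap E A (algebraMap ℂ E (Real.cos θ : ℂ))
  let y : ℝ → A := fun θ => algebraMap E A (algebraMap ℂ E (Complex.I * (Real.sin θ : ℂ)))
  have hz : Continuous z := hE.comp ((continuous_algebraMap ℂ E).comp
    (Complex.continuous_ofReal.comp Real.continuous_cos))
  have hy : Continuous y := hE.comp ((continuous_algebraMap ℂ E).comp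
    (continuous_const.mul (Complex.continuous_ofReal.comp Real.continuous_sin)))
  have hzs : ∀ θ, star (z θ) = z θ := fun θ => by
    simp only [z, ← algebraMap_star_comm, Complex.star_def, Complex.conj_ofReal]
  have hys : ∀ θ, star (y θ) = - y θ := fun θ => by
    simp only [y, ← algebraMap_star_comm]
    rw [← map_neg, ← map_neg]
    congr 2
    rw [Complex.star_def, map_mul, Complex.conj_I, Complex.conj_ofReal, neg_mul]
  have hzy : ∀ θ, z θ * z θ - y θ * y θ = 1 := fun θ => by
    simp only [z, y, ← map_mul, ← map_sub]
    have : (Real.cos θ : ℂ) * (Real.cos θ : ℂ) -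
        Complex.I * (Real.sin θ : ℂ) * (Complex.I * (Real.sin θ : ℂ)) = 1 := by
      have h1 := Complex.cos_sq_add_sin_sq (θ : ℂ)
      push_cast
      linear_combination h1 - Complex.sin θ ^ 2 * Complex.I_sq
    rw [this, map_one, map_one]
  have hcz : ∀ θ (x : A), x * z θ = z θ * x := fun θ x => (Algebra.commutes _ _).symm
  have hcy : ∀ θ (x : A), x * y θ = y θ * x := fun θ x => (Algebra.commutes _ _).symm
  have hw : ∀ θ, z θ + y θ * s ∈ unitary A := fun θ => by
    have e : star (z θ + y θ * s) = z θ - y θ * s := by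
      rw [star_add, star_mul, hs, hzs, hys, mul_neg, hcy, sub_eq_add_neg]
    have e1 : y θ * s * (y θ * s) = y θ * y θ := by
      rw [mul_assoc, ← mul_assoc s, hcy, mul_assoc, hss, mul_one]
    have e2 : y θ * s * z θ = z θ * (y θ * s) := hcz _ _
    rw [Unitary.mem_iff, e, sub_mul, mul_add, mul_add, add_mul, mul_sub, mul_sub, e1, e2]
    constructor
    · rw [← hzy θ]; abel
    · rw [← hzy θ]; abel
  let w : ℝ → unitary A := fun θ => ⟨z θ + y θ * s, hw θ⟩
  have hwc : Continuous w := (hz.add (hy.mul continuous_const)).subtype_mk _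
  have h0 : w 0 = 1 := Subtype.ext (by simp [w, z, y])
  refine ⟨w (Real.pi / 2), ⟨⟨⟨fun t => w (t * (Real.pi / 2)), by fun_prop⟩, ?_, ?_⟩⟩, fun x => ?_⟩
  · simp [h0]
  · simp
  · have hz1 : z (Real.pi / 2) = 0 := by simp [z]
    have hy1 : - (y (Real.pi / 2) * y (Real.pi / 2)) = 1 := by
      rw [← hzy (Real.pi / 2), hz1, mul_zero, zero_sub]
    have hv : ((w (Real.pi / 2) : unitary A) : A) = y (Real.pi / 2) * s := by
      change z (Real.pi / 2) + y (Real.pi / 2) * s = _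
      rw [hz1, zero_add]
    rw [hv, star_mul, hs, hys, mul_neg, hcy, mul_neg, ← mul_assoc, hcy, ← mul_assoc, ← mul_assoc,
      mul_assoc _ x s, mul_assoc _ s (x * s), ← neg_mul, hy1, one_mul, mul_assoc]

/-! ### The group `K_1` -/

namespace ProjKData

variable {E : Type u} {T : Type v} [CommCStarAlgebra E] [Group T] (K : ProjKData E T)

variable {R : Type w} [CStarAlgebra R] [Algebra E R] [StarModule E R] [IsScalarTower ℂ E R]

variable (R) in
/-- The unit of `R`, as a homomorphism `E → R`. -/
def unitHom : E →⋆ₐ[E] R :=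
  { Algebra.ofId E R with map_star' := fun α => algebraMap_star_comm α }

theorem continuous_tau (n : ℕ) : Continuous (K.tau (R := R) n) := by
  refine Continuous.subtype_mk ?_ _
  exact (continuous_const.mul
    ((K.toSchurTower.continuous_incl n).comp continuous_subtype_val)).add continuous_const

variable {R' : Type*} [CStarAlgebra R'] [Algebra E R'] [StarModule E R'] [IsScalarTower ℂ E R']

theorem continuous_unMap (φ : R →⋆ₐ[E] R') (n : ℕ) : Continuous (K.unMap φ n) :=
  Continuous.subtype_mk ((K.toSchurTower.continuous_lmap φ n).comp continuous_subtype_val) _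

variable (R) in
/-- The group `Un_{E_n} R_n` of unitaries of `R_n` which are homotopic in `Un R_n` to a unitary
of `E_n`. -/
def UnE (n : ℕ) : Subgroup (unitary (K.Lv R n)) where
  carrier := {U | ∃ W : unitary (K.Lv E n), Joined U (K.unMap (unitHom R) n W)}
  mul_mem' := by
    rintro U V ⟨W, h⟩ ⟨W', h'⟩
    exact ⟨W * W', by rw [map_mul]; exact h.mul h'⟩
  one_mem' := ⟨1, by rw [map_one]⟩
  inv_mem' := by
    rintro U ⟨W, h⟩
    exact ⟨W⁻¹, by rw [map_inv]; exact h.inv⟩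

theorem tau_mem_UnE {n : ℕ} {U : unitary (K.Lv R n)} (hU : U ∈ K.UnE R n) :
    K.tau n U ∈ K.UnE R (n + 1) := by
  obtain ⟨W, h⟩ := hU
  exact ⟨K.tau n W, by rw [unMap_tau]; exact h.map (K.continuous_tau n)⟩

theorem seqMonoidHom_mem_UnE {i j : ℕ} (h : i ≤ j) {U : unitary (K.Lv R i)} (hU : U ∈ K.UnE R i) :
    seqMonoidHom (fun n => K.tau (R := R) n) i j h U ∈ K.UnE R j := by
  induction j, h using Nat.le_induction with
  | base =>
    rw [seqMonoidHom_apply, seqMap_self]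
    exact hU
  | succ k hk ih =>
    rw [seqMonoidHom_apply, seqMap_succ _ hk]
    exact K.tau_mem_UnE ih

variable (R) in
/-- The subgroup `un_E R` of `un R`: the union of the images of the groups `Un_{E_n} R_n`. -/
def unE : Subgroup (K.LimUn R) where
  carrier := {u | ∃ n, ∃ U ∈ K.UnE R n, K.toLimUn n U = u}
  mul_mem' := by
    rintro _ _ ⟨n, U, hU, rfl⟩ ⟨m, V, hV, rfl⟩
    refine ⟨max n m, _, (K.UnE R _).mul_mem (K.seqMonoidHom_mem_UnE (le_max_left n m) hU)
      (K.seqMonoidHom_mem_UnE (le_max_right n m) hV), ?_⟩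
    rw [map_mul]
    exact congrArg₂ (fun x y => x * y)
      (SeqGrp.of_seqMonoidHom (fun n => K.tau (R := R) n) (le_max_left n m) U)
      (SeqGrp.of_seqMonoidHom (fun n => K.tau (R := R) n) (le_max_right n m) V)
  one_mem' := ⟨0, 1, (K.UnE R 0).one_mem, map_one _⟩
  inv_mem' := by
    rintro _ ⟨n, U, hU, rfl⟩
    exact ⟨n, U⁻¹, (K.UnE R n).inv_mem hU, map_inv _ _⟩

theorem C_mul_C (n : ℕ) : K.C n * K.C n = 0 := by
  apply K.toSchurTower.eq_zero_of_star_mul_self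
  have hA := (K.isStarProjection_A n).isIdempotentElem.eq
  calc star (K.C n * K.C n) * (K.C n * K.C n)
      = star (K.C n) * (star (K.C n) * K.C n) * K.C n := by simp only [star_mul, mul_assoc]
    _ = star (K.C n) * (1 - K.C n * star (K.C n)) * K.C n := by
        rw [eq_sub_of_add_eq (K.A_add_B n)]
    _ = star (K.C n) * K.C n - (star (K.C n) * K.C n) * (star (K.C n) * K.C n) := by
        rw [mul_sub, sub_mul, mul_one]; simp only [mul_assoc]
    _ = 0 := by rw [hA, sub_self]

theorem continuous_algebraMap_lvl (n : ℕ) : Continuous (algebraMap E (K.Lv R n)) := by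
  have h : ∀ c : E, algebraMap E (K.Lv R n) c =
      (K.toSchurTower.coefEquiv n).symm (Pi.single 1 (algebraMap E R c)) := fun c => by
    rw [Equiv.eq_symm_apply, SchurTower.coefEquiv_algebraMap]
  have h1 : Continuous (algebraMap E R) :=
    continuous_starAlgHom (E := E) (R := E) (R' := R) (unitHom R)
  rw [funext h]
  exact (K.toSchurTower.continuous_coefEquiv_symm n).comp ((continuous_single 1).comp h1)

theorem swap_conj {A : Type*} [Ring A] [StarRing A] (c x : A) (hcc : c * c = 0)
    (hAB : star c * c + c * star c = 1) (h1 : c * x = x * c) (h2 : star c * x = x * star c) :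
    (c + star c) * (star c * c * x + c * star c) * (c + star c) = c * star c * x + star c * c := by
  have hss : star c * star c = 0 := by rw [← star_mul, hcc, star_zero]
  have e1 : (c + star c) * (star c * c * x + c * star c) = c * star c * c * x + star c * c * star c := by
    simp only [add_mul, mul_add, ← mul_assoc, hcc, hss, zero_mul, add_zero, zero_add]
  have e2 : c * star c * c = c := by
    rw [eq_sub_of_add_eq' hAB, sub_mul, one_mul, mul_assoc, hcc, mul_zero, sub_zero]
  have e3 : star c * c * star c = star c := by
    rw [eq_sub_of_add_eq hAB, sub_mul, one_mul, mul_assoc, hss, mul_zero, sub_zero]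
  rw [e1, e2, e3, add_mul, mul_add, mul_add, hss, add_zero, mul_assoc c x c, ← h1, ← mul_assoc, hcc,
    zero_mul, zero_add, mul_assoc c x, ← h2, ← mul_assoc]

/-- The commutators of `un R` belong to `un_E R`. -/
theorem commutator_mem (u v : K.LimUn R) : u * v * u⁻¹ * v⁻¹ ∈ K.unE R := by
  obtain ⟨n, U, V, rfl, rfl⟩ := SeqGrp.exists_of₂ (fun n => K.tau (R := R) n) u v
  have hcc : K.cc R n * K.cc R n = 0 := by rw [cc, ← map_mul, C_mul_C, map_zero]
  have hss : star (K.cc R n) * star (K.cc R n) = 0 := by rw [← star_mul, hcc, star_zero]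
  have hAB : star (K.cc R n) * K.cc R n + K.cc R n * star (K.cc R n) = 1 := K.aa_add_bb R n
  obtain ⟨w, hw1, hw2⟩ := exists_joined_conj (A := K.Lv R (n + 1))
    (K.continuous_algebraMap_lvl (n + 1)) (K.cc R n + star (K.cc R n))
    (by rw [star_add, star_star]; exact add_comm _ _)
    (by rw [add_mul, mul_add, mul_add, hcc, hss, zero_add, add_zero]; exact (add_comm _ _).trans hAB)
  obtain ⟨V', hV'⟩ : ∃ V', V' = w * K.tau n V * w⁻¹ := ⟨_, rfl⟩
  have hb : Joined (K.tau n V) V' := by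
    have := (hw1.mul (Joined.refl (K.tau n V))).mul hw1.inv
    rw [hV']
    simpa using this
  have hval : (V' : K.Lv R (n + 1)) = K.bb R n * K.toSchurTower.incl n V + K.aa R n := by
    have h := hw2 (K.tau n V : K.Lv R (n + 1))
    rw [hV']
    exact h.trans (swap_conj _ _ hcc hAB (K.cc_commute n (V : K.Lv R n)).eq
      (K.star_cc_commute n (V : K.Lv R n)).eq)
  have hcomm : K.tau n U * V' = V' * K.tau n U := by
    apply Subtype.ext
    rw [Submonoid.coe_mul, Submonoid.coe_mul, hval, coe_tau]
    generalize hX : K.toSchurTower.incl n (U : K.Lv R n) = X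
    generalize hY : K.toSchurTower.incl n (V : K.Lv R n) = Y
    have a1 : K.aa R n * X = X * K.aa R n := hX ▸ (K.aa_commute n (U : K.Lv R n)).eq
    have a2 : K.bb R n * X = X * K.bb R n := hX ▸ (K.bb_commute n (U : K.Lv R n)).eq
    have a3 : K.aa R n * Y = Y * K.aa R n := hY ▸ (K.aa_commute n (V : K.Lv R n)).eq
    have a4 : K.bb R n * Y = Y * K.bb R n := hY ▸ (K.bb_commute n (V : K.Lv R n)).eq
    have l1 : K.aa R n * X * (K.bb R n * Y) = 0 := by
      rw [a1, mul_assoc, ← mul_assoc (K.aa R n), aa_mul_bb, zero_mul, mul_zero]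
    have l2 : K.bb R n * Y * (K.aa R n * X) = 0 := by
      rw [a4, mul_assoc, ← mul_assoc (K.bb R n), bb_mul_aa, zero_mul, mul_zero]
    rw [add_mul, mul_add, mul_add, add_mul, mul_add, mul_add, l1, l2, aa_mul_bb, bb_mul_aa,
      ← mul_assoc (K.bb R n), bb_mul_bb, a4, mul_assoc Y, bb_mul_bb, ← mul_assoc (K.aa R n),
      aa_mul_aa, a1, mul_assoc X, aa_mul_aa]
    simp only [zero_add, add_zero]
    exact add_comm _ _
  refine ⟨n + 1, K.tau n U * K.tau n V * (K.tau n U)⁻¹ * (K.tau n V)⁻¹, ⟨1, ?_⟩, ?_⟩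
  · have := (((Joined.refl (K.tau n U)).mul hb).mul (Joined.refl (K.tau n U)⁻¹)).mul hb.inv
    rw [hcomm] at this
    rw [map_one]
    simpa using this
  · rw [map_mul, map_mul, map_mul, map_inv, map_inv, toLimUn_tau, toLimUn_tau]
    rfl

instance instNormalUnE : (K.unE R).Normal where
  conj_mem u hu v := by
    have := (K.unE R).mul_mem (K.commutator_mem v u) hu
    rwa [inv_mul_cancel_right] at this

variable (R) in
/-- The group `K_1` of a unital algebra `R`: the quotient `un R / un_E R`, which is
commutative, written additively. -/
def K1Full : Type (max v w) := Additive (K.LimUn R ⧸ K.unE R)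

instance instAddCommGroupK1Full : AddCommGroup (K.K1Full R) :=
  { (inferInstance : AddGroup (Additive (K.LimUn R ⧸ K.unE R))) with
    add_comm := by
      intro a b
      obtain ⟨u, rfl⟩ := QuotientGroup.mk'_surjective (K.unE R) a
      obtain ⟨v, rfl⟩ := QuotientGroup.mk'_surjective (K.unE R) b
      change QuotientGroup.mk' (K.unE R) u * QuotientGroup.mk' (K.unE R) v =
        QuotientGroup.mk' (K.unE R) v * QuotientGroup.mk' (K.unE R) u
      rw [← map_mul, ← map_mul]
      refine (QuotientGroup.eq.mpr ?_)
      have := K.commutator_mem v⁻¹ u⁻¹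
      rw [inv_inv, inv_inv] at this
      simpa [mul_assoc] using this }

/-- The class `[U]_1` of a unitary `U` of `R_n`. -/
def class1 (n : ℕ) (U : unitary (K.Lv R n)) : K.K1Full R :=
  Additive.ofMul (QuotientGroup.mk' (K.unE R) (K.toLimUn n U))

theorem limUnMap_mem (φ : R →⋆ₐ[E] R') {u : K.LimUn R} (hu : u ∈ K.unE R) :
    K.limUnMap φ u ∈ K.unE R' := by
  obtain ⟨n, U, ⟨W, hW⟩, rfl⟩ := hu
  refine ⟨n, K.unMap φ n U, ⟨W, ?_⟩, rfl⟩
  have := hW.map (K.continuous_unMap φ n)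
  have e : K.unMap φ n (K.unMap (unitHom R) n W) = K.unMap (unitHom R') n W :=
    Subtype.ext (K.toSchurTower.lmap_unitMap φ n W)
  rwa [e] at this

/-- The homomorphism `[U]_1 ↦ [φ_n U]_1`. -/
def k1FullMap (φ : R →⋆ₐ[E] R') : K.K1Full R →+ K.K1Full R' :=
  MonoidHom.toAdditive (QuotientGroup.map (K.unE R) (K.unE R') (K.limUnMap φ)
    fun _ hu => K.limUnMap_mem φ hu)

end ProjKData

/-! ### K-theory of `E`-C*-algebras and the index map -/

namespace ProjKData

variable {E : Type u} {T : Type v} [CommCStarAlgebra E] [Group T] (K : ProjKData E T)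

section Full

variable {R R' R'' : Type*} [CStarAlgebra R] [Algebra E R] [StarModule E R]
  [CStarAlgebra R'] [Algebra E R'] [StarModule E R']
  [CStarAlgebra R''] [Algebra E R''] [StarModule E R'']

theorem lmap_isStarProjection (φ : R →⋆ₐ[E] R') {n : ℕ} {P : K.Lv R n} (hP : IsStarProjection P) :
    IsStarProjection (K.toSchurTower.lmap φ n P) :=
  (Proj.map (K.lmapHom φ n) ⟨P, hP⟩).2

theorem k0FullMap_class0 (φ : R →⋆ₐ[E] R') (n : ℕ) (P : K.Lv R n) (hP : IsStarProjection P) :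
    K.k0FullMap φ (K.class0 n P hP) =
      K.class0 n (K.toSchurTower.lmap φ n P) (K.lmap_isStarProjection φ hP) :=
  K.k0FullMap_of φ _

theorem k0FullMap_comp (χ : R' →⋆ₐ[E] R'') (φ : R →⋆ₐ[E] R') (x : K.K0Full R) :
    K.k0FullMap χ (K.k0FullMap φ x) = K.k0FullMap (χ.comp φ) x := by
  refine DFunLike.congr_fun (f := (K.k0FullMap χ).comp (K.k0FullMap φ))
    (K.k0Full_hom_ext fun v => ?_) x
  rw [AddMonoidHom.comp_apply]
  rw [k0FullMap_of, k0FullMap_of, k0FullMap_of]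
  congr 1
  obtain ⟨p, rfl⟩ := Quotient.exists_rep v
  refine congrArg VSet.mk (Subtype.ext ?_)
  obtain ⟨n, X, hX⟩ := SeqLim.exists_of (fun n => K.rho (R := R) n) p.1
  change K.limMap χ (K.limMap φ p.1) = K.limMap (χ.comp φ) p.1
  rw [← hX]
  exact congrArg (K.toLim n) (K.toSchurTower.lmap_comp χ φ n X)

/-- For morphisms `φ : R → R'`, `ψ : R' → R''` and `U ∈ Un R''_n`, a pair `V ∈ Un R'_{n+1}`,
`P ∈ Pr R_{n+1}` such that `ψ_{n+1} V = A_{n+1} U + B_{n+1} U*` and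
`φ_{n+1} P = V A_{n+1} V*`. -/
structure IsIndexLift (φ : R →⋆ₐ[E] R') (ψ : R' →⋆ₐ[E] R'') (n : ℕ)
    (U : unitary (K.Lv R'' n)) (V : unitary (K.Lv R' (n + 1))) (P : K.Lv R (n + 1)) : Prop where
  isStarProjection : IsStarProjection P
  map_V : K.toSchurTower.lmap ψ (n + 1) (V : K.Lv R' (n + 1)) =
    K.aa R'' n * K.toSchurTower.incl n (U : K.Lv R'' n) +
      K.bb R'' n * K.toSchurTower.incl n (star (U : K.Lv R'' n))
  map_P : K.toSchurTower.lmap φ (n + 1) P =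
    (V : K.Lv R' (n + 1)) * K.aa R' n * star (V : K.Lv R' (n + 1))

/-- The element `[P]_0 - [σ_n P]_0`, for a projection `P` of `R_n` and an endomorphism `σ` of `R`. -/
def class0Diff (σ : R →⋆ₐ[E] R) (n : ℕ) (P : K.Lv R n) (hP : IsStarProjection P) : K.K0Full R :=
  K.class0 n P hP - K.class0 n (K.toSchurTower.lmap σ n P) (K.lmap_isStarProjection σ hP)

end Full

variable (F : Type w) {G H : Type*}
  [NonUnitalCStarAlgebra F] [Module E F]
  [IsScalarTower ℂ E F] [IsScalarTower E F F] [SMulCommClass E F F] [StarModule E F]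
  [IsBoundedSMul E F]
  [NonUnitalCStarAlgebra G] [Module E G]
  [IsScalarTower ℂ E G] [IsScalarTower E G G] [SMulCommClass E G G] [StarModule E G]
  [IsBoundedSMul E G]
  [NonUnitalCStarAlgebra H] [Module E H]
  [IsScalarTower ℂ E H] [IsScalarTower E H H] [SMulCommClass E H H] [StarModule E H]
  [IsBoundedSMul E H]

/-- `K_0(F)`, the kernel of the map `[P]_0 ↦ [π P]_0` from the Grothendieck group of the classes of
projections of `F̌` to that of `E`. -/
def K0 : AddSubgroup (K.K0Full (Check E F)) := (K.k0FullMap (Check.piHom E F)).ker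

/-- `K_1(F) = un F̌ / un_E F̌`. -/
abbrev K1 : Type (max u v w) := K.K1Full (Check E F)

variable {F}

/-- `K_0(φ)`, the restriction of `[P]_0 ↦ [φ̌ P]_0`. -/
def K0Map (φ : F →⋆ₙₐ[E] G) : K.K0 F →+ K.K0 G :=
  ((K.k0FullMap (Check.mapHom φ)).comp (K.K0 F).subtype).codRestrict (K.K0 G) fun x => by
    have hx : K.k0FullMap (Check.piHom E F) x = 0 := x.2
    change K.k0FullMap (Check.piHom E G) (K.k0FullMap (Check.mapHom φ) x) = 0
    rw [k0FullMap_comp, Check.piHom_comp_mapHom, hx]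

theorem coe_K0Map (φ : F →⋆ₙₐ[E] G) (x : K.K0 F) :
    (K.K0Map φ x : K.K0Full (Check E G)) = K.k0FullMap (Check.mapHom φ) x := rfl

/-- `K_1(φ)`, the map `[U]_1 ↦ [φ̌ U]_1`. -/
def K1Map (φ : F →⋆ₙₐ[E] G) : K.K1 F →+ K.K1 G := K.k1FullMap (Check.mapHom φ)

/-- `δ` is the index map of `F → G → H`: every `U ∈ Un Ȟ_n` has a lift `(V, P)`, and
`δ [U]_1 = [P]_0 - [σ P]_0` for every such lift. -/
def IsIndexMap (φ : F →⋆ₙₐ[E] G) (ψ : G →⋆ₙₐ[E] H) (δ : K.K1 H →+ K.K0 F) : Prop :=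
  ∀ (n : ℕ) (U : unitary (K.Lv (Check E H) n)),
    (∃ V P, K.IsIndexLift (Check.mapHom φ) (Check.mapHom ψ) n U V P) ∧
    ∀ V P, ∀ h : K.IsIndexLift (Check.mapHom φ) (Check.mapHom ψ) n U V P,
      (δ (K.class1 n U) : K.K0Full (Check E F)) =
        K.class0Diff (Check.sigmaHom E F) (n + 1) P h.isStarProjection

end ProjKData

end ProjK

end

/-!
Write `R_n` for the level `n` algebra of a unital `R`, and let `π : F̌ → E` be the augmentation.
The elements `A_{n+1}`, `C_{n+1}*`, `C_{n+1}`, `B_{n+1}` are `2 × 2` matrix units in `R_{n+1}` that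
commute with `R_n`, so `R_{n+1}` contains the matrix algebra `M_2(R_n)` (`ProjKData.mat2`). In these
terms `R_n → R_{n+1}` is `X ↦ diag(X, 0)` for `K_0` and `U ↦ diag(U, 1)` for `K_1`, and
`A_{n+1} U + B_{n+1} U*` is `diag(U, U*)`. The usual proof of exactness at the index map can then be
run with `M_2(R_n) ⊆ R_{n+1}` in place of matrices of growing size.

Four facts carry the argument.

* Unitaries joined to `1` lift along surjections (`SchurTower.exists_joined_lift`): a path of
  unitaries from `1` ends at a product of exponentials `exp (i h)` with `h` self-adjoint, and
  self-adjoint elements lift. This is applied to `R_n`, which is a C*-algebra because it is a closed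
  subalgebra of the matrices over `R`. Since `diag(U, U*)` is joined to `1`, index lifts `(V, P)`
  exist.
* Exactness of `F → G → H` turns into: `φ̌` is injective, `ψ̌` is surjective, and an element of
  `Ǧ_n` whose image under `ψ̌_n` lies in `E_n` comes from `F̌_n` (`IsExactPair.exists_lmap_eq`). So
  two projections of `F̌_n` have the same class as soon as they are equivalent in `Ǧ_n` through a
  partial isometry with `ψ̌`-image in `E_n` (`IsExactPair.class0_eq`). Independence of the index of
  the choice of `(V, P)`, its invariance under `U ↦ U ψ̌(Y)` and its additivity on `diag(U, U')` are
  then each proved by exhibiting such a partial isometry; additivity on products follows because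
  `diag(U U', 1) = diag(U, U') diag(U', U'*)` and the last factor lifts to `Ǧ`.
* If `[P]_0 = [Q]_0` in `R_n`, then, at a higher level and after adding a projection `e` of
  `E_m` orthogonal to both, `P + e` and `Q + e` are conjugate by a unitary joined to `1`
  (`ProjKData.exists_conj_of_class0_eq`). That `e` has coefficients in `E` keeps
  the images of `P + e` in `Ǧ` and `Ȟ` comparable with elements of `E_m`.
* Every element of `K_0(F)` is of the form `[P]_0 - [π P]_0` with `P` a projection of `F̌_n`
  (`ProjKData.exists_class0_sub_unitMap`).

Exactness at `K_1(G)` follows from the first two facts. At `K_1(H)`, if `U` has index zero, the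
third fact gives `w ∈ Un F̌_m` conjugating `P + e` to `A_{n+1} + e`, and a correction of `V` by `w`
commutes with `A_{n+1} + e`; cutting it down to that projection gives a lift of `diag(U, 1)`. At
`K_0(F)`, a unitary of `Ǧ` that conjugates `q = π P` to `φ̌ P` has a `ψ̌`-image commuting with
`q`; its restriction to `q` has index `[P]_0 - [q]_0`. At `K_0(G)`, the conjugating
unitary of `Ȟ` is joined to `1`, hence lifts to `Ǧ`, and conjugates the given projection into `F̌`.
-/

noncomputable section

namespace ProjK

universe u v w

open scoped Topology

/-! ### Lifting unitaries along surjections -/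

section Cstar
variable {A B : Type*} [CStarAlgebra A] [CStarAlgebra B]

/-- Unitaries in the path component of `1` lift along surjective *-homomorphisms. -/
theorem exists_joined_lift (f : A →⋆ₐ[ℂ] B) (hf : Function.Surjective f) (u : unitary B)
    (hu : Joined 1 u) : ∃ y : unitary A, Joined 1 y ∧ f y = u := by
  obtain ⟨l, rfl⟩ := Unitary.mem_pathComponentOne_iff.mp hu
  clear hu
  induction l with
  | nil => exact ⟨1, Joined.refl _, by simp⟩
  | cons x l ih =>
    obtain ⟨y, hy, hyl⟩ := ih
    obtain ⟨z, hz⟩ := hf x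
    -- The real part of any lift of the self-adjoint `x` is a self-adjoint lift.
    have hs : f (((1 / 2 : ℂ)) • (z + star z)) = x := by
      rw [map_smul, map_add, map_star, hz, selfAdjoint.star_val_eq, ← two_smul ℂ, smul_smul]
      norm_num
    have hsa : IsSelfAdjoint (((1 / 2 : ℂ)) • (z + star z)) := by
      rw [IsSelfAdjoint, star_smul, star_add, star_star, add_comm]
      simp
    refine ⟨selfAdjoint.expUnitary ⟨_, hsa⟩ * y, ?_, ?_⟩
    · simpa using (selfAdjoint.joined_one_expUnitary ⟨_, hsa⟩).mul hy
    · have hc : Continuous f := by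
        refine AddMonoidHomClass.continuous_of_bound f 1 fun x => ?_
        rw [one_mul]
        exact NonUnitalStarAlgHom.norm_apply_le f x
      let : NormedAlgebra ℚ A := .restrictScalars ℚ ℂ A
      let : NormedAlgebra ℚ B := .restrictScalars ℚ ℂ B
      rw [Submonoid.coe_mul, map_mul, hyl, List.map_cons, List.prod_cons, Submonoid.coe_mul,
        selfAdjoint.expUnitary_coe, selfAdjoint.expUnitary_coe, NormedSpace.map_exp f hc,
        map_smul, hs]

end Cstar

namespace SchurTower

variable {E : Type u} {T : Type v} [CommCStarAlgebra E] [Group T] (S : SchurTower E T)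
variable (R : Type w) [CStarAlgebra R] [Algebra E R] [StarModule E R] [IsScalarTower ℂ E R]

theorem continuous_toMat (n : ℕ) : Continuous (S.toMat (R := R) n) := continuous_subtype_val

/-- The algebra `R_n` is closed in the matrices over `R`. -/
theorem isClosed_range_toMat (n : ℕ) : IsClosed (Set.range (S.toMat (R := R) n)) := by
  have hc : Continuous fun M : S.Mat R n => S.coef M := continuous_pi fun t =>
    continuous_apply_apply (ρ := fun _ _ => R) t (1 : S.sub n)
  -- A matrix lies in `R_n` if and only if it is the operator given by its own first column.
  have e : Set.range (S.toMat (R := R) n) = {M : S.Mat R n | S.oper (S.coef M) = M} := by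
    ext M
    constructor
    · rintro ⟨⟨_, X, rfl⟩, rfl⟩
      exact congrArg S.oper (S.coef_oper X)
    · intro h
      exact ⟨(S.coefEquiv n).symm (S.coef M), h⟩
  rw [e]
  exact isClosed_eq (((S.continuous_toMat R n).comp (S.continuous_coefEquiv_symm n)).comp hc)
    continuous_id

/-- The C*-algebra structure of `R_n`, as a closed subalgebra of the matrices over `R`, whose norm
is the one of operators on a Hilbert module. The scalars `ℂ` act through `E`, and the topology is
the one `R_n` already has, so that paths of unitaries mean the same for both. It is not an instance,
since only the lifting of unitaries needs the norm. -/
@[reducible] def cstarAlg (n : ℕ) : CStarAlgebra (S.Alg R n) := by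
  letI := CStarAlgebra.spectralOrder R
  haveI := CStarAlgebra.spectralOrderedRing R
  letI nr : NormedRing (S.Alg R n) := NormedRing.induced (S.Alg R n) (S.Mat R n) (S.toMat n)
    (S.toMat_injective n)
  have hnorm : ∀ x : S.Alg R n, ‖x‖ = ‖S.toMat n x‖ := fun _ => rfl
  have hsm : ∀ (c : ℂ) (M : S.Mat R n), algebraMap ℂ E c • M = c • M := fun c M => by
    ext i j
    exact algebraMap_smul E c (M i j)
  letI na : NormedAlgebra ℂ (S.Alg R n) :=
    { Algebra.compHom (S.Alg R n) (algebraMap ℂ E) with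
      norm_smul_le := fun c x => by
        change ‖S.toMat n (algebraMap ℂ E c • x)‖ ≤ _
        rw [map_smul, hsm]
        exact norm_smul_le c (S.toMat n x) }
  exact
    { nr, na, S.instStarRingAlg R n with
      complete := fun {_} h => ((completeSpace_iff_isComplete_range (f := S.toMat (R := R) n)
        ⟨rfl⟩).mpr (S.isClosed_range_toMat R n).isComplete).complete h
      norm_mul_self_le := fun x => by
        rw [hnorm, hnorm, map_mul, map_star]
        exact CStarRing.norm_mul_self_le _
      star_smul := fun c x => by
        change star (algebraMap ℂ E c • x) = algebraMap ℂ E (star c) • star x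
        rw [star_smul, algebraMap_star_comm] }

variable {R} {R' : Type*} [CStarAlgebra R'] [Algebra E R'] [StarModule E R'] [IsScalarTower ℂ E R']

/-- Unitaries of `R'_n` in the path component of `1` lift along `f_n` for surjective `f`, to
unitaries in the path component of `1`. -/
theorem exists_joined_lift (f : R →⋆ₐ[E] R') (hf : Function.Surjective f) (n : ℕ)
    (u : unitary (S.Alg R' n)) (hu : Joined 1 u) :
    ∃ y : unitary (S.Alg R n), Joined 1 y ∧ S.lmap f n y = u := by
  let := S.cstarAlg R n
  let := S.cstarAlg R' n
  have hs : Function.Surjective (S.lmap f n) := fun M => by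
    choose g hg using hf
    refine ⟨(S.coefEquiv n).symm fun t => g (S.coefEquiv n M t), (S.coefEquiv n).injective ?_⟩
    rw [lmap, coefEquiv_homOfCoef]
    ext t
    simp [hg]
  exact ProjK.exists_joined_lift (A := S.Alg R n) (B := S.Alg R' n)
    { S.lmap f n with
      map_zero' := map_zero (S.lmap f n)
      map_add' := map_add (S.lmap f n)
      commutes' := fun c => (S.lmap f n).commutes (algebraMap ℂ E c) } hs u hu

end SchurTower

/-! ### The matrix units `A`, `C*`, `C`, `B` -/

namespace ProjKData

variable {E : Type u} {T : Type v} [CommCStarAlgebra E] [Group T] (K : ProjKData E T)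

section Mat2

variable {R : Type w} [CStarAlgebra R] [Algebra E R] [StarModule E R]

/-- The matrix `(a b; c d)` over `R_n`, as the element `A a + C* b + C c + B d` of `R_{n+1}`, where
`A`, `C*`, `C`, `B` (in Lean `aa n`, `star (cc n)`, `cc n`, `bb n`, living in level `n + 1`) are
matrix units commuting with `R_n`. -/
def mat2 (n : ℕ) (a b c d : K.Lv R n) : K.Lv R (n + 1) :=
  K.aa R n * K.toSchurTower.incl n a + star (K.cc R n) * K.toSchurTower.incl n b +
    K.cc R n * K.toSchurTower.incl n c + K.bb R n * K.toSchurTower.incl n d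

theorem cc_mul_cc (n : ℕ) : K.cc R n * K.cc R n = 0 := by
  rw [cc, ← map_mul, C_mul_C, map_zero]

theorem star_cc_mul_star_cc (n : ℕ) : star (K.cc R n) * star (K.cc R n) = 0 := by
  rw [← star_mul, cc_mul_cc, star_zero]

theorem cc_mul_star_cc_mul_cc (n : ℕ) : K.cc R n * (star (K.cc R n) * K.cc R n) = K.cc R n := by
  have h := K.aa_add_bb R n
  rw [aa, bb] at h
  rw [eq_sub_of_add_eq h, mul_sub, mul_one, ← mul_assoc, cc_mul_cc, zero_mul, sub_zero]

theorem star_cc_mul_cc_mul_star_cc (n : ℕ) :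
    star (K.cc R n) * (K.cc R n * star (K.cc R n)) = star (K.cc R n) := by
  have h := congrArg star (K.cc_mul_star_cc_mul_cc (R := R) n)
  simpa only [star_mul, star_star, mul_assoc] using h

/-- Products of the elements `mat2` are matrix products. -/
theorem mat2_mul (n : ℕ) (a b c d a' b' c' d' : K.Lv R n) :
    K.mat2 n a b c d * K.mat2 n a' b' c' d' =
      K.mat2 n (a * a' + b * c') (a * b' + b * d') (c * a' + d * c') (c * b' + d * d') := by
  have e : ∀ (x y : K.Lv R (n + 1)) (r s : K.Lv R n), Commute y (K.toSchurTower.incl n r) →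
      x * K.toSchurTower.incl n r * (y * K.toSchurTower.incl n s) =
        x * y * K.toSchurTower.incl n (r * s) := fun x y r s h => by
    rw [map_mul, mul_assoc, ← mul_assoc _ y, ← h.eq]
    simp only [mul_assoc]
  have hA := K.aa_commute (R := R) n
  have hB := K.bb_commute (R := R) n
  have hC := K.cc_commute (R := R) n
  have hD := K.star_cc_commute (R := R) n
  have h1 := K.cc_mul_star_cc_mul_cc (R := R) n
  have h2 := K.star_cc_mul_cc_mul_star_cc (R := R) n
  have h3 := K.cc_mul_cc (R := R) n
  have h4 := K.star_cc_mul_star_cc (R := R) n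
  simp only [mat2, add_mul, mul_add, map_add, e _ _ _ _ (hA _), e _ _ _ _ (hB _), e _ _ _ _ (hC _),
    e _ _ _ _ (hD _), aa_mul_aa, bb_mul_bb, aa_mul_bb, bb_mul_aa]
  have t1 : K.aa R n * star (K.cc R n) = star (K.cc R n) := by rw [aa, mul_assoc, h2]
  have t2 : K.aa R n * K.cc R n = 0 := by rw [aa, mul_assoc, h3, mul_zero]
  have t3 : star (K.cc R n) * K.aa R n = 0 := by rw [aa, ← mul_assoc, h4, zero_mul]
  have t4 : star (K.cc R n) * K.bb R n = star (K.cc R n) := by rw [bb, h2]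
  have t5 : K.cc R n * K.aa R n = K.cc R n := by rw [aa, h1]
  have t6 : K.cc R n * K.bb R n = 0 := by rw [bb, ← mul_assoc, h3, zero_mul]
  have t7 : K.bb R n * star (K.cc R n) = 0 := by rw [bb, mul_assoc, h4, mul_zero]
  have t8 : K.bb R n * K.cc R n = K.cc R n := by rw [bb, mul_assoc, h1]
  have t9 : star (K.cc R n) * K.cc R n = K.aa R n := rfl
  have t10 : K.cc R n * star (K.cc R n) = K.bb R n := rfl
  simp only [t1, t2, t3, t4, t5, t6, t7, t8, t9, t10, h3, h4, zero_mul, add_zero, zero_add]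
  abel

theorem mat2_star (n : ℕ) (a b c d : K.Lv R n) :
    star (K.mat2 n a b c d) = K.mat2 n (star a) (star c) (star b) (star d) := by
  simp only [mat2, star_add, star_mul, star_aa, star_bb, star_star, ← map_star]
  rw [(K.aa_commute n _).eq, (K.bb_commute n _).eq, (K.cc_commute n _).eq,
    (K.star_cc_commute n _).eq]
  abel

theorem mat2_one (n : ℕ) : K.mat2 (R := R) n 1 0 0 1 = 1 := by
  simp [mat2, aa_add_bb]

theorem mat2_add (n : ℕ) (a b c d a' b' c' d' : K.Lv R n) :
    K.mat2 n a b c d + K.mat2 n a' b' c' d' = K.mat2 n (a + a') (b + b') (c + c') (d + d') := by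
  simp only [mat2, map_add, mul_add]
  abel

theorem mat2_sub (n : ℕ) (a b c d a' b' c' d' : K.Lv R n) :
    K.mat2 n a b c d - K.mat2 n a' b' c' d' = K.mat2 n (a - a') (b - b') (c - c') (d - d') := by
  simp only [mat2, map_sub, mul_sub]
  abel

theorem mat2_zero (n : ℕ) : K.mat2 (R := R) n 0 0 0 0 = 0 := by
  simp [mat2]

theorem rho_eq_mat2 (n : ℕ) (X : K.Lv R n) : K.rho n X = K.mat2 n X 0 0 0 := by
  simp [mat2, rho_apply]

theorem aa_eq_mat2 (n : ℕ) : K.aa R n = K.mat2 n 1 0 0 0 := by simp [mat2]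

theorem bb_eq_mat2 (n : ℕ) : K.bb R n = K.mat2 n 0 0 0 1 := by simp [mat2]

theorem cc_eq_mat2 (n : ℕ) : K.cc R n = K.mat2 n 0 0 1 0 := by simp [mat2]

theorem incl_eq_mat2 (n : ℕ) (X : K.Lv R n) : K.toSchurTower.incl n X = K.mat2 n X 0 0 X := by
  simp [mat2, ← add_mul, aa_add_bb]

theorem coe_tau_eq_mat2 (n : ℕ) (U : unitary (K.Lv R n)) :
    (K.tau n U : K.Lv R (n + 1)) = K.mat2 n U 0 0 1 := by
  simp [mat2, coe_tau]

variable {R' : Type*} [CStarAlgebra R'] [Algebra E R'] [StarModule E R'] (φ : R →⋆ₐ[E] R')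

theorem lmap_mat2 (n : ℕ) (a b c d : K.Lv R n) :
    K.toSchurTower.lmap φ (n + 1) (K.mat2 n a b c d) =
      K.mat2 n (K.toSchurTower.lmap φ n a) (K.toSchurTower.lmap φ n b)
        (K.toSchurTower.lmap φ n c) (K.toSchurTower.lmap φ n d) := by
  simp only [mat2, map_add, map_mul, map_star, lmap_aa, lmap_bb, lmap_cc, SchurTower.lmap_incl]

theorem unitMap_mat2 (n : ℕ) (a b c d : K.Lv E n) :
    K.toSchurTower.unitMap R (n + 1) (K.mat2 n a b c d) =
      K.mat2 n (K.toSchurTower.unitMap R n a) (K.toSchurTower.unitMap R n b)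
        (K.toSchurTower.unitMap R n c) (K.toSchurTower.unitMap R n d) :=
  K.lmap_mat2 _ n a b c d

end Mat2

/-! ### Unitaries of `M_2(R_n)` joined to `1` -/

section Joined

variable {R : Type w} [CStarAlgebra R] [Algebra E R] [StarModule E R] [IsScalarTower ℂ E R]

/-- The unitary `diag(U, U*)` is joined to `1`: it is `diag(U, 1) w diag(U*, 1) w*`, for a unitary
`w` joined to `1` which conjugates by the flip `(0 1; 1 0)`. -/
theorem exists_unitary_diag_star (n : ℕ) (U : unitary (K.Lv R n)) :
    ∃ D : unitary (K.Lv R (n + 1)), (D : K.Lv R (n + 1)) = K.mat2 n U 0 0 (star (U : K.Lv R n)) ∧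
      Joined 1 D := by
  obtain ⟨w, hw1, hw2⟩ := exists_joined_conj (A := K.Lv R (n + 1))
    (K.continuous_algebraMap_lvl (n + 1)) (K.mat2 n 0 1 1 0)
    (by simp [mat2_star]) (by simp [mat2_mul, mat2_one])
  refine ⟨K.tau n U * (w * K.tau n U⁻¹ * w⁻¹), ?_, ?_⟩
  · have h := hw2 (K.tau n U⁻¹ : K.Lv R (n + 1))
    rw [Submonoid.coe_mul, Submonoid.coe_mul, Submonoid.coe_mul]
    refine (congrArg (fun x => (K.tau n U : K.Lv R (n + 1)) * x) h).trans ?_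
    rw [coe_tau_eq_mat2, coe_tau_eq_mat2]
    simp [mat2_mul]
    rfl
  · have h : Joined (K.tau n U * (1 * K.tau n U⁻¹ * 1⁻¹)) (K.tau n U * (w * K.tau n U⁻¹ * w⁻¹)) :=
      (Joined.refl _).mul ((hw1.mul (Joined.refl _)).mul hw1.inv)
    simpa using h

/-- Murray–von Neumann equivalent projections of `R_n` are conjugate in `R_{n+2}`, by a unitary in
the component of `1`. -/
theorem exists_unitary_conj_rho_rho (n : ℕ) {p q x : K.Lv R n} (hp : IsStarProjection p)
    (hq : IsStarProjection q) (h1 : star x * x = p) (h2 : x * star x = q) :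
    ∃ w : unitary (K.Lv R (n + 2)), Joined 1 w ∧
      (w : K.Lv R (n + 2)) * K.rho (n + 1) (K.rho n p) * star (w : K.Lv R (n + 2)) =
        K.rho (n + 1) (K.rho n q) := by
  have hpp : p * p = p := hp.isIdempotentElem.eq
  have hqq : q * q = q := hq.isIdempotentElem.eq
  have hps : star p = p := hp.isSelfAdjoint.star_eq
  have hqs : star q = q := hq.isSelfAdjoint.star_eq
  -- `x` is a partial isometry, as `(x p - x)* (x p - x) = 0`.
  have hxp : x * p = x := by
    refine sub_eq_zero.mp (K.toSchurTower.eq_zero_of_star_mul_self _ ?_)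
    rw [star_sub, star_mul, hps, sub_mul, mul_sub, mul_sub, ← mul_assoc, mul_assoc p, h1,
      mul_assoc p, ← mul_assoc (star x), h1, hpp, hpp, sub_self]
  have hqx : q * x = x := by rw [← h2, mul_assoc, h1, hxp]
  have hpx : p * star x = star x := by rw [← hps, ← star_mul, hxp]
  have hxq : star x * q = star x := by rw [← hqs, ← star_mul, hqx]
  -- This unitary `w` conjugates `diag(p, 0)` to `diag(q, 0)`, but need not be joined to `1`. The
  -- unitary `diag(w, w*)` is, and it acts on `diag(p, 0, 0, 0)` in the same way.
  obtain ⟨w, hw⟩ : ∃ w : unitary (K.Lv R (n + 1)),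
      (w : K.Lv R (n + 1)) = K.mat2 n x (1 - q) (1 - p) (star x) := by
    refine ⟨⟨K.mat2 n x (1 - q) (1 - p) (star x), ?_⟩, rfl⟩
    rw [Unitary.mem_iff, mat2_star, mat2_mul, mat2_mul, ← mat2_one]
    constructor <;>
    simp [mul_sub, sub_mul, h1, h2, hpp, hqq, hps, hqs, hxp, hqx, hpx, hxq]
  obtain ⟨D, hD, hD1⟩ := K.exists_unitary_diag_star (n + 1) w
  refine ⟨D, hD1, ?_⟩
  simp [hD, hw, rho_eq_mat2, mat2_star, mat2_mul, mul_sub, sub_mul, h2, hpp, hxp, hps]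

end Joined
end ProjKData

/-! ### The maps into higher levels and into the limits -/

theorem seqMap_injective {G : ℕ → Type*} (g : ∀ n, G n → G (n + 1))
    (hg : ∀ n, Function.Injective (g n)) {i j : ℕ} (h : i ≤ j) :
    Function.Injective (seqMap g h) := by
  induction j, h using Nat.le_induction with
  | base => exact fun x y hxy => by rwa [seqMap_self, seqMap_self] at hxy
  | succ k hk ih =>
    intro x y hxy
    rw [seqMap_succ g hk, seqMap_succ g hk] at hxy
    exact ih (hg k hxy)

namespace ProjKData

variable {E : Type u} {T : Type v} [CommCStarAlgebra E] [Group T] (K : ProjKData E T)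

section Corner

variable {R : Type w} [CStarAlgebra R] [Algebra E R] [StarModule E R]

theorem incl_injective (n : ℕ) : Function.Injective (K.toSchurTower.incl (R := R) n) := by
  intro X Y h
  apply (K.toSchurTower.coefEquiv n).injective
  ext t
  have h' := congrFun (congrArg (K.toSchurTower.coefEquiv (n + 1)) h)
    (Subgroup.inclusion (K.toSchurTower.sub_mono n.le_succ) t)
  rw [SchurTower.incl, SchurTower.coefEquiv_homOfCoef, SchurTower.coefEquiv_homOfCoef,
    SchurTower.extend_of_mem _ _ t.2, SchurTower.extend_of_mem _ _ t.2] at h'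
  exact h'

/-- The maps `X ↦ A_{n+1} X` are injective: conjugating `diag(X, 0)` with matrix units gives
`diag(0, X)`, and the sum of both is the image of `X` in `R_{n+1}`. -/
theorem rho_injective (n : ℕ) : Function.Injective (K.rho (R := R) n) := by
  rw [injective_iff_map_eq_zero]
  intro X hX
  apply K.incl_injective n
  have h1 : K.mat2 n X 0 0 0 = 0 := by rw [← rho_eq_mat2, hX]
  rw [map_zero, incl_eq_mat2]
  have h : K.mat2 n X 0 0 X = K.mat2 n X 0 0 0 +
      K.mat2 n 0 0 1 0 * K.mat2 n X 0 0 0 * K.mat2 n 0 1 0 0 := by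
    simp [mat2_mul, mat2_add]
  rw [h, h1, mul_zero, zero_mul, add_zero]

/-- The inclusion of `R_n` into `R_m` as a corner, `X ↦ A_{n+1} ⋯ A_m X`. It is the transition map
of the sequence with limit `R_→`, and it is not unital. -/
def corner {n m : ℕ} (h : n ≤ m) : K.Lv R n →⋆ₙ+* K.Lv R m :=
  seqHom (fun n => K.rho (R := R) n) n m h

theorem corner_self (n : ℕ) (X : K.Lv R n) : K.corner le_rfl X = X := seqMap_self _ X

theorem corner_succ {n m : ℕ} (h : n ≤ m) (X : K.Lv R n) :
    K.corner (h.trans m.le_succ) X = K.rho m (K.corner h X) :=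
  seqMap_succ (fun n => K.rho (R := R) n) h X

theorem corner_corner {n m l : ℕ} (h : n ≤ m) (h' : m ≤ l) (X : K.Lv R n) :
    K.corner h' (K.corner h X) = K.corner (h.trans h') X :=
  seqMap_trans (fun n => K.rho (R := R) n) h h' X

theorem corner_mul_bb {n m : ℕ} (h : n ≤ m) (X : K.Lv R n) :
    K.corner (h.trans m.le_succ) X * K.bb R m = 0 := by
  rw [K.corner_succ h, rho_eq_mat2, bb_eq_mat2, mat2_mul]
  simp [mat2_zero]

theorem corner_injective {n m : ℕ} (h : n ≤ m) : Function.Injective (K.corner (R := R) h) :=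
  seqMap_injective (fun n => K.rho (R := R) n) K.rho_injective h

theorem toLim_corner {n m : ℕ} (h : n ≤ m) (X : K.Lv R n) :
    K.toLim m (K.corner h X) = K.toLim n X :=
  SeqLim.of_seqHom (fun n => K.rho (R := R) n) h X

theorem toLim_injective (n : ℕ) : Function.Injective (K.toLim (R := R) n) := by
  intro X Y h
  obtain ⟨m, hm, h'⟩ := SeqLim.exists_of_eq (fun n => K.rho (R := R) n) h
  exact K.corner_injective hm h'

/-- Every element of `R_→` comes from elements of all sufficiently high levels. -/
theorem exists_toLim (x : K.Lim R) : ∃ n, ∀ m, n ≤ m → ∃ X : K.Lv R m, K.toLim m X = x := by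
  obtain ⟨n, X, rfl⟩ := SeqLim.exists_of (fun n => K.rho (R := R) n) x
  exact ⟨n, fun m h => ⟨K.corner h X, K.toLim_corner h X⟩⟩

theorem lmap_corner {R' : Type*} [CStarAlgebra R'] [Algebra E R'] [StarModule E R']
    (φ : R →⋆ₐ[E] R') {n m : ℕ} (h : n ≤ m) (X : K.Lv R n) :
    K.toSchurTower.lmap φ m (K.corner h X) = K.corner h (K.toSchurTower.lmap φ n X) :=
  seqMap_map (fun n => K.rho (R := R) n) (fun n => K.rho (R := R') n)
    (fun n => K.toSchurTower.lmap φ n) (K.lmap_rho φ) h X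

/-- The homomorphism `Un R_n → Un R_m`, `U ↦ diag(U, 1)`: the composition of the maps
`U ↦ A_k U + B_k`, i.e. the transition map of the sequence with limit `un R`. -/
def stab {n m : ℕ} (h : n ≤ m) : unitary (K.Lv R n) →* unitary (K.Lv R m) :=
  seqMonoidHom (fun n => K.tau (R := R) n) n m h

theorem stab_self (n : ℕ) (U : unitary (K.Lv R n)) : K.stab le_rfl U = U :=
  seqMap_self (fun n => K.tau (R := R) n) U

theorem stab_succ {n m : ℕ} (h : n ≤ m) (U : unitary (K.Lv R n)) :
    K.stab (h.trans m.le_succ) U = K.tau m (K.stab h U) :=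
  seqMap_succ (fun n => K.tau (R := R) n) h U

theorem coe_stab {n m : ℕ} (h : n ≤ m) (U : unitary (K.Lv R n)) :
    (K.stab h U : K.Lv R m) = K.corner h (U : K.Lv R n) + (1 - K.corner h 1) := by
  induction m, h using Nat.le_induction with
  | base =>
    rw [corner_self, corner_self, sub_self, add_zero, stab_self]
  | succ k hk ih =>
    have h1 : K.rho (R := R) k 1 = K.aa R k := by rw [rho_apply, map_one, mul_one]
    rw [K.stab_succ hk, coe_tau, ← rho_apply, ih, K.corner_succ hk, K.corner_succ hk, map_add,
      map_sub, h1, ← K.aa_add_bb R k]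
    abel

theorem toLimUn_stab {n m : ℕ} (h : n ≤ m) (U : unitary (K.Lv R n)) :
    K.toLimUn m (K.stab h U) = K.toLimUn n U :=
  SeqGrp.of_seqMonoidHom (fun n => K.tau (R := R) n) h U

theorem stab_injective {n m : ℕ} (h : n ≤ m) : Function.Injective (K.stab (R := R) h) := by
  intro U V e
  have e' := congrArg Subtype.val e
  rw [coe_stab, coe_stab, add_left_inj] at e'
  exact Subtype.ext (K.corner_injective h e')

theorem toLimUn_injective (n : ℕ) : Function.Injective (K.toLimUn (R := R) n) := by
  intro U V h
  obtain ⟨m, h1, _, h3⟩ := Quotient.eq.mp h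
  exact K.stab_injective h1 h3

variable {R' : Type*} [CStarAlgebra R'] [Algebra E R'] [StarModule E R']

theorem unMap_stab (φ : R →⋆ₐ[E] R') {n m : ℕ} (h : n ≤ m) (U : unitary (K.Lv R n)) :
    K.unMap φ m (K.stab h U) = K.stab h (K.unMap φ n U) := by
  apply Subtype.ext
  rw [coe_unMap, coe_stab, coe_stab, map_add, map_sub, lmap_corner, lmap_corner, map_one, map_one,
    coe_unMap]

end Corner

/-! ### Classes in `K_1` -/

section ClassOne

variable {R : Type w} [CStarAlgebra R] [Algebra E R] [StarModule E R] [IsScalarTower ℂ E R]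

theorem class1_surjective (x : K.K1Full R) : ∃ n U, K.class1 n U = x := by
  obtain ⟨u, rfl⟩ := QuotientGroup.mk'_surjective (K.unE R) (Additive.toMul x)
  obtain ⟨n, U, rfl⟩ := SeqGrp.exists_of (fun n => K.tau (R := R) n) u
  exact ⟨n, U, rfl⟩

theorem class1_mul (n : ℕ) (U V : unitary (K.Lv R n)) :
    K.class1 n (U * V) = K.class1 n U + K.class1 n V := by
  simp only [class1, map_mul]
  rfl

theorem class1_stab {n m : ℕ} (h : n ≤ m) (U : unitary (K.Lv R n)) :
    K.class1 m (K.stab h U) = K.class1 n U := by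
  rw [class1, toLimUn_stab, class1]

theorem class1_eq_zero_of_mem {n : ℕ} {U : unitary (K.Lv R n)} (hU : U ∈ K.UnE R n) :
    K.class1 n U = 0 :=
  congrArg Additive.ofMul ((QuotientGroup.eq_one_iff _).mpr ⟨n, U, hU, rfl⟩)

/-- Since the maps into `un R` are injective, a class vanishes if and only if some stabilization of
the unitary is homotopic to a unitary with coefficients in `E`. -/
theorem class1_eq_zero_iff {n : ℕ} {U : unitary (K.Lv R n)} :
    K.class1 n U = 0 ↔ ∃ (m : ℕ) (h : n ≤ m), K.stab h U ∈ K.UnE R m := by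
  constructor
  · intro h
    obtain ⟨m, W, hW, e⟩ := (QuotientGroup.eq_one_iff (N := K.unE R) (K.toLimUn n U)).mp
      (congrArg Additive.toMul h)
    refine ⟨max n m, le_max_left _ _, ?_⟩
    have e' : K.stab (le_max_left n m) U = K.stab (le_max_right n m) W := by
      apply K.toLimUn_injective
      rw [toLimUn_stab, toLimUn_stab, e]
    rw [e']
    exact K.seqMonoidHom_mem_UnE _ hW
  · rintro ⟨m, h, hU⟩
    rw [← K.class1_stab h, K.class1_eq_zero_of_mem hU]

theorem k1FullMap_class1 {R' : Type*} [CStarAlgebra R'] [Algebra E R'] [StarModule E R']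
    [IsScalarTower ℂ E R'] (φ : R →⋆ₐ[E] R') (n : ℕ) (U : unitary (K.Lv R n)) :
    K.k1FullMap φ (K.class1 n U) = K.class1 n (K.unMap φ n U) := rfl

end ClassOne

/-! ### Classes in `K_0` -/

section ClassZero

variable {R : Type w} [CStarAlgebra R] [Algebra E R] [StarModule E R]

theorem corner_isStarProjection {n m : ℕ} (h : n ≤ m) {P : K.Lv R n} (hP : IsStarProjection P) :
    IsStarProjection (K.corner h P) := (Proj.map (K.corner h) ⟨P, hP⟩).2

theorem aa_isStarProjection (n : ℕ) : IsStarProjection (K.aa R n) :=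
  ⟨K.aa_mul_aa R n, K.star_aa R n⟩

theorem bb_isStarProjection (n : ℕ) : IsStarProjection (K.bb R n) :=
  ⟨K.bb_mul_bb R n, K.star_bb R n⟩

theorem isStarProjection_one (n : ℕ) : IsStarProjection (1 : K.Lv R n) := by
  have h := (IsStarProjection.zero (K.Lv R n)).one_sub
  rwa [sub_zero] at h

theorem class0_congr {n : ℕ} {P Q : K.Lv R n} {hP : IsStarProjection P} {hQ : IsStarProjection Q}
    (h : P = Q) : K.class0 n P hP = K.class0 n Q hQ := by subst h; rfl

theorem class0_corner {n m : ℕ} (h : n ≤ m) {P : K.Lv R n} (hP : IsStarProjection P) :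
    K.class0 m (K.corner h P) (K.corner_isStarProjection h hP) = K.class0 n P hP :=
  congrArg (fun p => K.toK0Full (VSet.mk p)) (Subtype.ext (K.toLim_corner h P))

theorem class0_eq_of_mvn {n : ℕ} {P Q : K.Lv R n} (hP : IsStarProjection P)
    (hQ : IsStarProjection Q) (X : K.Lv R n) (h1 : star X * X = P) (h2 : X * star X = Q) :
    K.class0 n P hP = K.class0 n Q hQ := by
  refine congrArg K.toK0Full (VSet.mk_eq_mk.mpr ⟨K.toLim n X, ?_, ?_⟩)
  · rw [← map_star, ← map_mul, h1]; rfl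
  · rw [← map_star, ← map_mul, h2]; rfl

theorem add_isStarProjection {n : ℕ} {P Q : K.Lv R n} (hP : IsStarProjection P)
    (hQ : IsStarProjection Q) (h : P * Q = 0) : IsStarProjection (P + Q) :=
  (Proj.add ⟨P, hP⟩ ⟨Q, hQ⟩ h).2

theorem class0_add {n : ℕ} {P Q : K.Lv R n} (hP : IsStarProjection P)
    (hQ : IsStarProjection Q) (h : P * Q = 0) :
    K.class0 n (P + Q) (K.add_isStarProjection hP hQ h) = K.class0 n P hP + K.class0 n Q hQ := by
  have h' : (K.limProj n P hP).1 * (K.limProj n Q hQ).1 = 0 := by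
    change K.toLim n P * K.toLim n Q = 0
    rw [← map_mul, h, map_zero]
  rw [class0, class0, class0, ← map_add, VSet.mk_add_mk _ _ h']
  exact congrArg (fun p => K.toK0Full (VSet.mk p)) (Subtype.ext (map_add (K.toLim n) P Q))

theorem unitMap_isStarProjection {n : ℕ} {P : K.Lv E n} (hP : IsStarProjection P) :
    IsStarProjection (K.toSchurTower.unitMap R n P) := K.lmap_isStarProjection _ hP

/-- Every projection of `R_→` comes from projections of all sufficiently high levels. -/
theorem exists_limProj (p : Proj (K.Lim R)) : ∃ n, ∀ m, n ≤ m → ∃ (P : K.Lv R m)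
    (hP : IsStarProjection P), K.limProj m P hP = p := by
  obtain ⟨n, X, hX, hP⟩ := SeqLim.exists_proj (fun n => K.rho (R := R) n) p
  exact ⟨n, fun m h => ⟨K.corner h X, K.corner_isStarProjection h hP,
    Subtype.ext ((K.toLim_corner h X).trans hX)⟩⟩

theorem mat2_diag_isStarProjection {n : ℕ} {P Q : K.Lv R n} (hP : IsStarProjection P)
    (hQ : IsStarProjection Q) : IsStarProjection (K.mat2 n P 0 0 Q) := by
  refine ⟨?_, ?_⟩
  · rw [IsIdempotentElem, mat2_mul]
    simp [hP.isIdempotentElem.eq, hQ.isIdempotentElem.eq]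
  · rw [IsSelfAdjoint, mat2_star]
    simp [hP.isSelfAdjoint.star_eq, hQ.isSelfAdjoint.star_eq]

theorem class0_mat2_diag {n : ℕ} {P Q : K.Lv R n} (hP : IsStarProjection P)
    (hQ : IsStarProjection Q) :
    K.class0 (n + 1) (K.mat2 n P 0 0 Q) (K.mat2_diag_isStarProjection hP hQ) =
      K.class0 n P hP + K.class0 n Q hQ := by
  have z := IsStarProjection.zero (K.Lv R n)
  have hPz := K.mat2_diag_isStarProjection hP z
  have hzQ := K.mat2_diag_isStarProjection z hQ
  have hc : ∀ {X : K.Lv R n} (hX : IsStarProjection X),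
      K.class0 (n + 1) (K.mat2 n X 0 0 0) (K.mat2_diag_isStarProjection hX z) =
        K.class0 n X hX := by
    intro X hX
    rw [← K.class0_corner n.le_succ]
    exact K.class0_congr (by
      rw [K.corner_succ le_rfl, corner_self, rho_eq_mat2])
  rw [← hc hP, ← hc hQ,
    K.class0_eq_of_mvn (K.mat2_diag_isStarProjection hQ z) hzQ (K.mat2 n 0 0 Q 0)
    (by simp [mat2_star, mat2_mul, hQ.isIdempotentElem.eq, hQ.isSelfAdjoint.star_eq])
    (by simp [mat2_star, mat2_mul, hQ.isIdempotentElem.eq, hQ.isSelfAdjoint.star_eq]),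
    ← K.class0_add hPz hzQ (by simp [mat2_mul, mat2_zero])]
  exact K.class0_congr (by simp [mat2_add])

theorem class0_zero (n : ℕ) : K.class0 n (0 : K.Lv R n) (IsStarProjection.zero _) = 0 := by
  have z := IsStarProjection.zero (K.Lv R n)
  have := K.class0_add z z (mul_zero _)
  rw [K.class0_congr (hQ := z) (add_zero _)] at this
  exact left_eq_add.mp this

theorem class0_aa (n : ℕ) : K.class0 (n + 1) (K.aa R n) (K.aa_isStarProjection n) =
    K.class0 n 1 (K.isStarProjection_one _) := by
  rw [← add_zero (K.class0 n 1 (K.isStarProjection_one _)), ← K.class0_zero n,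
    ← K.class0_mat2_diag]
  exact K.class0_congr (K.aa_eq_mat2 n)

theorem class0_one_succ (n : ℕ) : K.class0 (n + 1) (1 : K.Lv R (n + 1)) (K.isStarProjection_one _) =
    K.class0 n 1 (K.isStarProjection_one _) + K.class0 n 1 (K.isStarProjection_one _) := by
  rw [← K.class0_mat2_diag]
  exact K.class0_congr (K.mat2_one n).symm

theorem class0_one_sub {n : ℕ} {P : K.Lv R n} (hP : IsStarProjection P) :
    K.class0 n (1 - P) hP.one_sub = K.class0 n 1 (K.isStarProjection_one _) - K.class0 n P hP := by
  rw [eq_sub_iff_add_eq, ← K.class0_add hP.one_sub hP (by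
    rw [sub_mul, one_mul, hP.isIdempotentElem.eq, sub_self])]
  exact K.class0_congr (sub_add_cancel _ _)

theorem exists_class0_sub (x : K.K0Full R) : ∃ (n : ℕ) (P Q : K.Lv R n) (hP : IsStarProjection P)
    (hQ : IsStarProjection Q), x = K.class0 n P hP - K.class0 n Q hQ := by
  obtain ⟨⟨a, b, _⟩, h⟩ := (AddLocalization.addMonoidOf (⊤ : AddSubmonoid (VSet (K.Lim R)))).surj x
  obtain ⟨p, rfl⟩ := Quotient.exists_rep a
  obtain ⟨q, rfl⟩ := Quotient.exists_rep b
  obtain ⟨n, hp⟩ := K.exists_limProj p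
  obtain ⟨m, hq⟩ := K.exists_limProj q
  obtain ⟨P, hP, rfl⟩ := hp (max n m) (le_max_left _ _)
  obtain ⟨Q, hQ, rfl⟩ := hq (max n m) (le_max_right _ _)
  exact ⟨max n m, P, Q, hP, hQ, eq_sub_of_add_eq h⟩

/-- Every element of the Grothendieck group of `R` has the form `[P]_0 - [B_{n+1}]_0`. The point is
that the subtracted projection has coefficients in `E`. -/
theorem exists_class0_sub_bb (x : K.K0Full R) : ∃ (n : ℕ) (P : K.Lv R (n + 1))
    (hP : IsStarProjection P),
    x = K.class0 (n + 1) P hP - K.class0 (n + 1) (K.bb R n) (K.bb_isStarProjection n) := by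
  obtain ⟨n, P, Q, hP, hQ, rfl⟩ := K.exists_class0_sub x
  -- `[P]_0 - [Q]_0 = ([P]_0 + [1 - Q]_0) - ([Q]_0 + [1 - Q]_0)`.
  refine ⟨n, K.mat2 n P 0 0 (1 - Q), K.mat2_diag_isStarProjection hP hQ.one_sub, ?_⟩
  have z := IsStarProjection.zero (K.Lv R n)
  have e : K.class0 (n + 1) (K.bb R n) (K.bb_isStarProjection n) =
      K.class0 (n + 1) (K.mat2 n 0 0 0 Q) (K.mat2_diag_isStarProjection z hQ) +
      K.class0 (n + 1) (K.mat2 n 0 0 0 (1 - Q)) (K.mat2_diag_isStarProjection z hQ.one_sub) := by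
    rw [← K.class0_add _ _ (by
      simp [mat2_mul, mul_sub, hQ.isIdempotentElem.eq, mat2_zero])]
    exact K.class0_congr (by simp [mat2_add, bb_eq_mat2])
  rw [e, K.class0_mat2_diag hP hQ.one_sub, K.class0_mat2_diag z hQ,
    K.class0_mat2_diag z hQ.one_sub, K.class0_zero]
  abel

/-- Elements on which the augmentation `π` vanishes have the form `[P]_0 - [σ P]_0`, where `σ`
is the composition of `π` with the unit `E → R`. -/
theorem exists_class0_sub_unitMap (π : R →⋆ₐ[E] E) {x : K.K0Full R} (hx : K.k0FullMap π x = 0) :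
    ∃ (n : ℕ) (P : K.Lv R n) (hP : IsStarProjection P), x = K.class0 n P hP -
      K.class0 n (K.toSchurTower.unitMap R n (K.toSchurTower.lmap π n P))
        (K.unitMap_isStarProjection (K.lmap_isStarProjection π hP)) := by
  obtain ⟨n, P, hP, rfl⟩ := K.exists_class0_sub_bb x
  refine ⟨n + 1, P, hP, ?_⟩
  -- From `x = [P]_0 - [B]_0` and `[π P]_0 = [B]_0` in `E` one gets `[B]_0 = [σ P]_0` in `R`.
  let l : E →⋆ₐ[E] R := { Algebra.ofId E R with map_star' := fun α => algebraMap_star_comm α }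
  have h := congrArg (K.k0FullMap l) hx
  rw [map_zero, map_sub, map_sub, k0FullMap_class0, k0FullMap_class0, k0FullMap_class0,
    k0FullMap_class0, sub_eq_zero] at h
  have e : K.toSchurTower.lmap l (n + 1) (K.toSchurTower.lmap π (n + 1) (K.bb R n)) = K.bb R n := by
    rw [lmap_bb, lmap_bb]
  rw [sub_right_inj]
  exact (h.trans (K.class0_congr e)).symm

end ClassZero

/-! ### Stable unitary equivalence -/

section Conj

variable {R : Type w} [CStarAlgebra R] [Algebra E R] [StarModule E R] [IsScalarTower ℂ E R]

/-- If `[P]_0 = [Q]_0`, then `P` and `Q` become unitarily equivalent, by a unitary homotopic to `1`,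
after adding a projection `e` with coefficients in `E`, in some higher level. -/
theorem exists_conj_of_class0_eq {n : ℕ} {P Q : K.Lv R n} {hP : IsStarProjection P}
    {hQ : IsStarProjection Q} (h : K.class0 n P hP = K.class0 n Q hQ) :
    ∃ (m : ℕ) (hm : n ≤ m) (e : K.Lv E m), IsStarProjection e ∧ K.corner hm 1 * e = 0 ∧
      ∃ w : unitary (K.Lv R m), Joined 1 w ∧
        (w : K.Lv R m) * (K.corner hm P + K.toSchurTower.unitMap R m e) * star (w : K.Lv R m) =
          K.corner hm Q + K.toSchurTower.unitMap R m e := by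
  obtain ⟨⟨c, _⟩, hc⟩ := (AddLocalization.addMonoidOf
    (⊤ : AddSubmonoid (VSet (K.Lim R)))).eq_iff_exists.mp h
  obtain ⟨r, rfl⟩ := Quotient.exists_rep c
  -- Equality in the Grothendieck group means equality after adding the class of a projection `S`.
  -- Adding the class of `1 - S` as well replaces that of `S` with that of `1`, or of `B_{N+1}`.
  change VSet.mk r + VSet.mk (K.limProj n P hP) = VSet.mk r + VSet.mk (K.limProj n Q hQ) at hc
  obtain ⟨n', hr⟩ := K.exists_limProj r
  obtain ⟨S, hS, rfl⟩ := hr (max n n') (le_max_right _ _)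
  generalize hN : max n n' = N at S hS hc
  have hnN : n ≤ N := hN ▸ le_max_left n n'
  clear hr hN h
  have hb := K.bb_isStarProjection (R := R) N
  have e1 : VSet.mk (K.limProj N (1 - S) hS.one_sub) + VSet.mk (K.limProj N S hS) =
      VSet.mk (K.limProj (N + 1) (K.bb R N) hb) := by
    rw [VSet.mk_add_mk _ _ (by
      change K.toLim N _ * K.toLim N _ = 0
      rw [← map_mul, sub_mul, one_mul, hS.isIdempotentElem.eq, sub_self, map_zero])]
    refine VSet.mk_eq_mk.mpr ⟨K.toLim (N + 1) (K.cc R N), ?_, ?_⟩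
    · rw [← map_star, ← map_mul]
      change K.toLim (N + 1) (K.aa R N) = K.toLim N (1 - S) + K.toLim N S
      rw [← map_add, sub_add_cancel, ← K.toLim_rho N, rho_apply, map_one, mul_one]
    · rw [← map_star, ← map_mul]
      rfl
  have hc' := congrArg (fun x => VSet.mk (K.limProj N (1 - S) hS.one_sub) + x) hc
  simp only [← add_assoc, e1] at hc'
  have hX : ∀ {X : K.Lv R n}, IsStarProjection X →
      IsStarProjection (K.corner (hnN.trans N.le_succ) X + K.bb R N) := fun h =>
    K.add_isStarProjection (K.corner_isStarProjection _ h) hb (K.corner_mul_bb hnN _)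
  have key : ∀ {X : K.Lv R n} (h : IsStarProjection X),
      VSet.mk (K.limProj (N + 1) (K.bb R N) hb) + VSet.mk (K.limProj n X h) =
        VSet.mk (K.limProj (N + 1) _ (hX h)) := by
    intro X h
    rw [add_comm, VSet.mk_add_mk]
    · refine congrArg VSet.mk (Subtype.ext ?_)
      change K.toLim n X + K.toLim (N + 1) (K.bb R N) = K.toLim (N + 1) (_ + _)
      rw [map_add, toLim_corner]
    · change K.toLim n X * K.toLim (N + 1) (K.bb R N) = 0
      rw [← K.toLim_corner (hnN.trans N.le_succ), ← map_mul, K.corner_mul_bb hnN, map_zero]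
  rw [key, key] at hc'
  -- The projections `P + B` and `Q + B` are equivalent in `R_→`, hence in some `R_M`, and two
  -- levels higher they are conjugate.
  obtain ⟨x, hx1, hx2⟩ := VSet.mk_eq_mk.mp hc'
  obtain ⟨M', hM'⟩ := K.exists_toLim x
  obtain ⟨X, rfl⟩ := hM' (max (N + 1) M') (le_max_right _ _)
  generalize hM : max (N + 1) M' = M at X hx1 hx2
  have hNM : N + 1 ≤ M := hM ▸ le_max_left _ _
  clear hM' hM
  change star (K.toLim M X) * K.toLim M X = K.toLim (N + 1) (_ + _) at hx1
  change K.toLim M X * star (K.toLim M X) = K.toLim (N + 1) (_ + _) at hx2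
  rw [← map_star, ← map_mul, ← K.toLim_corner hNM] at hx1 hx2
  obtain ⟨w, hw1, hw2⟩ := K.exists_unitary_conj_rho_rho M
    (K.corner_isStarProjection hNM (hX hP)) (K.corner_isStarProjection hNM (hX hQ))
    (K.toLim_injective M hx1) (K.toLim_injective M hx2)
  have hM2 : M ≤ M + 2 := Nat.le_add_right _ _
  refine ⟨M + 2, (hnN.trans N.le_succ).trans (hNM.trans hM2), K.corner (hNM.trans hM2) (K.bb E N),
    K.corner_isStarProjection _ (K.bb_isStarProjection N), ?_, w, hw1, ?_⟩
  · rw [← K.corner_corner (hnN.trans N.le_succ) (hNM.trans hM2), ← map_mul, K.corner_mul_bb hnN,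
      map_zero]
  · have e2 : ∀ Y : K.Lv R M, K.rho (M + 1) (K.rho M Y) = K.corner hM2 Y := fun Y => by
      rw [K.corner_succ (M.le_succ), K.corner_succ le_rfl, corner_self]
    have e3 : K.toSchurTower.unitMap R (M + 2) (K.corner (hNM.trans hM2) (K.bb E N)) =
        K.corner (hNM.trans hM2) (K.bb R N) := by
      rw [SchurTower.unitMap, lmap_corner, lmap_bb]
    simpa only [e2, e3, corner_corner, map_add] using hw2

end Conj
end ProjKData

/-! ### Elements with image in `E_n` -/

theorem SchurTower.unitMap_injective {E : Type u} {T : Type v} [CommCStarAlgebra E] [Group T]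
    (S : SchurTower E T) {R : Type w} [CStarAlgebra R] [Algebra E R] [StarModule E R]
    (hE : Function.Injective (algebraMap E R)) (n : ℕ) : Function.Injective (S.unitMap R n) := by
  intro X Y e
  apply (S.coefEquiv n).injective
  have e' := congrArg (S.coefEquiv n) e
  rw [unitMap, lmap, coefEquiv_homOfCoef, coefEquiv_homOfCoef] at e'
  exact funext fun t => hE (congrFun e' t)

namespace ProjKData

variable {E : Type u} {T : Type v} [CommCStarAlgebra E] [Group T] (K : ProjKData E T)

section Pair

variable {R R' R'' : Type*} [CStarAlgebra R] [Algebra E R] [StarModule E R]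
  [CStarAlgebra R'] [Algebra E R'] [StarModule E R']
  [CStarAlgebra R''] [Algebra E R''] [StarModule E R'']

/-- The properties of the unital maps `φ : F̌ → Ǧ` and `ψ : Ǧ → Ȟ` obtained from an exact sequence
`0 → F → G → H → 0`, with `π : F̌ → E` the augmentation: `φ` is injective, `ψ` is surjective, and
`φ` identifies `F̌` with the elements of `Ǧ` which `ψ` maps into `E`, where `π` gives the value in
`E`. -/
structure IsExactPair (π : R →⋆ₐ[E] E) (φ : R →⋆ₐ[E] R') (ψ : R' →⋆ₐ[E] R'') : Prop where
  injective : Function.Injective φ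
  surjective : Function.Surjective ψ
  map_map : ∀ y, ψ (φ y) = algebraMap E R'' (π y)
  exists_map_eq : ∀ x α, ψ x = algebraMap E R'' α → ∃ y, φ y = x ∧ π y = α

namespace IsExactPair

variable {K} {π : R →⋆ₐ[E] E} {φ : R →⋆ₐ[E] R'} {ψ : R' →⋆ₐ[E] R''}

theorem lmap_lmap (h : IsExactPair π φ ψ) (n : ℕ) (Z : K.Lv R n) :
    K.toSchurTower.lmap ψ n (K.toSchurTower.lmap φ n Z) =
      K.toSchurTower.unitMap R'' n (K.toSchurTower.lmap π n Z) := by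
  rw [SchurTower.unitMap, SchurTower.lmap_comp, SchurTower.lmap_comp]
  congr 2
  exact StarAlgHom.ext h.map_map

theorem lmap_injective (h : IsExactPair π φ ψ) (n : ℕ) :
    Function.Injective (K.toSchurTower.lmap φ n) := by
  intro X Y e
  apply (K.toSchurTower.coefEquiv n).injective
  have e' := congrArg (K.toSchurTower.coefEquiv n) e
  rw [SchurTower.lmap, SchurTower.coefEquiv_homOfCoef, SchurTower.coefEquiv_homOfCoef] at e'
  exact funext fun t => h.injective (congrFun e' t)

/-- The elements of `R'_n` with image in `E_n` come from `R_n`. -/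
theorem exists_lmap_eq (h : IsExactPair π φ ψ) {n : ℕ} {X : K.Lv R' n} {c : K.Lv E n}
    (hX : K.toSchurTower.lmap ψ n X = K.toSchurTower.unitMap R'' n c) :
    ∃ Z : K.Lv R n, K.toSchurTower.lmap φ n Z = X ∧ K.toSchurTower.lmap π n Z = c := by
  have e := congrArg (K.toSchurTower.coefEquiv n) hX
  rw [SchurTower.unitMap, SchurTower.lmap, SchurTower.lmap, SchurTower.coefEquiv_homOfCoef,
    SchurTower.coefEquiv_homOfCoef] at e
  choose y hy1 hy2 using fun t => h.exists_map_eq _ _ (congrFun e t)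
  refine ⟨(K.toSchurTower.coefEquiv n).symm y, (K.toSchurTower.coefEquiv n).injective ?_,
    (K.toSchurTower.coefEquiv n).injective ?_⟩
  · rw [SchurTower.lmap, SchurTower.coefEquiv_homOfCoef, Equiv.apply_symm_apply]
    exact funext hy1
  · rw [SchurTower.lmap, SchurTower.coefEquiv_homOfCoef, Equiv.apply_symm_apply]
    exact funext hy2

/-- The projections of `R'_n` with image in `E_n` come from projections of `R_n`. -/
theorem exists_isStarProjection (h : IsExactPair π φ ψ) {n : ℕ} {X : K.Lv R' n}
    (hX : IsStarProjection X) {c : K.Lv E n}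
    (hc : K.toSchurTower.lmap ψ n X = K.toSchurTower.unitMap R'' n c) :
    ∃ Z : K.Lv R n, IsStarProjection Z ∧ K.toSchurTower.lmap φ n Z = X ∧
      K.toSchurTower.lmap π n Z = c := by
  obtain ⟨Z, rfl, hZ⟩ := h.exists_lmap_eq hc
  refine ⟨Z, ⟨h.lmap_injective n ?_, h.lmap_injective n ?_⟩, rfl, hZ⟩
  · rw [map_mul, hX.isIdempotentElem.eq]
  · rw [map_star, hX.isSelfAdjoint.star_eq]

/-- The unitaries of `R'_n` with image in `E_n` come from unitaries of `R_n`. -/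
theorem exists_unMap_eq (h : IsExactPair π φ ψ) {n : ℕ} {V : unitary (K.Lv R' n)} {c : K.Lv E n}
    (hc : K.toSchurTower.lmap ψ n V = K.toSchurTower.unitMap R'' n c) :
    ∃ Z : unitary (K.Lv R n), K.unMap φ n Z = V := by
  obtain ⟨Z, hZ, -⟩ := h.exists_lmap_eq hc
  refine ⟨⟨Z, Unitary.mem_iff.mpr ⟨h.lmap_injective n ?_, h.lmap_injective n ?_⟩⟩, Subtype.ext hZ⟩
  · rw [map_mul, map_star, hZ, map_one]
    exact Unitary.coe_star_mul_self V
  · rw [map_mul, map_star, hZ, map_one]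
    exact Unitary.coe_mul_star_self V

/-- Projections of `R_n` which are equivalent in `R'_n`, by an element with image in `E_n`, are
equivalent. -/
theorem class0_eq (h : IsExactPair π φ ψ) {n : ℕ} {P Q : K.Lv R n} (hP : IsStarProjection P)
    (hQ : IsStarProjection Q) {X : K.Lv R' n} {c : K.Lv E n}
    (h1 : star X * X = K.toSchurTower.lmap φ n P) (h2 : X * star X = K.toSchurTower.lmap φ n Q)
    (hc : K.toSchurTower.lmap ψ n X = K.toSchurTower.unitMap R'' n c) :
    K.class0 n P hP = K.class0 n Q hQ := by
  obtain ⟨Z, rfl, -⟩ := h.exists_lmap_eq hc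
  refine K.class0_eq_of_mvn hP hQ Z (h.lmap_injective n ?_) (h.lmap_injective n ?_)
  · rw [map_mul, map_star, h1]
  · rw [map_mul, map_star, h2]

end IsExactPair

/-! ### The index of a unitary -/

theorem IsIndexLift.lmap_V {φ : R →⋆ₐ[E] R'} {ψ : R' →⋆ₐ[E] R''} {n : ℕ} {U : unitary (K.Lv R'' n)}
    {V : unitary (K.Lv R' (n + 1))} {P : K.Lv R (n + 1)} (hV : K.IsIndexLift φ ψ n U V P) :
    K.toSchurTower.lmap ψ (n + 1) V = K.mat2 n U 0 0 (star (U : K.Lv R'' n)) := by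
  rw [hV.map_V]
  simp [mat2]

theorem unitMap_aa (n : ℕ) : K.toSchurTower.unitMap R (n + 1) (K.aa E n) = K.aa R n :=
  K.lmap_aa _ n

theorem unitMap_self (n : ℕ) (c : K.Lv E n) : K.toSchurTower.unitMap E n c = c := by
  apply (K.toSchurTower.coefEquiv n).injective
  rw [SchurTower.unitMap, SchurTower.lmap, SchurTower.coefEquiv_homOfCoef]
  rfl

theorem conj_star_mul_conj {A : Type*} [Ring A] [StarRing A] (V V' : unitary A) (D : A) :
    star ((V' : A) * D * star (V : A)) * ((V' : A) * D * star (V : A)) =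
      V * (star D * D) * star (V : A) := by
  rw [star_mul, star_mul, star_star, mul_assoc (V' : A), ← mul_assoc ((V : A) * _),
    mul_assoc (V : A), mul_assoc (star D), Unitary.coe_star_mul_self, mul_one]
  simp only [mul_assoc]

theorem conj_mul_conj_star {A : Type*} [Ring A] [StarRing A] (V V' : unitary A) (D : A) :
    ((V' : A) * D * star (V : A)) * star ((V' : A) * D * star (V : A)) =
      V' * (D * star D) * star (V' : A) := by
  have := conj_star_mul_conj V' V (star D)
  simpa only [star_mul, star_star, mul_assoc] using this

theorem conj_isStarProjection {A : Type*} [Ring A] [StarRing A] (V : unitary A) {p : A}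
    (hp : IsStarProjection p) : IsStarProjection ((V : A) * p * star (V : A)) := by
  refine ⟨?_, ?_⟩
  · have := conj_star_mul_conj V V p
    rw [hp.isSelfAdjoint.star_eq, hp.isIdempotentElem.eq] at this
    simpa [IsIdempotentElem, hp.isSelfAdjoint.star_eq, mul_assoc] using this
  · simp [IsSelfAdjoint, hp.isSelfAdjoint.star_eq, mul_assoc]

/-- The unitary `diag(U, V) = A_{n+1} U + B_{n+1} V` of `R_{n+1}`. -/
def diagUn (n : ℕ) (U V : unitary (K.Lv R n)) : unitary (K.Lv R (n + 1)) :=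
  ⟨K.mat2 n U 0 0 V, by
    rw [Unitary.mem_iff, mat2_star, mat2_mul, mat2_mul, ← mat2_one]
    simp⟩

theorem coe_diagUn (n : ℕ) (U V : unitary (K.Lv R n)) :
    (K.diagUn n U V : K.Lv R (n + 1)) = K.mat2 n U 0 0 V := rfl

theorem tau_eq_diagUn (n : ℕ) (U : unitary (K.Lv R n)) : K.tau n U = K.diagUn n U 1 :=
  Subtype.ext (K.coe_tau_eq_mat2 n U)

end Pair

namespace IsExactPair

variable {R R' R'' : Type*} [CStarAlgebra R] [Algebra E R] [StarModule E R]
  [CStarAlgebra R'] [Algebra E R'] [StarModule E R'] [IsScalarTower ℂ E R']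
  [CStarAlgebra R''] [Algebra E R''] [StarModule E R''] [IsScalarTower ℂ E R'']
  {K} {π : R →⋆ₐ[E] E} {φ : R →⋆ₐ[E] R'} {ψ : R' →⋆ₐ[E] R''}

theorem lmap_isIndexLift {n : ℕ} {U : unitary (K.Lv R'' n)}
    {V : unitary (K.Lv R' (n + 1))} {P : K.Lv R (n + 1)} (hV : K.IsIndexLift φ ψ n U V P) :
    K.toSchurTower.lmap ψ (n + 1) (K.toSchurTower.lmap φ (n + 1) P) = K.aa R'' n := by
  rw [hV.map_P, map_mul, map_mul, map_star, hV.lmap_V, lmap_aa, aa_eq_mat2, mat2_star, mat2_mul,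
    mat2_mul]
  simp

/-- Index lifts exist, because `diag(U, U*)` is joined to `1` and conjugation with it fixes
`A_{n+1} = diag(1, 0)`, which has coefficients in `E`. -/
theorem exists_isIndexLift (h : IsExactPair π φ ψ) (n : ℕ) (U : unitary (K.Lv R'' n)) :
    ∃ V P, K.IsIndexLift φ ψ n U V P := by
  obtain ⟨D, hD, hD1⟩ := K.exists_unitary_diag_star n U
  obtain ⟨V, -, hV⟩ := K.toSchurTower.exists_joined_lift ψ h.surjective (n + 1) D hD1
  have hp := conj_isStarProjection V (K.aa_isStarProjection (R := R') n)
  obtain ⟨P, hP, hP1, -⟩ := h.exists_isStarProjection hp (c := K.aa E n) (by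
    rw [map_mul, map_mul, map_star, hV, hD, lmap_aa, mat2_star, aa_eq_mat2, aa_eq_mat2,
      unitMap_mat2, mat2_mul, mat2_mul]
    simp)
  refine ⟨V, P, hP, ?_, hP1⟩
  rw [hV, hD]
  simp [mat2]

/-- The class of `P` is the same for all index lifts `(V, P)` of `U`, and does not change when `U`
is multiplied by a unitary `Y` which lifts. -/
theorem class0_eq_of_isIndexLift (h : IsExactPair π φ ψ) {n : ℕ} {U : unitary (K.Lv R'' n)}
    {V V' : unitary (K.Lv R' (n + 1))} {P P' : K.Lv R (n + 1)} (Y : unitary (K.Lv R' n))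
    (hV : K.IsIndexLift φ ψ n U V P) (hV' : K.IsIndexLift φ ψ n (U * K.unMap ψ n Y) V' P') :
    K.class0 (n + 1) P hV.isStarProjection = K.class0 (n + 1) P' hV'.isStarProjection := by
  -- `X = V' diag(Y*, 0) V*`, with image `diag(1, 0)`.
  refine h.class0_eq _ _ (X := V' * K.mat2 n (star (Y : K.Lv R' n)) 0 0 0 *
    star (V : K.Lv R' (n + 1))) (c := K.mat2 n 1 0 0 0) ?_ ?_ ?_
  · rw [conj_star_mul_conj, hV.map_P, aa_eq_mat2, mat2_star, mat2_mul]
    simp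
  · rw [conj_mul_conj_star, hV'.map_P, aa_eq_mat2, mat2_star, mat2_mul]
    simp
  · rw [map_mul, map_mul, map_star, hV.lmap_V, hV'.lmap_V, lmap_mat2, unitMap_mat2, mat2_star,
      mat2_mul, mat2_mul, map_star, ← coe_unMap]
    simp [mul_assoc]

/-- Additivity of the index for diagonal sums. -/
theorem class0_add_of_isIndexLift (h : IsExactPair π φ ψ) {n : ℕ} {U U' : unitary (K.Lv R'' n)}
    {V V' : unitary (K.Lv R' (n + 1))} {P P' : K.Lv R (n + 1)}
    {V'' : unitary (K.Lv R' (n + 2))} {P'' : K.Lv R (n + 2)}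
    (hV : K.IsIndexLift φ ψ n U V P) (hV' : K.IsIndexLift φ ψ n U' V' P')
    (hV'' : K.IsIndexLift φ ψ (n + 1) (K.diagUn n U U') V'' P'') :
    K.class0 (n + 2) P'' hV''.isStarProjection =
      K.class0 (n + 1) P hV.isStarProjection + K.class0 (n + 1) P' hV'.isStarProjection := by
  rw [← K.class0_mat2_diag hV.isStarProjection hV'.isStarProjection]
  symm
  -- `diag(A, A)` is equivalent to `diag(1, 0)` through the matrix `(A C; 0 0)` over `R_{n+1}`,
  -- which has coefficients in `E` and intertwines the images of `diag(V, V')` and `V''`.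
  refine h.class0_eq _ _ (X := V'' * K.mat2 (n + 1) (K.aa R' n) (K.cc R' n) 0 0 *
    star (K.diagUn (n + 1) V V' : K.Lv R' (n + 2)))
    (c := K.mat2 (n + 1) (K.aa E n) (K.cc E n) 0 0) ?_ ?_ ?_
  · rw [conj_star_mul_conj, lmap_mat2, hV.map_P, hV'.map_P, coe_diagUn]
    simp [mat2_mul, mat2_star, aa_eq_mat2, cc_eq_mat2, mat2_zero]
  · rw [conj_mul_conj_star, hV''.map_P]
    simp [mat2_mul, mat2_star, aa_eq_mat2, cc_eq_mat2, mat2_add, mat2_one]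
  · rw [map_mul, map_mul, map_star, hV''.lmap_V, coe_diagUn, coe_diagUn, lmap_mat2, lmap_mat2,
      hV.lmap_V, hV'.lmap_V, lmap_aa, lmap_cc]
    simp [mat2_mul, mat2_star, aa_eq_mat2, cc_eq_mat2, unitMap_mat2]

/-- The index `[P]_0 - [A_{n+1}]_0` of a unitary `U` of `R''_n`, for a chosen index lift `(V, P)` of
`U`. The class of `A_{n+1}` is written as that of the unit of `R_n`. -/
def index (h : IsExactPair π φ ψ) (n : ℕ) (U : unitary (K.Lv R'' n)) : K.K0Full R :=
  K.class0 (n + 1) _ (h.exists_isIndexLift n U).choose_spec.choose_spec.isStarProjection -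
    K.class0 n 1 (K.isStarProjection_one _)

theorem index_eq (h : IsExactPair π φ ψ) {n : ℕ} {U : unitary (K.Lv R'' n)}
    {V : unitary (K.Lv R' (n + 1))} {P : K.Lv R (n + 1)} (hV : K.IsIndexLift φ ψ n U V P) :
    h.index n U =
      K.class0 (n + 1) P hV.isStarProjection - K.class0 n 1 (K.isStarProjection_one _) := by
  rw [index, sub_left_inj]
  have hl := (h.exists_isIndexLift n U).choose_spec.choose_spec
  have hV1 : K.IsIndexLift φ ψ n (U * K.unMap ψ n 1) V P := by rwa [map_one, mul_one]
  exact h.class0_eq_of_isIndexLift 1 hl hV1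

theorem index_mul_unMap (h : IsExactPair π φ ψ) {n : ℕ} (U : unitary (K.Lv R'' n))
    (Y : unitary (K.Lv R' n)) : h.index n (U * K.unMap ψ n Y) = h.index n U := by
  obtain ⟨V, P, hV⟩ := h.exists_isIndexLift n U
  obtain ⟨V', P', hV'⟩ := h.exists_isIndexLift n (U * K.unMap ψ n Y)
  rw [h.index_eq hV, h.index_eq hV', h.class0_eq_of_isIndexLift Y hV hV']

theorem index_diagUn (h : IsExactPair π φ ψ) {n : ℕ} (U U' : unitary (K.Lv R'' n)) :
    h.index (n + 1) (K.diagUn n U U') = h.index n U + h.index n U' := by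
  obtain ⟨V, P, hV⟩ := h.exists_isIndexLift n U
  obtain ⟨V', P', hV'⟩ := h.exists_isIndexLift n U'
  obtain ⟨V'', P'', hV''⟩ := h.exists_isIndexLift (n + 1) (K.diagUn n U U')
  rw [h.index_eq hV, h.index_eq hV', h.index_eq hV'', h.class0_add_of_isIndexLift hV hV' hV'',
    K.class0_one_succ]
  abel

theorem index_one (h : IsExactPair π φ ψ) (n : ℕ) : h.index n (1 : unitary (K.Lv R'' n)) = 0 := by
  have hV : K.IsIndexLift φ ψ n 1 1 (K.aa R n) := ⟨K.aa_isStarProjection n, by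
    simp [aa_add_bb], by simp [lmap_aa]⟩
  rw [h.index_eq hV, class0_aa, sub_self]

theorem index_tau (h : IsExactPair π φ ψ) {n : ℕ} (U : unitary (K.Lv R'' n)) :
    h.index (n + 1) (K.tau n U) = h.index n U := by
  rw [tau_eq_diagUn, index_diagUn, index_one, add_zero]

theorem index_stab (h : IsExactPair π φ ψ) {n m : ℕ} (hm : n ≤ m) (U : unitary (K.Lv R'' n)) :
    h.index m (K.stab hm U) = h.index n U := by
  induction m, hm using Nat.le_induction with
  | base => rw [stab_self]
  | succ k hk ih => rw [K.stab_succ hk, index_tau, ih]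

theorem index_mul (h : IsExactPair π φ ψ) {n : ℕ} (U U' : unitary (K.Lv R'' n)) :
    h.index n (U * U') = h.index n U + h.index n U' := by
  obtain ⟨V', P', hV'⟩ := h.exists_isIndexLift n U'
  -- `diag(U U', 1) = diag(U, U') diag(U', U'*)`, and the last factor is the image of `V'`.
  have e : K.tau n (U * U') = K.diagUn n U U' * K.unMap ψ (n + 1) V' := by
    apply Subtype.ext
    rw [coe_tau_eq_mat2, Submonoid.coe_mul, Submonoid.coe_mul, coe_diagUn, coe_unMap, hV'.lmap_V,
      mat2_mul]
    simp
  rw [← h.index_tau, e, h.index_mul_unMap, index_diagUn]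

theorem index_unMap (h : IsExactPair π φ ψ) {n : ℕ} (Y : unitary (K.Lv R' n)) :
    h.index n (K.unMap ψ n Y) = 0 := by
  rw [← one_mul (K.unMap ψ n Y), index_mul_unMap, index_one]

theorem unMap_unMap_unitHom (ψ : R' →⋆ₐ[E] R'') {n : ℕ} (W : unitary (K.Lv E n)) :
    K.unMap ψ n (K.unMap (unitHom R') n W) = K.unMap (unitHom R'') n W :=
  Subtype.ext (K.toSchurTower.lmap_unitMap ψ n W)

/-- Unitaries of `R''_n` which are homotopic to unitaries of `E_n` lift to such unitaries of
`R'_n`. -/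
theorem exists_lift_of_mem_UnE (h : IsExactPair π φ ψ) {n : ℕ} {U : unitary (K.Lv R'' n)}
    (hU : U ∈ K.UnE R'' n) : ∃ Y ∈ K.UnE R' n, K.unMap ψ n Y = U := by
  obtain ⟨W, hW⟩ := hU
  have hj : Joined 1 (U * (K.unMap (unitHom R'') n W)⁻¹) := by
    have := hW.symm.mul (Joined.refl (K.unMap (unitHom R'') n W)⁻¹)
    rwa [mul_inv_cancel] at this
  obtain ⟨Y, hY1, hY⟩ := K.toSchurTower.exists_joined_lift ψ h.surjective n _ hj
  refine ⟨Y * K.unMap (unitHom R') n W, (K.UnE R' n).mul_mem ⟨1, ?_⟩ ⟨W, Joined.refl _⟩, ?_⟩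
  · rw [map_one]
    exact hY1.symm
  · have e : K.unMap ψ n Y = U * (K.unMap (unitHom R'') n W)⁻¹ := Subtype.ext hY
    rw [map_mul, e, unMap_unMap_unitHom, inv_mul_cancel_right]

theorem index_eq_of_class1_eq (h : IsExactPair π φ ψ) {n m : ℕ} {U : unitary (K.Lv R'' n)}
    {U' : unitary (K.Lv R'' m)} (e : K.class1 n U = K.class1 m U') :
    h.index n U = h.index m U' := by
  have key : ∀ {k : ℕ} {U : unitary (K.Lv R'' k)}, K.class1 k U = 0 → h.index k U = 0 := by
    intro k U hU
    obtain ⟨l, hl, hl'⟩ := K.class1_eq_zero_iff.mp hU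
    obtain ⟨Y, -, hY⟩ := h.exists_lift_of_mem_UnE hl'
    rw [← h.index_stab hl, ← hY, index_unMap]
  rw [← h.index_stab (le_max_left n m), ← h.index_stab (le_max_right n m)]
  rw [← K.class1_stab (le_max_left n m), ← K.class1_stab (le_max_right n m)] at e
  generalize K.stab (le_max_left n m) U = Z at e
  generalize K.stab (le_max_right n m) U' = Z' at e
  have h0 : K.class1 _ (Z * Z'⁻¹) = 0 := by
    have h1 := K.class1_mul _ (Z * Z'⁻¹) Z'
    rwa [inv_mul_cancel_right, e, right_eq_add] at h1
  have h2 := h.index_mul (Z * Z'⁻¹) Z'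
  rwa [key h0, zero_add, inv_mul_cancel_right] at h2

/-- The index map from `K_1` of `R''` to the Grothendieck group of `R`, given on classes by the
index of a chosen representative. -/
def indexHom (h : IsExactPair π φ ψ) : K.K1Full R'' →+ K.K0Full R :=
  AddMonoidHom.mk' (fun x => h.index _ (K.class1_surjective x).choose_spec.choose) fun x y => by
    obtain ⟨n, U, rfl⟩ := K.class1_surjective x
    obtain ⟨m, V, rfl⟩ := K.class1_surjective y
    have e : ∀ {x : K.K1Full R''} {k : ℕ} (W : unitary (K.Lv R'' k)), x = K.class1 k W →
        h.index _ (K.class1_surjective x).choose_spec.choose = h.index k W := fun {x _} W hW =>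
      h.index_eq_of_class1_eq ((K.class1_surjective x).choose_spec.choose_spec.trans hW)
    rw [e (K.stab (le_max_left n m) U) (K.class1_stab _ U).symm,
      e (K.stab (le_max_right n m) V) (K.class1_stab _ V).symm, ← index_mul]
    exact e _ (by rw [class1_mul, class1_stab, class1_stab])

theorem indexHom_class1 (h : IsExactPair π φ ψ) (n : ℕ) (U : unitary (K.Lv R'' n)) :
    h.indexHom (K.class1 n U) = h.index n U :=
  h.index_eq_of_class1_eq (K.class1_surjective (K.class1 n U)).choose_spec.choose_spec

/-- The augmentation of the projection of an index lift is `A_{n+1}`, because the image of `P` in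
`R''` is. -/
theorem lmap_augmentation (h : IsExactPair π φ ψ) {n : ℕ} {U : unitary (K.Lv R'' n)}
    {V : unitary (K.Lv R' (n + 1))} {P : K.Lv R (n + 1)} (hV : K.IsIndexLift φ ψ n U V P)
    (hE : Function.Injective (algebraMap E R'')) :
    K.toSchurTower.lmap π (n + 1) P = K.aa E n := by
  have e := lmap_isIndexLift hV
  rw [h.lmap_lmap, ← K.unitMap_aa] at e
  exact K.toSchurTower.unitMap_injective hE (n + 1) e

end IsExactPair
end ProjKData

namespace ProjKData

variable {E : Type u} {T : Type v} [CommCStarAlgebra E] [Group T] (K : ProjKData E T)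

/-! ### Unitaries cut down to a projection -/

section Aux

variable {A : Type*} [Ring A] [StarRing A]

theorem commute_of_conj {w : unitary A} {p q : A} (h : (w : A) * p * star (w : A) = q) :
    (w : A) * p = q * w := by
  rw [← h, mul_assoc, Unitary.coe_star_mul_self, mul_one]

theorem commute_star_of_commute {V : unitary A} {q : A} (hV : Commute (V : A) q) :
    Commute (star (V : A)) q := by
  have h : star (V : A) * (V * q) * star (V : A) = star (V : A) * (q * V) * star (V : A) := by
    rw [hV.eq]
  rw [← mul_assoc, Unitary.coe_star_mul_self, one_mul, mul_assoc, mul_assoc q,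
    Unitary.mul_star_self_of_mem V.2, mul_one] at h
  exact h.symm

/-- The unitary which agrees with `V` on `q` and is the identity on `1 - q`, for a unitary `V`
commuting with the projection `q`. -/
def cutUn (V : unitary A) {q : A} (hq : IsStarProjection q) (hV : Commute (V : A) q) : unitary A :=
  ⟨V * q + (1 - q), by
    have hqq : q * q = q := hq.isIdempotentElem.eq
    have hqs : star q = q := hq.isSelfAdjoint.star_eq
    have h1 := (commute_star_of_commute hV).eq
    have e : ∀ {a b : A}, a * b = 1 → a * q = q * a → b * q = q * b →
        (a * q + (1 - q)) * (b * q + (1 - q)) = 1 := by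
      intro a b hab ha hb
      have h2 : a * q * (b * q) = q := by
        rw [hb, ha, mul_assoc, ← mul_assoc a, ha, mul_assoc, hab, mul_one, hqq]
      have h3 : a * q * (1 - q) = 0 := by rw [mul_assoc, mul_sub, mul_one, hqq, sub_self, mul_zero]
      have h4 : (1 - q) * (b * q) = 0 := by
        rw [hb, ← mul_assoc, sub_mul, one_mul, hqq, sub_self, zero_mul]
      rw [add_mul, mul_add, mul_add, h2, h3, h4, hq.one_sub.isIdempotentElem.eq]
      simp
    rw [Unitary.mem_iff, star_add, star_mul, star_sub, star_one, hqs, ← h1]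
    exact ⟨e (Unitary.coe_star_mul_self V) h1 hV.eq, e (Unitary.coe_mul_star_self V) hV.eq h1⟩⟩

theorem coe_cutUn (V : unitary A) {q : A} (hq : IsStarProjection q) (hV : Commute (V : A) q) :
    (cutUn V hq hV : A) = V * q + (1 - q) := rfl

end Aux

/-! ### Adding a projection of `E_m` orthogonal to `R_n` -/

section CornerAdd

variable {R : Type w} [CStarAlgebra R] [Algebra E R] [StarModule E R]

theorem corner_one_mul_unitMap {n m : ℕ} {hm : n ≤ m} {e : K.Lv E m} (he : K.corner hm 1 * e = 0) :
    K.corner hm (1 : K.Lv R n) * K.toSchurTower.unitMap R m e = 0 := by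
  have h := congrArg (K.toSchurTower.unitMap R m) he
  rwa [map_mul, map_zero, SchurTower.unitMap, lmap_corner, map_one] at h

theorem corner_mul_unitMap {n m : ℕ} {hm : n ≤ m} {e : K.Lv E m} (he : K.corner hm 1 * e = 0)
    (X : K.Lv R n) : K.corner hm X * K.toSchurTower.unitMap R m e = 0 := by
  rw [← mul_one X, map_mul, mul_assoc, K.corner_one_mul_unitMap he, mul_zero]

theorem unitMap_mul_corner {n m : ℕ} {hm : n ≤ m} {e : K.Lv E m} (hes : IsStarProjection e)
    (he : K.corner hm 1 * e = 0) (X : K.Lv R n) :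
    K.toSchurTower.unitMap R m e * K.corner hm X = 0 := by
  have h := congrArg star (K.corner_mul_unitMap he (star X))
  rwa [star_mul, star_zero, ← map_star, ← map_star, star_star, hes.isSelfAdjoint.star_eq] at h

theorem corner_add_isStarProjection {n m : ℕ} {hm : n ≤ m} {e : K.Lv E m}
    (hes : IsStarProjection e) (he : K.corner hm 1 * e = 0) {P : K.Lv R n}
    (hP : IsStarProjection P) :
    IsStarProjection (K.corner hm P + K.toSchurTower.unitMap R m e) :=
  K.add_isStarProjection (K.corner_isStarProjection hm hP) (K.unitMap_isStarProjection hes)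
    (K.corner_mul_unitMap he P)

theorem class0_corner_add {n m : ℕ} {hm : n ≤ m} {e : K.Lv E m}
    (hes : IsStarProjection e) (he : K.corner hm 1 * e = 0) {P : K.Lv R n}
    (hP : IsStarProjection P) :
    K.class0 m _ (K.corner_add_isStarProjection hes he hP) =
      K.class0 n P hP + K.class0 m _ (K.unitMap_isStarProjection (R := R) hes) := by
  rw [← K.class0_corner hm hP]
  exact K.class0_add _ _ (K.corner_mul_unitMap he P)

theorem lmap_corner_add {R' : Type*} [CStarAlgebra R'] [Algebra E R'] [StarModule E R']
    (χ : R →⋆ₐ[E] R') {n m : ℕ} (hm : n ≤ m) (e : K.Lv E m) (P : K.Lv R n) :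
    K.toSchurTower.lmap χ m (K.corner hm P + K.toSchurTower.unitMap R m e) =
      K.corner hm (K.toSchurTower.lmap χ n P) + K.toSchurTower.unitMap R' m e := by
  rw [map_add, lmap_corner, SchurTower.lmap_unitMap]

theorem unitMap_corner_add {n m : ℕ} (hm : n ≤ m) (e : K.Lv E m) (P : K.Lv E n) :
    K.toSchurTower.unitMap R m (K.corner hm P + e) =
      K.corner hm (K.toSchurTower.unitMap R n P) + K.toSchurTower.unitMap R m e := by
  rw [map_add, SchurTower.unitMap, lmap_corner, SchurTower.unitMap]

theorem stab_mul_corner_add {n m : ℕ} {hm : n ≤ m} {e : K.Lv E m} (he : K.corner hm 1 * e = 0)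
    (V : unitary (K.Lv R n)) (X : K.Lv R n) :
    (K.stab hm V : K.Lv R m) * (K.corner hm X + K.toSchurTower.unitMap R m e) =
      K.corner hm ((V : K.Lv R n) * X) + K.toSchurTower.unitMap R m e := by
  rw [coe_stab, add_mul, mul_add, mul_add, sub_mul, sub_mul, K.corner_mul_unitMap he,
    K.corner_mul_unitMap he, ← map_mul, ← map_mul]
  simp

theorem corner_add_mul_stab {n m : ℕ} {hm : n ≤ m} {e : K.Lv E m} (hes : IsStarProjection e)
    (he : K.corner hm 1 * e = 0) (V : unitary (K.Lv R n)) (X : K.Lv R n) :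
    (K.corner hm X + K.toSchurTower.unitMap R m e) * (K.stab hm V : K.Lv R m) =
      K.corner hm (X * (V : K.Lv R n)) + K.toSchurTower.unitMap R m e := by
  rw [coe_stab, add_mul, mul_add, mul_add, mul_sub, mul_sub, K.unitMap_mul_corner hes he,
    K.unitMap_mul_corner hes he, ← map_mul, ← map_mul]
  simp

/-- The matrix `(q w*, 1 - q; 0, 0)` is a partial isometry from `diag(w q w*, 1 - q)` to
`diag(1, 0)`. -/
theorem partial_isometry_mat2 (n : ℕ) (w : unitary (K.Lv R n)) {q : K.Lv R n}
    (hq : IsStarProjection q) :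
    star (K.mat2 n (q * star (w : K.Lv R n)) (1 - q) 0 0) *
        K.mat2 n (q * star (w : K.Lv R n)) (1 - q) 0 0 =
      K.mat2 n ((w : K.Lv R n) * q * star (w : K.Lv R n)) 0 0 (1 - q) ∧
    K.mat2 n (q * star (w : K.Lv R n)) (1 - q) 0 0 *
        star (K.mat2 n (q * star (w : K.Lv R n)) (1 - q) 0 0) = K.aa R n := by
  have hqq : q * q = q := hq.isIdempotentElem.eq
  have hqs : star q = q := hq.isSelfAdjoint.star_eq
  have h1 : q * (1 - q) = 0 := by rw [mul_sub, mul_one, hqq, sub_self]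
  have h2 : (1 - q) * q = 0 := by rw [sub_mul, one_mul, hqq, sub_self]
  have h3 : (1 - q) * (1 - q) = 1 - q := hq.one_sub.isIdempotentElem.eq
  have h4 : star (q * star (w : K.Lv R n)) = w * q := by rw [star_mul, star_star, hqs]
  have h5 : (w : K.Lv R n) * q * (q * star (w : K.Lv R n)) = w * q * star (w : K.Lv R n) := by
    rw [mul_assoc, ← mul_assoc q, hqq, ← mul_assoc]
  have h6 : (w : K.Lv R n) * q * (1 - q) = 0 := by rw [mul_assoc, h1, mul_zero]
  have h7 : (1 - q) * (q * star (w : K.Lv R n)) = 0 := by rw [← mul_assoc, h2, zero_mul]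
  have h8 : q * star (w : K.Lv R n) * (w * q) = q := by
    rw [mul_assoc, ← mul_assoc (star (w : K.Lv R n)), Unitary.coe_star_mul_self, one_mul, hqq]
  have h9 : star (1 - q) = 1 - q := by rw [star_sub, star_one, hqs]
  rw [mat2_star, mat2_mul, mat2_mul, h4, h9, h5, h6, h7, h3, h8, aa_eq_mat2]
  simp

end CornerAdd

/-! ### Exactness -/

namespace IsExactPair

variable {R R' R'' : Type*} [CStarAlgebra R] [Algebra E R] [StarModule E R]
  [CStarAlgebra R'] [Algebra E R'] [StarModule E R'] [IsScalarTower ℂ E R']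
  [CStarAlgebra R''] [Algebra E R''] [StarModule E R''] [IsScalarTower ℂ E R'']
  {K} {π : R →⋆ₐ[E] E} {φ : R →⋆ₐ[E] R'} {ψ : R' →⋆ₐ[E] R''}

theorem unMap_unMap [IsScalarTower ℂ E R] (h : IsExactPair π φ ψ) (n : ℕ)
    (w : unitary (K.Lv R n)) :
    K.unMap ψ n (K.unMap φ n w) = K.unMap (unitHom R'') n (K.unMap π n w) := by
  apply Subtype.ext
  rw [coe_unMap, coe_unMap]
  exact h.lmap_lmap n (w : K.Lv R n)

/-- Exactness at `K_1(G)`: a class of `R'` that vanishes in `R''` comes from `R`. -/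
theorem exists_k1FullMap_eq [IsScalarTower ℂ E R] (h : IsExactPair π φ ψ) {x : K.K1Full R'}
    (hx : K.k1FullMap ψ x = 0) : ∃ y : K.K1Full R, K.k1FullMap φ y = x := by
  obtain ⟨n, U, rfl⟩ := K.class1_surjective x
  rw [k1FullMap_class1] at hx
  obtain ⟨m, hm, hU⟩ := K.class1_eq_zero_iff.mp hx
  rw [← unMap_stab] at hU
  obtain ⟨Y, hY, hYU⟩ := h.exists_lift_of_mem_UnE hU
  -- `U Y*` has image `1` in `R''`, and `Y` has the class zero.
  obtain ⟨Z, hZ⟩ := h.exists_unMap_eq (V := K.stab hm U * Y⁻¹) (c := 1) (by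
    rw [map_one, ← coe_unMap, map_mul, map_inv, hYU, mul_inv_cancel, OneMemClass.coe_one])
  refine ⟨K.class1 m Z, ?_⟩
  have e := K.class1_mul m (K.stab hm U * Y⁻¹) Y
  rw [inv_mul_cancel_right, K.class1_eq_zero_of_mem hY, add_zero, class1_stab] at e
  rw [k1FullMap_class1, hZ, e]

/-- Exactness at `K_1(H)`: a unitary of `R''` with index zero lifts, up to equivalence, to `R'`. -/
theorem exists_k1FullMap_eq_of_indexHom_eq_zero (h : IsExactPair π φ ψ)
    (hE : Function.Injective (algebraMap E R'')) [IsScalarTower ℂ E R] {x : K.K1Full R''}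
    (hx : h.indexHom x = 0) : ∃ y : K.K1Full R', K.k1FullMap ψ y = x := by
  obtain ⟨n, U, rfl⟩ := K.class1_surjective x
  rw [indexHom_class1] at hx
  obtain ⟨V, P, hV⟩ := h.exists_isIndexLift n U
  rw [h.index_eq hV, ← class0_aa, sub_eq_zero] at hx
  obtain ⟨m, hm, e, hes, he, w, -, hw⟩ := K.exists_conj_of_class0_eq hx
  have hπP := h.lmap_augmentation hV hE
  have hq : IsStarProjection (K.corner hm (K.aa R' n) + K.toSchurTower.unitMap R' m e) :=
    K.corner_add_isStarProjection hes he (K.aa_isStarProjection n)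
  -- Put `q = A_{n+1} + e`, so that `w (P + e) w* = q` and `V q V* = P + e`. The augmentation of `P`
  -- is `A_{n+1}`; hence that of `w`, viewed in `R'` as `c`, commutes with `q`.
  obtain ⟨c, hcq, hcψ⟩ : ∃ c : unitary (K.Lv R' m),
      Commute (c : K.Lv R' m) (K.corner hm (K.aa R' n) + K.toSchurTower.unitMap R' m e) ∧
        K.unMap ψ m c = K.unMap ψ m (K.unMap φ m w) := by
    refine ⟨K.unMap (unitHom R') m (K.unMap π m w), ?_, ?_⟩
    · have hc := congrArg (K.toSchurTower.lmap π m) hw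
      rw [map_mul, map_mul, map_star, lmap_corner_add, lmap_corner_add, hπP, lmap_aa, unitMap_self,
        ← coe_unMap] at hc
      have hc' := congrArg (K.toSchurTower.unitMap R' m) (commute_of_conj hc)
      rw [map_mul, map_mul, unitMap_corner_add, unitMap_aa] at hc'
      exact hc'
    · rw [unMap_unMap_unitHom, h.unMap_unMap]
  have hwq : (K.unMap φ m w : K.Lv R' m) *
      (K.corner hm (K.toSchurTower.lmap φ (n + 1) P) + K.toSchurTower.unitMap R' m e) =
      (K.corner hm (K.aa R' n) + K.toSchurTower.unitMap R' m e) * K.unMap φ m w := by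
    apply commute_of_conj
    have h1 := congrArg (K.toSchurTower.lmap φ m) hw
    rw [map_mul, map_mul, map_star, lmap_corner_add, lmap_corner_add, lmap_aa] at h1
    exact h1
  have hVq : (K.stab hm V : K.Lv R' m) *
      (K.corner hm (K.aa R' n) + K.toSchurTower.unitMap R' m e) =
      (K.corner hm (K.toSchurTower.lmap φ (n + 1) P) + K.toSchurTower.unitMap R' m e) *
        K.stab hm V := by
    rw [K.stab_mul_corner_add he, K.corner_add_mul_stab hes he,
      commute_of_conj hV.map_P.symm]
  -- `V' = c* w V` commutes with `q`, and has the same image as `V` in `R''`.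
  obtain ⟨V', hV'q, hV'ψ⟩ : ∃ V' : unitary (K.Lv R' m),
      Commute (V' : K.Lv R' m) (K.corner hm (K.aa R' n) + K.toSchurTower.unitMap R' m e) ∧
        K.unMap ψ m V' = K.stab hm (K.unMap ψ (n + 1) V) := by
    refine ⟨c⁻¹ * K.unMap φ m w * K.stab hm V, ?_, ?_⟩
    · have h1 := (commute_star_of_commute hcq).eq
      have h2 : ((c⁻¹ * K.unMap φ m w * K.stab hm V : unitary (K.Lv R' m)) : K.Lv R' m) =
        star (c : K.Lv R' m) * K.unMap φ m w * K.stab hm V := rfl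
      rw [Commute, SemiconjBy, h2, mul_assoc, hVq, ← mul_assoc, mul_assoc (star (c : K.Lv R' m)),
        hwq, ← mul_assoc, h1]
      simp only [mul_assoc]
    · rw [map_mul, map_mul, map_inv, hcψ, inv_mul_cancel, one_mul, unMap_stab]
  -- The image of `V' q + (1 - q)` is `diag(U, U*) (A_{n+1} + e) + (1 - A_{n+1} - e)`, and this is
  -- `diag(U, 1)`, the stabilization of `U`.
  refine ⟨K.class1 m (cutUn V' hq hV'q), ?_⟩
  rw [k1FullMap_class1, ← K.class1_stab n.le_succ, ← K.class1_stab hm]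
  congr 1
  apply Subtype.ext
  rw [coe_unMap, coe_cutUn, map_add, map_mul, ← coe_unMap, hV'ψ, map_sub, map_one,
    lmap_corner_add, lmap_aa, K.stab_mul_corner_add he, coe_stab, K.stab_succ le_rfl, stab_self,
    coe_tau_eq_mat2, coe_unMap, hV.lmap_V]
  have h3 : K.mat2 n (U : K.Lv R'' n) 0 0 1 = K.mat2 n U 0 0 (star (U : K.Lv R'' n)) * K.aa R'' n +
      (1 - K.aa R'' n) := by
    rw [aa_eq_mat2, ← mat2_one, mat2_mul, mat2_sub, mat2_add]
    simp
  rw [h3, map_add, map_sub]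
  abel

/-- Exactness at `K_0(F)`: an element of the kernel of the augmentation which vanishes in `R'` is an
index. -/
theorem exists_indexHom_eq (h : IsExactPair π φ ψ) {x : K.K0Full R} (hπ : K.k0FullMap π x = 0)
    (hx : K.k0FullMap φ x = 0) : ∃ y : K.K1Full R'', h.indexHom y = x := by
  obtain ⟨n, P, hP, rfl⟩ := K.exists_class0_sub_unitMap π hπ
  rw [map_sub, sub_eq_zero, k0FullMap_class0, k0FullMap_class0] at hx
  have hpP := K.lmap_isStarProjection π hP
  obtain ⟨m, hm, e, hes, he, w, -, hw⟩ := K.exists_conj_of_class0_eq hx.symm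
  rw [SchurTower.lmap_unitMap, ← unitMap_corner_add, ← lmap_corner_add] at hw
  have hP1 := K.corner_add_isStarProjection hes he hP
  have hq : IsStarProjection (K.corner hm (K.toSchurTower.lmap π n P) + e) := by
    simpa only [unitMap_self] using K.corner_add_isStarProjection hes he hpP
  have hπ1 : K.toSchurTower.lmap π m (K.corner hm P + K.toSchurTower.unitMap R m e) =
      K.corner hm (K.toSchurTower.lmap π n P) + e := by
    rw [lmap_corner_add, unitMap_self]
  have hx1 : K.class0 n P hP - K.class0 n _ (K.unitMap_isStarProjection hpP) =
      K.class0 m _ hP1 - K.class0 m _ (K.unitMap_isStarProjection (R := R) hq) := by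
    rw [K.class0_congr (hQ := K.corner_add_isStarProjection hes he (K.unitMap_isStarProjection hpP))
      (K.unitMap_corner_add hm e _), K.class0_corner_add hes he hP,
      K.class0_corner_add hes he (K.unitMap_isStarProjection hpP)]
    abel
  rw [hx1]
  -- It remains to treat `[P1]_0 - [q]_0` for a projection `P1` of `R_m` with augmentation `q`,
  -- where a unitary `w` of `R'_m` conjugates `q` to `P1`.
  generalize K.corner hm P + K.toSchurTower.unitMap R m e = P1 at *
  generalize K.corner hm (K.toSchurTower.lmap π n P) + e = q at *
  clear hx1 hx
  have hQ' := K.unitMap_isStarProjection (R := R') hq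
  have hQ'' := K.unitMap_isStarProjection (R := R'') hq
  have hu : Commute (K.unMap ψ m w : K.Lv R'' m) (K.toSchurTower.unitMap R'' m q) := by
    apply commute_of_conj
    have h1 := congrArg (K.toSchurTower.lmap ψ m) hw
    rw [map_mul, map_mul, map_star, h.lmap_lmap, hπ1, SchurTower.lmap_unitMap] at h1
    exact h1
  refine ⟨K.class1 m (cutUn _ hQ'' hu), ?_⟩
  obtain ⟨V, P', hV⟩ := h.exists_isIndexLift m (cutUn _ hQ'' hu)
  have hQ := K.unitMap_isStarProjection (R := R) hq
  -- With `u` the image of `w` in `R''` and `(V, P')` an index lift of `u q + (1 - q)`, the partial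
  -- isometry `V (q w*, 1 - q; 0, 0)` takes `diag(P1, 1 - q)` to `P'`. Its image in `R''` is the
  -- matrix `(q, 1 - q; 0, 0)` over `E_m`, so `[P1]_0 + [1 - q]_0 = [P']_0`.
  have key := h.class0_eq (K.mat2_diag_isStarProjection hP1 hQ.one_sub) hV.isStarProjection
    (X := V * K.mat2 m (K.toSchurTower.unitMap R' m q * star (w : K.Lv R' m))
      (1 - K.toSchurTower.unitMap R' m q) 0 0) (c := K.mat2 m q (1 - q) 0 0) ?_ ?_ ?_
  · rw [indexHom_class1, h.index_eq hV, ← key, K.class0_mat2_diag hP1 hQ.one_sub,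
      K.class0_one_sub hQ]
    abel
  · have e1 := conj_star_mul_conj 1 V (K.mat2 m (K.toSchurTower.unitMap R' m q *
      star (w : K.Lv R' m)) (1 - K.toSchurTower.unitMap R' m q) 0 0)
    rw [OneMemClass.coe_one, star_one, mul_one, one_mul, mul_one] at e1
    rw [e1, (K.partial_isometry_mat2 m w hQ').1, lmap_mat2, ← hw, map_sub, map_one,
      SchurTower.lmap_unitMap, map_zero]
  · have e1 := conj_mul_conj_star 1 V (K.mat2 m (K.toSchurTower.unitMap R' m q *
      star (w : K.Lv R' m)) (1 - K.toSchurTower.unitMap R' m q) 0 0)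
    rw [OneMemClass.coe_one, star_one, mul_one] at e1
    rw [e1, (K.partial_isometry_mat2 m w hQ').2, hV.map_P]
  · have hqq : K.toSchurTower.unitMap R'' m q * K.toSchurTower.unitMap R'' m q =
      K.toSchurTower.unitMap R'' m q := hQ''.isIdempotentElem.eq
    rw [map_mul, hV.lmap_V, lmap_mat2, unitMap_mat2, coe_cutUn, mat2_mul, map_mul, map_star,
      map_sub, map_sub, map_one, map_one, SchurTower.lmap_unitMap, ← coe_unMap]
    generalize K.toSchurTower.unitMap R'' m q = Q at *
    generalize K.unMap ψ m w = u at *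
    have h1 : ((u : K.Lv R'' m) * Q + (1 - Q)) * (Q * star (u : K.Lv R'' m)) = Q := by
      have h2 : (1 - Q) * (Q * star (u : K.Lv R'' m)) = 0 := by
        rw [← mul_assoc, sub_mul, one_mul, hqq, sub_self, zero_mul]
      rw [add_mul, h2, add_zero, mul_assoc, ← mul_assoc Q, hqq, ← mul_assoc, hu.eq, mul_assoc,
        Unitary.mul_star_self_of_mem u.2, mul_one]
    have h3 : ((u : K.Lv R'' m) * Q + (1 - Q)) * (1 - Q) = 1 - Q := by
      rw [add_mul, mul_assoc, mul_sub, mul_one, hqq, sub_self, mul_zero, zero_add, mul_sub,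
        sub_mul, sub_mul, hqq]
      simp
    rw [h1, h3]
    simp

/-- Exactness at `K_0(G)`: an element of the kernel of the augmentation `π'` of `R'` which vanishes
in `R''` comes from an element of the kernel of the augmentation of `R`. -/
theorem exists_k0FullMap_eq (h : IsExactPair π φ ψ) (π' : R' →⋆ₐ[E] E) {x : K.K0Full R'}
    (hπ : K.k0FullMap π' x = 0) (hx : K.k0FullMap ψ x = 0) :
    ∃ y : K.K0Full R, K.k0FullMap π y = 0 ∧ K.k0FullMap φ y = x := by
  obtain ⟨n, P, hP, rfl⟩ := K.exists_class0_sub_unitMap π' hπ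
  rw [map_sub, sub_eq_zero, k0FullMap_class0, k0FullMap_class0] at hx
  have hpP := K.lmap_isStarProjection π' hP
  obtain ⟨m, hm, e, hes, he, w, hw1, hw⟩ := K.exists_conj_of_class0_eq hx
  rw [SchurTower.lmap_unitMap, ← unitMap_corner_add, ← lmap_corner_add] at hw
  -- After conjugation with a lift `Y` of `w`, the projection `P + e` has its image in `E_m`.
  obtain ⟨Y, -, hY⟩ := K.toSchurTower.exists_joined_lift ψ h.surjective m w hw1
  have hP1 := K.corner_add_isStarProjection hes he hP
  have hq : IsStarProjection (K.corner hm (K.toSchurTower.lmap π' n P) + e) := by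
    simpa only [unitMap_self] using K.corner_add_isStarProjection hes he hpP
  obtain ⟨Z, hZ, hZ1, hZ2⟩ := h.exists_isStarProjection (conj_isStarProjection Y hP1)
    (c := K.corner hm (K.toSchurTower.lmap π' n P) + e) (by
      rw [map_mul, map_mul, map_star, hY, hw])
  refine ⟨K.class0 m Z hZ - K.class0 m _ (K.unitMap_isStarProjection hq), ?_, ?_⟩
  · rw [map_sub, sub_eq_zero, k0FullMap_class0, k0FullMap_class0]
    exact K.class0_congr (by rw [hZ2, SchurTower.lmap_unitMap, unitMap_self])
  · have hR := K.unitMap_isStarProjection (R := R') hpP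
    have hs := K.corner_add_isStarProjection hes he hR
    rw [map_sub, k0FullMap_class0, k0FullMap_class0,
      K.class0_congr (hQ := conj_isStarProjection Y hP1) hZ1,
      K.class0_congr (hP := K.lmap_isStarProjection φ (K.unitMap_isStarProjection hq)) (hQ := hs)
        (by rw [SchurTower.lmap_unitMap, unitMap_corner_add]),
      ← K.class0_eq_of_mvn hP1 (conj_isStarProjection Y hP1)
        (Y * (K.corner hm P + K.toSchurTower.unitMap R' m e)) (by
          rw [star_mul, mul_assoc, ← mul_assoc (star (Y : K.Lv R' m)), Unitary.coe_star_mul_self,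
            one_mul, hP1.isSelfAdjoint.star_eq, hP1.isIdempotentElem.eq]) (by
          rw [star_mul, mul_assoc, ← mul_assoc (K.corner hm P + _), hP1.isSelfAdjoint.star_eq,
            hP1.isIdempotentElem.eq, mul_assoc]),
      K.class0_corner_add hes he hP, K.class0_corner_add hes he hR]
    abel

end IsExactPair
end ProjKData

/-! ### The algebras `F̌`, `Ǧ`, `Ȟ` of an exact sequence -/

section CheckPair

variable {E F G H : Type*} [CommCStarAlgebra E]
  [NonUnitalCStarAlgebra F] [Module E F] [IsScalarTower ℂ E F] [IsScalarTower E F F]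
  [SMulCommClass E F F] [StarModule E F] [IsBoundedSMul E F]
  [NonUnitalCStarAlgebra G] [Module E G] [IsScalarTower ℂ E G] [IsScalarTower E G G]
  [SMulCommClass E G G] [StarModule E G] [IsBoundedSMul E G]
  [NonUnitalCStarAlgebra H] [Module E H] [IsScalarTower ℂ E H] [IsScalarTower E H H]
  [SMulCommClass E H H] [StarModule E H] [IsBoundedSMul E H]

theorem Check.algebraMap_injective : Function.Injective (algebraMap E (Check E H)) := by
  intro α β e
  have h := congrArg Check.toProd e
  rw [Check.toProd_algebraMap, Check.toProd_algebraMap] at h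
  exact congrArg Prod.fst h

theorem Check.isExactPair {φ : F →⋆ₙₐ[E] G} {ψ : G →⋆ₙₐ[E] H} (hφ : Function.Injective φ)
    (hφψ : Function.Exact φ ψ) (hψ : Function.Surjective ψ) :
    ProjKData.IsExactPair (Check.piHom E F) (Check.mapHom φ) (Check.mapHom ψ) where
  injective x y e := by
    have h := congrArg Check.toProd e
    rw [Check.toProd_mapHom, Check.toProd_mapHom, Prod.mk.injEq] at h
    exact Check.toProd.injective (Prod.ext h.1 (hφ h.2))
  surjective z := by
    obtain ⟨y, hy⟩ := hψ (Check.toProd z).2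
    refine ⟨Check.toProd.symm ((Check.toProd z).1, y), Check.toProd.injective ?_⟩
    rw [Check.toProd_mapHom, AddEquiv.apply_symm_apply, hy]
  map_map y := by
    apply Check.toProd.injective
    rw [Check.toProd_mapHom, Check.toProd_mapHom, Check.toProd_algebraMap, Check.piHom_apply,
      hφψ.apply_apply_eq_zero]
  exists_map_eq x α e := by
    have h := congrArg Check.toProd e
    rw [Check.toProd_mapHom, Check.toProd_algebraMap, Prod.mk.injEq] at h
    obtain ⟨y, hy⟩ := (hφψ _).mp h.2
    refine ⟨Check.toProd.symm (α, y), Check.toProd.injective ?_, ?_⟩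
    · rw [Check.toProd_mapHom, AddEquiv.apply_symm_apply, hy, ← h.1]
    · rw [Check.piHom_apply, AddEquiv.apply_symm_apply]

end CheckPair

namespace ProjKData

variable {E : Type u} {T : Type v} [CommCStarAlgebra E] [Group T] {K : ProjKData E T}

section
variable {F : Type*} [NonUnitalCStarAlgebra F] [Module E F] [IsScalarTower ℂ E F]
  [IsScalarTower E F F] [SMulCommClass E F F] [StarModule E F] [IsBoundedSMul E F]

theorem lmap_sigmaHom (n : ℕ) (X : K.Lv (Check E F) n) :
    K.toSchurTower.lmap (Check.sigmaHom E F) n X =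
      K.toSchurTower.unitMap (Check E F) n (K.toSchurTower.lmap (Check.piHom E F) n X) := by
  rw [Check.sigmaHom, ← SchurTower.lmap_comp]
  rfl
end

namespace IsExactPair

variable {R R' R'' : Type*} [CStarAlgebra R] [Algebra E R] [StarModule E R]
  [CStarAlgebra R'] [Algebra E R'] [StarModule E R'] [IsScalarTower ℂ E R']
  [CStarAlgebra R''] [Algebra E R''] [StarModule E R''] [IsScalarTower ℂ E R'']
  {π : R →⋆ₐ[E] E} {φ : R →⋆ₐ[E] R'} {ψ : R' →⋆ₐ[E] R''}

theorem k1FullMap_k1FullMap [IsScalarTower ℂ E R] (h : IsExactPair π φ ψ) (x : K.K1Full R) :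
    K.k1FullMap ψ (K.k1FullMap φ x) = 0 := by
  obtain ⟨n, U, rfl⟩ := K.class1_surjective x
  rw [k1FullMap_class1, k1FullMap_class1, h.unMap_unMap]
  exact K.class1_eq_zero_of_mem ⟨_, Joined.refl _⟩

theorem indexHom_k1FullMap (h : IsExactPair π φ ψ) (x : K.K1Full R') :
    h.indexHom (K.k1FullMap ψ x) = 0 := by
  obtain ⟨n, U, rfl⟩ := K.class1_surjective x
  rw [k1FullMap_class1, indexHom_class1, index_unMap]

theorem k0FullMap_augmentation_indexHom (h : IsExactPair π φ ψ)
    (hE : Function.Injective (algebraMap E R'')) (x : K.K1Full R'') :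
    K.k0FullMap π (h.indexHom x) = 0 := by
  obtain ⟨n, U, rfl⟩ := K.class1_surjective x
  obtain ⟨V, P, hV⟩ := h.exists_isIndexLift n U
  rw [indexHom_class1, h.index_eq hV, map_sub, k0FullMap_class0, k0FullMap_class0,
    K.class0_congr (hQ := K.aa_isStarProjection n) (h.lmap_augmentation hV hE),
    K.class0_congr (hQ := K.isStarProjection_one n) (map_one _), class0_aa, sub_self]

theorem k0FullMap_indexHom (h : IsExactPair π φ ψ) (x : K.K1Full R'') :
    K.k0FullMap φ (h.indexHom x) = 0 := by
  obtain ⟨n, U, rfl⟩ := K.class1_surjective x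
  obtain ⟨V, P, hV⟩ := h.exists_isIndexLift n U
  have ha := K.aa_isStarProjection (R := R') n
  have e : K.class0 (n + 1) (K.aa R' n) ha = K.class0 (n + 1) _ (conj_isStarProjection V ha) :=
    K.class0_eq_of_mvn _ _ (V * K.aa R' n) (by
      rw [star_mul, mul_assoc, ← mul_assoc (star (V : K.Lv R' (n + 1))), Unitary.coe_star_mul_self,
        one_mul, ha.isSelfAdjoint.star_eq, ha.isIdempotentElem.eq]) (by
      rw [star_mul, mul_assoc, ← mul_assoc (K.aa R' n), ha.isSelfAdjoint.star_eq,
        ha.isIdempotentElem.eq, mul_assoc])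
  rw [indexHom_class1, h.index_eq hV, map_sub, k0FullMap_class0, k0FullMap_class0,
    K.class0_congr (hQ := conj_isStarProjection V ha) hV.map_P, ← e,
    K.class0_congr (hQ := K.isStarProjection_one n) (map_one _), class0_aa, sub_self]

theorem k0FullMap_k0FullMap (h : IsExactPair π φ ψ) {x : K.K0Full R}
    (hx : K.k0FullMap π x = 0) : K.k0FullMap ψ (K.k0FullMap φ x) = 0 := by
  have e : ψ.comp φ = (unitHom R'').comp π := StarAlgHom.ext h.map_map
  rw [k0FullMap_comp, e, ← k0FullMap_comp, hx, map_zero]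

end IsExactPair
end ProjKData

end ProjK

end

theorem theorem974 {E T F G H : Type*} [CommCStarAlgebra E] [Group T]
    (K : ProjK.ProjKData E T)
    [NonUnitalCStarAlgebra F] [Module E F] [IsScalarTower ℂ E F] [IsScalarTower E F F]
    [SMulCommClass E F F] [StarModule E F] [IsBoundedSMul E F]
    [NonUnitalCStarAlgebra G] [Module E G] [IsScalarTower ℂ E G] [IsScalarTower E G G]
    [SMulCommClass E G G] [StarModule E G] [IsBoundedSMul E G]
    [NonUnitalCStarAlgebra H] [Module E H] [IsScalarTower ℂ E H] [IsScalarTower E H H]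
    [SMulCommClass E H H] [StarModule E H] [IsBoundedSMul E H]
    (φ : F →⋆ₙₐ[E] G) (ψ : G →⋆ₙₐ[E] H)
    (hφ : Function.Injective φ) (hφψ : Function.Exact φ ψ) (hψ : Function.Surjective ψ) :
    ∃ δ : K.K1 H →+ K.K0 F,
      K.IsIndexMap φ ψ δ ∧ (∀ δ' : K.K1 H →+ K.K0 F, K.IsIndexMap φ ψ δ' → δ' = δ) ∧
      Function.Exact (K.K1Map φ) (K.K1Map ψ) ∧
      Function.Exact (K.K1Map ψ) δ ∧
      Function.Exact δ (K.K0Map φ) ∧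
      Function.Exact (K.K0Map φ) (K.K0Map ψ) := by
  have h := ProjK.Check.isExactPair hφ hφψ hψ
  have hE : Function.Injective (algebraMap E (ProjK.Check E H)) := ProjK.Check.algebraMap_injective
  have key : ∀ (n : ℕ) (U : unitary (K.Lv (ProjK.Check E H) n)) V P,
      ∀ hV : K.IsIndexLift (ProjK.Check.mapHom φ) (ProjK.Check.mapHom ψ) n U V P,
      h.indexHom (K.class1 n U) =
        K.class0Diff (ProjK.Check.sigmaHom E F) (n + 1) P hV.isStarProjection := by
    intro n U V P hV
    have e : K.toSchurTower.lmap (ProjK.Check.sigmaHom E F) (n + 1) P =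
        K.aa (ProjK.Check E F) n := by
      rw [ProjK.ProjKData.lmap_sigmaHom, h.lmap_augmentation hV hE, K.unitMap_aa]
    rw [h.indexHom_class1, h.index_eq hV, ProjK.ProjKData.class0Diff, sub_right_inj,
      K.class0_congr (hQ := K.aa_isStarProjection n) e, K.class0_aa]
  let δ : K.K1 H →+ K.K0 F := h.indexHom.codRestrict (K.K0 F) fun x =>
    h.k0FullMap_augmentation_indexHom hE x
  refine ⟨δ, fun n U => ⟨h.exists_isIndexLift n U, key n U⟩, ?_, ?_, ?_, ?_, ?_⟩
  · intro δ' hδ'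
    refine AddMonoidHom.ext fun x => ?_
    obtain ⟨n, U, rfl⟩ := K.class1_surjective x
    obtain ⟨⟨V, P, hV⟩, hval⟩ := hδ' n U
    exact Subtype.ext ((hval V P hV).trans (key n U V P hV).symm)
  · exact fun y => ⟨fun hy => h.exists_k1FullMap_eq hy, by
      rintro ⟨x, rfl⟩; exact h.k1FullMap_k1FullMap x⟩
  · exact fun y => ⟨fun hy =>
      h.exists_k1FullMap_eq_of_indexHom_eq_zero hE (congrArg Subtype.val hy), by
      rintro ⟨x, rfl⟩; exact Subtype.ext (h.indexHom_k1FullMap x)⟩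
  · refine fun y => ⟨fun hy => ?_, ?_⟩
    · obtain ⟨x, hx⟩ := h.exists_indexHom_eq y.2 (congrArg Subtype.val hy)
      exact ⟨x, Subtype.ext hx⟩
    · rintro ⟨x, rfl⟩
      exact Subtype.ext (h.k0FullMap_indexHom x)
  · refine fun y => ⟨fun hy => ?_, ?_⟩
    · obtain ⟨x, hx, hxy⟩ := h.exists_k0FullMap_eq (ProjK.Check.piHom E G) y.2
        (congrArg Subtype.val hy)
      exact ⟨⟨x, hx⟩, Subtype.ext hxy⟩
    · rintro ⟨x, rfl⟩
      exact Subtype.ext (h.k0FullMap_k0FullMap x.2)
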